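/- Consider a $K$-user MIMO interference network: transmitter $i$ has $N_i$ antennas, receiver $j$ has $M_j$ antennas, and user $i$ sends $d_i$ data streams. The channel matrices $H_{ji}\in\mathbb{C}^{M_j\times N_i}$ (from transmitter $i$ to receiver $j$) have entries which, over all $i,j$, are i.i.d. circularly symmetric complex Gaussian with mean $0$ and variance $1$. A feedback profile $\mathcal{L}$ consists of integers $0\le M_j^s\le M_j$, $0\le N_i^s\le N_i$ and, for every $j$, a partition of $\{i: i\ne j\}$ into four sets $\Omega_j^{I},\Omega_j^{II},\Omega_j^{III},\Omega_j^{IV}$. Let $H_{ji}^s$ be the upper left $M_j^s\times N_i^s$ submatrix of $H_{ji}$, and put $$M_j^e=M_j^s-\sum_{i\in\Omega_j^{II}}N_i^s,\qquad N_i^e=N_i^s-\sum_{j:\,i\in\Omega_j^{III}}M_j^e,\qquad d_j^0=d_j+\sum_{i\in\Omega_j^{I}}d_i .$$ Let $S_j^r\in\mathbb{C}^{M_j^s\times M_j^e}$ have orthonormal columns that span the left null space $\{u: u^\dagger H_{ji}^s=0\ \forall i\in\Omega_j^{II}\}$. Receiver $j$ feeds back the tuple $F_j$ consisting of the null spaces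 of $(S_j^r)^\dagger H_{jp}^s$, $p\in\Omega_j^{III}$, and of the row space of the concatenated matrix $[\cdots\,(S_j^r)^\dagger H_{jq}^s\,\cdots]_{q\in\Omega_j^{IV}}$. Let $S_i^t\in\mathbb{C}^{N_i^s\times N_i^e}$ have orthonormal columns that span $\bigcap_{j:\,i\in\Omega_j^{III}}\ker\big((S_j^r)^\dagger H_{ji}^s\big)$. The interference alignment problem is called almost surely feasible under $\mathcal{L}$ if there are precoders $V_i\in\mathbb{C}^{N_i\times d_i}$, which are functions of the feedback $(F_1,\dots,F_K)$ only, such that almost surely the following hold. Every $V_i$ has the form $V_i=\begin{bmatrix}S_i^tV_i^a\\0\end{bmatrix}$ with $V_i^a\in\mathbb{C}^{N_i^e\times d_i}$; there are decorrelators of the form $U_j=\begin{bmatrix}S_j^rR_j^\dagger U_j^a\\0\end{bmatrix}\in\mathbb{C}^{M_j\times d_j}$ with $R_j\in\mathbb{C}^{M_j^e\times M_j^e}$ invertible and $U_j^a\in\mathbb{C}^{M_j^e\times d_j}$ such that $$\operatorname{rank}(U_j^\dagger H_{jj}V_j)=d_j\ \ \forall j,\qquad U_j^\dagger H_{ji}V_i=0\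 \ \forall i\ne j;$$ and there are also decorrelators $U_j\in\mathbb{C}^{M_j\times d_j}$, not necessarily of this form, that satisfy the same equations and in which each $U_j$ is a function of $(H_{ji}V_i)_{i=1,\dots,K}$ only. Suppose that $d_i=d$ for all $i$, that $d\mid M_i^s$ and $d\mid N_i^s$ for all $i$, and that the following three conditions hold: 1. $N_i^e\ge d_i$ for all $i$; 2. $M_j^e\ge d_j^0$ for all $j$; 3. with $V_i=d_i(N_i^e-d_i)$, $U_j=d_j^0(M_j^e-d_j^0)$ and $C_{ji}=d_j^0d_i$ (integers, not to be confused with the matrices above), for every set $\Omega_{sub}\subseteq\{(j,i): i\in\Omega_j^{IV}\}$, $$\sum_{j\in\mathrm{pr}_1(\Omega_{sub})}U_j+\sum_{i\in\mathrm{pr}_2(\Omega_{sub})}V_i\ \ge\sum_{(j,i)\in\Omega_{sub}}C_{ji},$$ where $\mathrm{pr}_1(\Omega_{sub})$ and $\mathrm{pr}_2(\Omega_{sub})$ are the sets of first and of second entries of the pairs in $\Omega_{sub}$ (every index counted once). Then the interference alignment problem is almost surely feasible under $\mathcal{L}$. -/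

import Mathlib

open MeasureTheory ProbabilityTheory
open scoped Matrix

noncomputable section

namespace InterferenceAlignment

/-! ### Random channels -/

/-- The circularly symmetric complex Gaussian law with mean zero and unit variance
(independent real and imaginary parts, each centred with variance one half). -/
def complexGaussian : Measure ℂ :=
  ((gaussianReal 0 (1 / 2)).prod (gaussianReal 0 (1 / 2))).map
    (fun p : ℝ × ℝ => (p.1 : ℂ) + (p.2 : ℂ) * Complex.I)

/-- All channel matrices of a `K`-user network: `H j i` is the `M j × N i` matrix from
transmitter `i` to receiver `j`. -/
abbrev Channels {K : ℕ} (M N : Fin K → ℕ) : Type :=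
  ∀ j i : Fin K, Matrix (Fin (M j)) (Fin (N i)) ℂ

/-- The joint law of the entries `E j i a b` of the channel matrices: all entries of all the
matrices are independent and complex Gaussian with mean zero and unit variance. -/
def channelLaw {K : ℕ} (M N : Fin K → ℕ) :
    Measure (∀ j i : Fin K, Fin (M j) → Fin (N i) → ℂ) :=
  Measure.pi fun j => Measure.pi fun i =>
    Measure.pi fun _ : Fin (M j) => Measure.pi fun _ : Fin (N i) => complexGaussian

/-! ### Linear algebra -/

/-- The span of the columns of a matrix. -/
def colSpan {m n : Type*} [Fintype n] (A : Matrix m n ℂ) : Submodule ℂ (m → ℂ) :=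
  LinearMap.range A.mulVecLin

/-- The null space `{v | A v = 0}`. -/
def nullSpace {m n : Type*} [Fintype n] (A : Matrix m n ℂ) : Submodule ℂ (n → ℂ) :=
  LinearMap.ker A.mulVecLin

/-- The left null space `{u | u† A = 0}` (equivalently `A† u = 0`). -/
def leftNullSpace {m n : Type*} [Fintype m] (A : Matrix m n ℂ) : Submodule ℂ (m → ℂ) :=
  LinearMap.ker Aᴴ.mulVecLin

/-- `S† S = I` and the columns of `S` span `W`. -/
def IsOrthonormalBasisMatrix {m n : Type*} [Fintype m] [Fintype n] [DecidableEq n]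
    (S : Matrix m n ℂ) (W : Submodule ℂ (m → ℂ)) : Prop :=
  Sᴴ * S = 1 ∧ colSpan S = W

/-- The block matrix with `A` on top and zero rows below. -/
def padRows {m : ℕ} (M : ℕ) {n : Type*} (A : Matrix (Fin m) n ℂ) : Matrix (Fin M) n ℂ :=
  Matrix.of fun a b => if h : (a : ℕ) < m then A ⟨a, h⟩ b else 0

/-- The null space of `S† A`, for any matrix `S` whose columns span `W`
(see `projNullSpace_colSpan`). -/
def projNullSpace {m n : Type*} [Fintype m] [Fintype n]
    (W : Submodule ℂ (m → ℂ)) (A : Matrix m n ℂ) : Submodule ℂ (n → ℂ) where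
  carrier := {v | ∀ u ∈ W, star u ⬝ᵥ (A *ᵥ v) = 0}
  add_mem' := fun ha hb u hu => by
    rw [Matrix.mulVec_add, dotProduct_add, ha u hu, hb u hu, add_zero]
  zero_mem' := fun u _ => by simp
  smul_mem' := fun c v hv u hu => by
    rw [Matrix.mulVec_smul, dotProduct_smul, hv u hu, smul_zero]

/-- The span of the columns of `(S† A)ᵀ`, i.e. the row space of `S† A`, for any matrix `S`
whose columns span `W` (see `projRowSpace_colSpan`). -/
def projRowSpace {m n : Type*} [Fintype m]
    (W : Submodule ℂ (m → ℂ)) (A : Matrix m n ℂ) : Submodule ℂ (n → ℂ) :=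
  Submodule.span ℂ ((fun u => star u ᵥ* A) '' (W : Set (m → ℂ)))

theorem projNullSpace_colSpan {m n r : Type*} [Fintype m] [Fintype n] [Fintype r]
    (S : Matrix m r ℂ) (A : Matrix m n ℂ) :
    projNullSpace (colSpan S) A = nullSpace (Sᴴ * A) := by
  classical
  ext v
  have key : ∀ c : r → ℂ, star (S *ᵥ c) ⬝ᵥ (A *ᵥ v) = star c ⬝ᵥ ((Sᴴ * A) *ᵥ v) := by
    intro c
    rw [Matrix.star_mulVec, ← Matrix.dotProduct_mulVec, Matrix.mulVec_mulVec]
  constructor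
  · intro h
    change (Sᴴ * A) *ᵥ v = 0
    have h' := h (S *ᵥ ((Sᴴ * A) *ᵥ v)) ⟨_, rfl⟩
    rw [key] at h'
    open scoped ComplexOrder in
    exact dotProduct_star_self_eq_zero.mp h'
  · rintro h _ ⟨c, rfl⟩
    have h' : (Sᴴ * A) *ᵥ v = 0 := h
    change star (S *ᵥ c) ⬝ᵥ (A *ᵥ v) = 0
    rw [key, h', dotProduct_zero]

theorem projRowSpace_colSpan {m n r : Type*} [Fintype m] [Fintype r]
    (S : Matrix m r ℂ) (A : Matrix m n ℂ) :
    projRowSpace (colSpan S) A = colSpan (Sᴴ * A)ᵀ := by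
  have key : ∀ c : r → ℂ, star (S *ᵥ c) ᵥ* A = (Sᴴ * A)ᵀ *ᵥ star c := by
    intro c
    rw [Matrix.star_mulVec, Matrix.vecMul_vecMul, Matrix.mulVec_transpose]
  apply le_antisymm
  · refine Submodule.span_le.mpr ?_
    rintro _ ⟨_, ⟨c, rfl⟩, rfl⟩
    exact ⟨star c, (key c).symm⟩
  · rintro _ ⟨c, rfl⟩
    refine Submodule.subset_span ⟨S *ᵥ star c, ⟨_, rfl⟩, ?_⟩
    change star (S *ᵥ star c) ᵥ* A = (Sᴴ * A)ᵀ *ᵥ c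
    rw [key, star_star]

/-! ### Feedback profiles -/

/-- A feedback profile: the sizes of the channel submatrices that are used, and for every
receiver `j` a partition of the cross links `{i | i ≠ j}` into four classes. -/
structure FeedbackProfile {K : ℕ} (M N : Fin K → ℕ) where
  Ms : Fin K → ℕ
  Ns : Fin K → ℕ
  Ms_le : ∀ j, Ms j ≤ M j
  Ns_le : ∀ i, Ns i ≤ N i
  ΩI : Fin K → Finset (Fin K)
  ΩII : Fin K → Finset (Fin K)
  ΩIII : Fin K → Finset (Fin K)
  ΩIV : Fin K → Finset (Fin K)
  union_eq : ∀ j, ΩI j ∪ ΩII j ∪ ΩIII j ∪ ΩIV j = Finset.univ.erase j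
  disjoint : ∀ j, [ΩI j, ΩII j, ΩIII j, ΩIV j].Pairwise Disjoint

namespace FeedbackProfile

variable {K : ℕ} {M N : Fin K → ℕ} (L : FeedbackProfile M N)

/-- `M_j^e = M_j^s - ∑_{i ∈ Ω_j^II} N_i^s`. -/
def Me (j : Fin K) : ℤ := (L.Ms j : ℤ) - ∑ i ∈ L.ΩII j, (L.Ns i : ℤ)

/-- `N_i^e = N_i^s - ∑_{j : i ∈ Ω_j^III} M_j^e`. -/
def Ne (i : Fin K) : ℤ :=
  (L.Ns i : ℤ) - ∑ j ∈ Finset.univ.filter (fun j => i ∈ L.ΩIII j), L.Me j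

/-- `d_j^0 = d_j + ∑_{i ∈ Ω_j^I} d_i`. -/
def dZero (d : Fin K → ℕ) (j : Fin K) : ℕ := d j + ∑ i ∈ L.ΩI j, d i

/-- `U_j = d_j^0 (M_j^e - d_j^0)`. -/
def Uvar (d : Fin K → ℕ) (j : Fin K) : ℤ := L.dZero d j * (L.Me j - L.dZero d j)

/-- `V_i = d_i (N_i^e - d_i)`. -/
def Vvar (d : Fin K → ℕ) (i : Fin K) : ℤ := d i * (L.Ne i - d i)

/-- `C_{ji} = d_j^0 d_i`. -/
def Ccon (d : Fin K → ℕ) (j i : Fin K) : ℤ := L.dZero d j * d i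

/-- `H_{ji}^s`, the upper left `M_j^s × N_i^s` submatrix of `H_{ji}`. -/
def subChannel (H : Channels M N) (j i : Fin K) :
    Matrix (Fin (L.Ms j)) (Fin (L.Ns i)) ℂ :=
  (H j i).submatrix (Fin.castLE (L.Ms_le j)) (Fin.castLE (L.Ns_le i))

/-- The horizontal concatenation `[⋯ H_{ji}^s ⋯]` over `i ∈ T`. -/
def concat (H : Channels M N) (j : Fin K) (T : Finset (Fin K)) :
    Matrix (Fin (L.Ms j)) ((i : T) × Fin (L.Ns i)) ℂ :=
  Matrix.of fun a c => L.subChannel H j c.1 a c.2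

/-- The left null space of `[⋯ H_{ji}^s ⋯]_{i ∈ Ω_j^II}`, i.e. the span of `S_j^r`. -/
def rxSpace (H : Channels M N) (j : Fin K) : Submodule ℂ (Fin (L.Ms j) → ℂ) :=
  leftNullSpace (L.concat H j (L.ΩII j))

/-- The type of the partial channel information fed back by receiver `j`: one subspace for
every link in class III, and one subspace for all the links in class IV together. -/
abbrev FeedbackTuple (j : Fin K) : Type :=
  ((p : L.ΩIII j) → Submodule ℂ (Fin (L.Ns p) → ℂ)) ×
    Submodule ℂ (((q : L.ΩIV j) × Fin (L.Ns q)) → ℂ)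

/-- The feedback function `F_j`: the null spaces of `(S_j^r)† H_{jp}^s` for `p` in class III
and the row space of `[⋯ (S_j^r)† H_{jq}^s ⋯]`, `q` in class IV. -/
def feedback (H : Channels M N) (j : Fin K) : L.FeedbackTuple j :=
  (fun p => projNullSpace (L.rxSpace H j) (L.subChannel H j p),
    projRowSpace (L.rxSpace H j) (L.concat H j (L.ΩIV j)))

/-- The intersection of the fed back null spaces `N((S_j^r)† H_{ji}^s)` over all `j` with
`i ∈ Ω_j^III`, i.e. the span of `S_i^t`. -/
def txSpace (F : ∀ j, L.FeedbackTuple j) (i : Fin K) : Submodule ℂ (Fin (L.Ns i) → ℂ) :=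
  ⨅ (j : Fin K) (h : i ∈ L.ΩIII j), (F j).1 ⟨i, h⟩

/-- `V = [S_i^t V_i^a ; 0]` with `S_i^t` of size `N_i^s × N_i^e`. -/
def IsStructuredPrecoder (F : ∀ j, L.FeedbackTuple j) (i : Fin K) {e : ℕ}
    (V : Matrix (Fin (N i)) (Fin e) ℂ) : Prop :=
  ∃ (St : Matrix (Fin (L.Ns i)) (Fin (L.Ne i).toNat) ℂ)
    (Va : Matrix (Fin (L.Ne i).toNat) (Fin e) ℂ),
    IsOrthonormalBasisMatrix St (L.txSpace F i) ∧ V = padRows (N i) (St * Va)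

/-- `U = [S_j^r R_j† U_j^a ; 0]` with `S_j^r` of size `M_j^s × M_j^e` and `R_j` invertible. -/
def IsStructuredDecorrelator (H : Channels M N) (j : Fin K) {e : ℕ}
    (U : Matrix (Fin (M j)) (Fin e) ℂ) : Prop :=
  ∃ (Sr : Matrix (Fin (L.Ms j)) (Fin (L.Me j).toNat) ℂ)
    (R : Matrix (Fin (L.Me j).toNat) (Fin (L.Me j).toNat) ℂ)
    (Ua : Matrix (Fin (L.Me j).toNat) (Fin e) ℂ),
    IsOrthonormalBasisMatrix Sr (L.rxSpace H j) ∧ IsUnit R ∧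
      U = padRows (M j) (Sr * Rᴴ * Ua)

end FeedbackProfile

/-! ### The interference alignment problem -/

/-- The interference alignment equations: every desired link keeps all its streams and all
the interference is nulled. -/
def IsAligned {K : ℕ} {M N : Fin K → ℕ} (d : Fin K → ℕ) (H : Channels M N)
    (V : ∀ i, Matrix (Fin (N i)) (Fin (d i)) ℂ)
    (U : ∀ j, Matrix (Fin (M j)) (Fin (d j)) ℂ) : Prop :=
  (∀ j, ((U j)ᴴ * H j j * V j).rank = d j) ∧
    ∀ j i, i ≠ j → (U j)ᴴ * H j i * V i = 0

/-- Almost sure feasibility of the interference alignment problem under a feedback profile.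
The precoders are functions `v` of the partial channel information that is fed back, and of
the prescribed form. Decorrelators of the prescribed form solve the alignment equations
together with them, and so do decorrelators which receiver `j` can compute by a function
`u j` of its effective channels `(H j i * V i)_i` only. -/
def FeedbackProfile.AlmostSurelyFeasible {K : ℕ} {M N : Fin K → ℕ}
    (L : FeedbackProfile M N) (d : Fin K → ℕ) : Prop :=
  ∃ (v : (∀ j, L.FeedbackTuple j) → ∀ i, Matrix (Fin (N i)) (Fin (d i)) ℂ)
    (u : ∀ j, (∀ i, Matrix (Fin (M j)) (Fin (d i)) ℂ) → Matrix (Fin (M j)) (Fin (d j)) ℂ),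
    ∀ᵐ E ∂(channelLaw M N),
      let H : Channels M N := fun j i => Matrix.of (E j i)
      let V := v (L.feedback H)
      (∀ i, L.IsStructuredPrecoder (L.feedback H) i (V i)) ∧
      (∃ U : ∀ j, Matrix (Fin (M j)) (Fin (d j)) ℂ,
        (∀ j, L.IsStructuredDecorrelator H j (U j)) ∧ IsAligned d H V U) ∧
      IsAligned d H V (fun j => u j fun i => H j i * V i)

end InterferenceAlignment

end

/-! Almost surely all channel entries are algebraically independent over ℚ
(`ae_algebraicIndependent`). From there the argument is deterministic: fix such a point, keep track
of which algebraically closed subfield of ℂ each object lives in, and use two principles. A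
polynomial over a field `k` that is nonzero somewhere is nonzero at entries independent over `k`
(`IsPolyOn.ne_zero`), so nondegeneracy need only be checked at one hand-picked channel. A polynomial
system over an algebraically closed subfield that is solvable in ℂ is solvable in that subfield
(`exists_zero_mem`).

After reordering, the rows of `[1 X_j]` span the vectors annihilating class II from the left, and
the columns of `[1; Y_i]` span the transmit space, with `X_j` and `Y_i` algebraic over the entries
of classes II and III. Class IV alignment asks for `[1 C_j] W_{ji} [1; v_i] = 0`, where `W_{ji}` is
the effective channel. Its upper left block contains fresh entries `a` that are independent of
everything else in the equations, so the system reads `φ(v, C) = a` with `φ` polynomial. A dominant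
`φ` attains the generic value `a` (`exists_eval_eq_of_algebraicIndependent`), and `φ` is dominant
once its derivative at the origin is surjective (`eq_zero_of_surjective_deriv`). Surjectivity
(`linEq_surjective`) is a determinant condition, verified at a special channel: the counting
hypothesis gives, by Hall's theorem, a private variable for each scalar equation
(`exists_injective_assignment`). Divisibility by `d` lets everything be cut into `d × d` blocks, so
that the special channel is a scalar one tensored with the identity.

The precoders must depend on the feedback alone, and the receivers must still separate the desired
streams. The precoder conditions are polynomial over the algebraically closed field generated by
canonical bases of the fed back subspaces, so a solution can be chosen inside that field
(`IsFeedbackPrecoder.exists_mem_feedbackField`). Such precoders are algebraic over classes II, III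
and IV, hence the direct and class I links are still generic relative to them. After class IV has
been projected away, a square matrix built from those links is invertible, and its inverse yields
the decorrelators (`exists_decorrelators`). -/

open MeasureTheory ProbabilityTheory
open scoped Matrix

noncomputable section

namespace InterferenceAlignment

/-! ### Algebraically closed fields of definition -/

/-- The algebraic closure in `ℂ` of the field generated by `s`. -/
def acl (s : Set ℂ) : IntermediateField ℚ ℂ :=
  (algebraicClosure (IntermediateField.adjoin ℚ s) ℂ).restrictScalars ℚ

theorem mem_acl {s : Set ℂ} {x : ℂ} :
    x ∈ acl s ↔ IsAlgebraic (IntermediateField.adjoin ℚ s) x := by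
  rw [acl, IntermediateField.mem_restrictScalars, mem_algebraicClosure_iff]

theorem subset_acl (s : Set ℂ) : s ⊆ acl s := fun x hx =>
  mem_acl.2 (isAlgebraic_algebraMap
    (⟨x, IntermediateField.subset_adjoin ℚ s hx⟩ : IntermediateField.adjoin ℚ s))

instance isAlgClosed_acl (s : Set ℂ) : IsAlgClosed (acl s) :=
  IsAlgClosure.isAlgClosed (K := algebraicClosure (IntermediateField.adjoin ℚ s) ℂ)
    (IntermediateField.adjoin ℚ s)

/-- Algebraicity is transitive: an element algebraic over ℚ(s) is algebraic over `acl t`, which is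
algebraically closed and so contains it. -/
theorem acl_le {s t : Set ℂ} (h : s ⊆ acl t) : acl s ≤ acl t := by
  intro x hx
  rw [mem_acl] at hx
  have hle : IntermediateField.adjoin ℚ s ≤ acl t := IntermediateField.adjoin_le_iff.2 h
  let _ : Algebra (IntermediateField.adjoin ℚ s) (acl t) :=
    (IntermediateField.inclusion hle).toRingHom.toAlgebra
  have : IsScalarTower (IntermediateField.adjoin ℚ s) (acl t) ℂ :=
    IsScalarTower.of_algebraMap_eq fun _ => rfl
  have hx' : IsAlgebraic (acl t) x := hx.tower_top _
  have hx'' := mem_algebraicClosure_iff.2 hx'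
  rw [(IsAlgClosed.algebraicClosure_eq_bot_iff (acl t) ℂ).2 inferInstance,
    IntermediateField.mem_bot] at hx''
  obtain ⟨y, hy⟩ := hx''
  exact hy ▸ y.2

theorem acl_mono {s t : Set ℂ} (h : s ⊆ t) : acl s ≤ acl t :=
  acl_le (h.trans (subset_acl t))

/-- The source of all genericity below: disjoint groups of channel entries stay independent when one
group, together with everything algebraic over it, is treated as constants. -/
theorem algebraicIndependent_acl {σ : Type*} {E : σ → ℂ}
    (hE : AlgebraicIndependent ℚ E) {S T : Set σ} (h : Disjoint S T) :
    AlgebraicIndependent (acl (E '' S)) (fun t : T => E t) := by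
  have h1 := hE.adjoin_of_disjoint h
  rw [← IntermediateField.algebraicIndependent_adjoin_iff] at h1
  exact h1.algebraicClosure

/-! ### Polynomial functions over a subfield -/

/-- `f` is a polynomial function over `k` in the coordinates from `T`. -/
def IsPolyOn {σ : Type*} (k : IntermediateField ℚ ℂ) (T : Set σ) (f : (σ → ℂ) → ℂ) : Prop :=
  ∃ p : MvPolynomial T k, ∀ e, f e = MvPolynomial.aeval (fun t : T => e t) p

namespace IsPolyOn

variable {σ : Type*} {k : IntermediateField ℚ ℂ} {T : Set σ} {f g : (σ → ℂ) → ℂ}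

theorem const {c : ℂ} (hc : c ∈ k) : IsPolyOn k T fun _ => c :=
  ⟨MvPolynomial.C ⟨c, hc⟩, fun e => by rw [MvPolynomial.aeval_C]; rfl⟩

theorem zero : IsPolyOn k T fun _ => 0 := const k.zero_mem

theorem one : IsPolyOn k T fun _ => 1 := const k.one_mem

theorem coord {t : σ} (ht : t ∈ T) : IsPolyOn k T fun e => e t :=
  ⟨MvPolynomial.X ⟨t, ht⟩, fun e => by rw [MvPolynomial.aeval_X]⟩

theorem add (hf : IsPolyOn k T f) (hg : IsPolyOn k T g) : IsPolyOn k T fun e => f e + g e := by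
  obtain ⟨p, hp⟩ := hf
  obtain ⟨q, hq⟩ := hg
  exact ⟨p + q, fun e => by simp only [map_add, hp, hq]⟩

theorem sub (hf : IsPolyOn k T f) (hg : IsPolyOn k T g) : IsPolyOn k T fun e => f e - g e := by
  obtain ⟨p, hp⟩ := hf
  obtain ⟨q, hq⟩ := hg
  exact ⟨p - q, fun e => by simp only [map_sub, hp, hq]⟩

theorem mul (hf : IsPolyOn k T f) (hg : IsPolyOn k T g) : IsPolyOn k T fun e => f e * g e := by
  obtain ⟨p, hp⟩ := hf
  obtain ⟨q, hq⟩ := hg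
  exact ⟨p * q, fun e => by simp only [map_mul, hp, hq]⟩

theorem sum {α : Type*} (s : Finset α) {f : α → (σ → ℂ) → ℂ}
    (hf : ∀ a ∈ s, IsPolyOn k T (f a)) : IsPolyOn k T fun e => ∑ a ∈ s, f a e := by
  classical
  induction s using Finset.induction_on with
  | empty => simpa using zero
  | insert a s ha ih =>
    simp only [Finset.sum_insert ha]
    exact (hf a (Finset.mem_insert_self a s)).add
      (ih fun b hb => hf b (Finset.mem_insert_of_mem hb))

theorem prod {α : Type*} (s : Finset α) {f : α → (σ → ℂ) → ℂ}
    (hf : ∀ a ∈ s, IsPolyOn k T (f a)) : IsPolyOn k T fun e => ∏ a ∈ s, f a e := by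
  classical
  induction s using Finset.induction_on with
  | empty => simpa using one
  | insert a s ha ih =>
    simp only [Finset.prod_insert ha]
    exact (hf a (Finset.mem_insert_self a s)).mul
      (ih fun b hb => hf b (Finset.mem_insert_of_mem hb))

theorem matrix_mul {l m n : Type*} [Fintype m] {A : (σ → ℂ) → Matrix l m ℂ}
    {B : (σ → ℂ) → Matrix m n ℂ} (hA : ∀ a b, IsPolyOn k T fun e => A e a b)
    (hB : ∀ a b, IsPolyOn k T fun e => B e a b) (a : l) (b : n) :
    IsPolyOn k T fun e => (A e * B e) a b := by
  simp only [Matrix.mul_apply]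
  exact sum _ fun c _ => (hA a c).mul (hB c b)

theorem det {m : Type*} [Fintype m] [DecidableEq m] {A : (σ → ℂ) → Matrix m m ℂ}
    (hA : ∀ a b, IsPolyOn k T fun e => A e a b) : IsPolyOn k T fun e => (A e).det := by
  simp only [Matrix.det_apply]
  refine sum _ fun τ _ => ?_
  have hs : ∀ x : ℂ, Equiv.Perm.sign τ • x = ((Equiv.Perm.sign τ : ℤ) : ℂ) * x := fun x => by
    rw [Units.smul_def, zsmul_eq_mul]
  simp only [hs]
  exact (const (by exact_mod_cast intCast_mem k _)).mul (prod _ fun c _ => hA _ _)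

/-- A polynomial function over `k` which does not vanish identically does not vanish at a point
whose coordinates are algebraically independent over `k`. -/
theorem ne_zero (hf : IsPolyOn k T f) {E : σ → ℂ}
    (hE : AlgebraicIndependent k (fun t : T => E t)) {e : σ → ℂ} (he : f e ≠ 0) : f E ≠ 0 := by
  obtain ⟨p, hp⟩ := hf
  intro h0
  rw [hp] at h0 he
  exact he (by rw [(algebraicIndependent_iff.1 hE) p h0, map_zero])

end IsPolyOn

/-! ### Solving polynomial systems over subfields of ℂ -/

open MvPolynomial in
/-- Polynomial equations over an algebraically closed subfield of `ℂ` that have a complex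
solution have a solution in the subfield. -/
theorem exists_zero_mem {σ ι : Type*} [Finite σ] (k : IntermediateField ℚ ℂ) [IsAlgClosed k]
    (f : ι → (σ → ℂ) → ℂ) (hf : ∀ i, IsPolyOn k Set.univ (f i)) (z : σ → ℂ)
    (hz : ∀ i, f i z = 0) : ∃ w : σ → ℂ, (∀ s, w s ∈ k) ∧ ∀ i, f i w = 0 := by
  choose p hp using hf
  set I : Ideal (MvPolynomial (Set.univ : Set σ) k) := Ideal.span (Set.range p) with hI
  have hne : (zeroLocus k I).Nonempty := by
    by_contra h
    rw [Set.not_nonempty_iff_eq_empty] at h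
    have h1 : (1 : MvPolynomial (Set.univ : Set σ) k) ∈ I.radical := by
      rw [← vanishingIdeal_zeroLocus_eq_radical (K := k) I, h, vanishingIdeal_empty]
      trivial
    -- Evaluation at the complex solution `z` kills `I` but not 1, so the Nullstellensatz over `k`
    -- supplies a zero in `k`.
    have h2 : I ≤ RingHom.ker (aeval (R := k) (fun t : (Set.univ : Set σ) => z t)) := by
      rw [hI, Ideal.span_le]
      rintro _ ⟨i, rfl⟩
      exact (hp i z).symm.trans (hz i)
    obtain ⟨n, hn⟩ := h1
    have h3 := h2 hn
    rw [one_pow, RingHom.mem_ker, map_one] at h3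
    exact one_ne_zero h3
  obtain ⟨w, hw⟩ := hne
  refine ⟨fun s => w ⟨s, trivial⟩, fun s => (w ⟨s, trivial⟩).2, fun i => ?_⟩
  have h := hw (p i) (Ideal.subset_span ⟨i, rfl⟩)
  rw [hp i]
  have h4 : aeval (R := k) (fun t : (Set.univ : Set σ) => ((w t : k) : ℂ)) (p i)
      = algebraMap k ℂ (aeval w (p i)) := by
    rw [← aeval_algebraMap_apply]; rfl
  exact h4.trans (by rw [h, map_zero])

open MvPolynomial in
/-- A dominant polynomial map over `k` attains every value whose coordinates are algebraically
independent over `k`. -/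
theorem exists_eval_eq_of_algebraicIndependent {σ τ : Type*} [Finite σ]
    (k : IntermediateField ℚ ℂ) (φ : τ → (σ → ℂ) → ℂ) (hφ : ∀ t, IsPolyOn k Set.univ (φ t))
    (hdom : ∀ P : MvPolynomial τ ℂ, (∀ z, eval (fun t => φ t z) P = 0) → P = 0)
    {a : τ → ℂ} (ha : AlgebraicIndependent k a) : ∃ z, ∀ t, φ t z = a t := by
  choose p hp using hφ
  let R := MvPolynomial (Set.univ : Set σ) k
  let L := FractionRing R
  have hpi : AlgebraicIndependent k p := by
    rw [algebraicIndependent_iff]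
    intro P hP
    have h0 : map (algebraMap k ℂ) P = 0 := by
      apply hdom
      intro z
      have h1 := congrArg (aeval (R := k) (fun t : (Set.univ : Set σ) => z t)) hP
      rw [map_zero, comp_aeval_apply] at h1
      rw [eval_map, ← aeval_def, ← h1]
      simp only [hp]
    exact map_injective _ (algebraMap k ℂ).injective (by rw [h0, map_zero])
  have hL : AlgebraicIndependent k (fun t => algebraMap R L (p t)) :=
    hpi.map' (f := IsScalarTower.toAlgHom k R L) (IsFractionRing.injective R L)
  -- Since the `a t` and the `p t` are both algebraically independent, k(a) is isomorphic to k(p)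
  -- inside the rational function field `L`; `θ` sends `a t` to `p t`.
  let k' := IntermediateField.adjoin k (Set.range a)
  let θ : k' →ₐ[k] L := ((IntermediateField.val _).comp hL.aevalEquivField.toAlgHom).comp
    ha.aevalEquivField.symm.toAlgHom
  let a' : τ → k' := fun t => ⟨a t, IntermediateField.subset_adjoin _ _ ⟨t, rfl⟩⟩
  have hθ : ∀ t, θ (a' t) = algebraMap R L (p t) := by
    intro t
    have h1 : a' t = ha.aevalEquivField (algebraMap (MvPolynomial τ k)
        (FractionRing (MvPolynomial τ k)) (X t)) := by
      apply Subtype.ext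
      rw [AlgebraicIndependent.aevalEquivField_algebraMap_apply_coe, aeval_X]
    change ((hL.aevalEquivField (ha.aevalEquivField.symm (a' t)) : _) : L) = _
    rw [h1, AlgEquiv.symm_apply_apply, AlgebraicIndependent.aevalEquivField_algebraMap_apply_coe,
      aeval_X]
  let q : τ → MvPolynomial (Set.univ : Set σ) k' := fun t =>
    map (algebraMap k k') (p t) - C (a' t)
  set I : Ideal (MvPolynomial (Set.univ : Set σ) k') := Ideal.span (Set.range q) with hI
  have hne : (zeroLocus ℂ I).Nonempty := by
    by_contra h
    rw [Set.not_nonempty_iff_eq_empty] at h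
    have h1 : (1 : MvPolynomial (Set.univ : Set σ) k') ∈ I.radical := by
      rw [← vanishingIdeal_zeroLocus_eq_radical (K := ℂ) I, h, vanishingIdeal_empty]
      trivial
    -- Carried along `θ`, the system `p t = a t` becomes `p t(x) = p t(X)`, which the tautological
    -- point `X` of `L` solves. The ideal is therefore proper and has a complex zero.
    have h2 : I ≤ RingHom.ker (eval₂Hom θ.toRingHom (fun s => algebraMap R L (X s))) := by
      rw [hI, Ideal.span_le]
      rintro _ ⟨t, rfl⟩
      change eval₂Hom θ.toRingHom (fun s => algebraMap R L (X s)) (q t) = 0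
      rw [map_sub, coe_eval₂Hom, eval₂_C, eval₂_map]
      have h5 : θ.toRingHom.comp (algebraMap k k') = (algebraMap R L).comp C := by
        ext c
        change θ (algebraMap k k' c) = _
        rw [AlgHom.commutes]
        rfl
      have h6 := hθ t
      have h7 := eval₂_comp_left (algebraMap R L) (C : k →+* R) X (p t)
      rw [eval₂_eta] at h7
      rw [h5]
      refine (congrArg (· - _) h7.symm).trans ?_
      exact sub_eq_zero.2 h6.symm
    obtain ⟨n, hn⟩ := h1
    have h3 := h2 hn
    rw [one_pow, RingHom.mem_ker, map_one] at h3
    exact one_ne_zero h3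
  obtain ⟨w, hw⟩ := hne
  refine ⟨fun s => w ⟨s, trivial⟩, fun t => ?_⟩
  have h := hw (q t) (Ideal.subset_span ⟨t, rfl⟩)
  rw [map_sub, aeval_C, aeval_map_algebraMap, sub_eq_zero] at h
  rw [hp]
  exact h

/-! ### Generic points of product measures -/

/-- The coordinates `c` avoid the zero set of every nonzero polynomial almost everywhere. -/
structure PolyGeneric {X κ : Type*} [MeasurableSpace X] (μ : Measure X) (c : κ → X → ℂ) :
    Prop where
  measurable : ∀ k, Measurable (c k)
  ae_ne : ∀ p : MvPolynomial κ ℂ, p ≠ 0 → ∀ᵐ x ∂μ, MvPolynomial.eval (fun k => c k x) p ≠ 0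

namespace PolyGeneric

theorem measurable_eval {X κ : Type*} [MeasurableSpace X] {c : κ → X → ℂ}
    (hc : ∀ k, Measurable (c k)) (p : MvPolynomial κ ℂ) :
    Measurable fun x => MvPolynomial.eval (fun k => c k x) p := by
  induction p using MvPolynomial.induction_on with
  | C a => simp only [MvPolynomial.eval_C]; fun_prop
  | add p q hp hq => simp only [map_add]; exact hp.add hq
  | mul_X p k hp => simp only [map_mul, MvPolynomial.eval_X]; exact hp.mul (hc k)

/-- Fubini: view the polynomial as one in the second group of variables with coefficients in the
first. Some coefficient is a nonzero polynomial, so for almost every `x` the specialised polynomial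
in `y` is nonzero. -/
theorem prod {X Y κ ι : Type*} [MeasurableSpace X] [MeasurableSpace Y] {μ : Measure X}
    {ν : Measure Y} [SFinite μ] [SFinite ν] {c : κ → X → ℂ} {d : ι → Y → ℂ}
    (hμ : PolyGeneric μ c) (hν : PolyGeneric ν d) :
    PolyGeneric (μ.prod ν) (Sum.elim (fun k z => c k z.1) fun k z => d k z.2) := by
  have hm : ∀ k, Measurable
      ((Sum.elim (fun k z => c k z.1) fun k z => d k z.2 : κ ⊕ ι → X × Y → ℂ) k) := by
    rintro (k | k)
    · exact (hμ.measurable k).comp measurable_fst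
    · exact (hν.measurable k).comp measurable_snd
  refine ⟨hm, fun p hp => ?_⟩
  have hms : MeasurableSet {z : X × Y | MvPolynomial.eval (fun k =>
      (Sum.elim (fun k z => c k z.1) fun k z => d k z.2 : κ ⊕ ι → X × Y → ℂ) k z) p ≠ 0} :=
    (measurableSet_singleton (0 : ℂ)).compl.preimage (measurable_eval hm p)
  rw [Measure.ae_prod_iff_ae_ae hms]
  -- The swap makes the variables of the first factor the coefficient variables.
  let q : MvPolynomial ι (MvPolynomial κ ℂ) :=
    MvPolynomial.sumAlgEquiv ℂ ι κ (MvPolynomial.rename Sum.swap p)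
  have hq : q ≠ 0 := fun h => hp (MvPolynomial.rename_injective _ Sum.swap_leftInverse.injective
    ((MvPolynomial.sumAlgEquiv ℂ ι κ).injective (by rw [map_zero, map_zero]; exact h)))
  have hqe : ∀ x y, MvPolynomial.eval (fun k =>
      (Sum.elim (fun k z => c k z.1) fun k z => d k z.2 : κ ⊕ ι → X × Y → ℂ) k (x, y)) p =
      MvPolynomial.eval (fun k => d k y) (MvPolynomial.map (MvPolynomial.eval fun k => c k x) q) := by
    intro x y
    have h : (MvPolynomial.eval (fun k =>
        (Sum.elim (fun k z => c k z.1) fun k z => d k z.2 : κ ⊕ ι → X × Y → ℂ) k (x, y))) =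
        ((MvPolynomial.eval fun k => d k y).comp (MvPolynomial.map
          (MvPolynomial.eval fun k => c k x))).comp
          ((MvPolynomial.sumAlgEquiv ℂ ι κ).toRingEquiv.toRingHom.comp
            (MvPolynomial.rename (R := ℂ) (Sum.swap : κ ⊕ ι → ι ⊕ κ)).toRingHom) := by
      ext k
      · simp
      · rcases k with k | k <;> simp
    exact congrArg (fun f => f p) h
  obtain ⟨m, hm⟩ := MvPolynomial.ne_zero_iff.1 hq
  filter_upwards [hμ.ae_ne _ hm] with x hx
  have hx' : MvPolynomial.map (MvPolynomial.eval fun k => c k x) q ≠ 0 :=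
    MvPolynomial.ne_zero_iff.2 ⟨m, by rwa [MvPolynomial.coeff_map]⟩
  filter_upwards [hν.ae_ne _ hx'] with y hy
  rwa [hqe]

theorem comp {X Y κ : Type*} [MeasurableSpace X] [MeasurableSpace Y] {μ : Measure X}
    {ν : Measure Y} {c : κ → Y → ℂ} (h : PolyGeneric ν c) {f : X → Y}
    (hf : MeasurePreserving f μ ν) : PolyGeneric μ (fun k x => c k (f x)) := by
  refine ⟨fun k => (h.measurable k).comp hf.measurable, fun p hp => ?_⟩
  exact hf.quasiMeasurePreserving.ae (h.ae_ne p hp)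

theorem reindex {X κ ι : Type*} [MeasurableSpace X] {μ : Measure X} {c : κ → X → ℂ}
    (h : PolyGeneric μ c) {g : ι → κ} (hg : g.Injective) : PolyGeneric μ (fun k => c (g k)) := by
  refine ⟨fun k => h.measurable _, fun p hp => ?_⟩
  have := h.ae_ne (MvPolynomial.rename g p)
    (fun h0 => hp (MvPolynomial.rename_injective g hg (by rw [h0, map_zero])))
  simpa only [MvPolynomial.eval_rename, Function.comp_def] using this

theorem pi_fin {n : ℕ} : ∀ {X : Fin n → Type*} {κ : Fin n → Type*} [∀ i, MeasurableSpace (X i)]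
    {μ : ∀ i, Measure (X i)} [∀ i, SigmaFinite (μ i)] {c : ∀ i, κ i → X i → ℂ}
    (_ : ∀ i, PolyGeneric (μ i) (c i)),
    PolyGeneric (Measure.pi μ) (fun (s : Σ i, κ i) x => c s.1 s.2 (x s.1)) := by
  induction n with
  | zero =>
    intro X κ _ μ _ c _
    refine ⟨fun k => k.1.elim0, fun p hp => ?_⟩
    rw [MvPolynomial.eq_C_of_isEmpty p] at hp ⊢
    simp only [MvPolynomial.eval_C]
    exact Filter.Eventually.of_forall fun _ h0 => hp (by rw [h0, map_zero])
  | succ n ih =>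
    intro X κ _ μ _ c hc
    have h1 := (hc 0).prod (ih fun i : Fin n => hc i.succ)
    have h2 := h1.comp (measurePreserving_piFinSuccAbove μ 0)
    let g : (Σ i, κ i) → κ 0 ⊕ Σ i : Fin n, κ i.succ := fun s =>
      Fin.cases (motive := fun i => κ i → κ 0 ⊕ Σ i : Fin n, κ i.succ)
        (fun k => Sum.inl k) (fun i k => Sum.inr ⟨i, k⟩) s.1 s.2
    have hg : g.Injective := by
      rintro ⟨i, k⟩ ⟨i', k'⟩ h
      induction i using Fin.cases <;> induction i' using Fin.cases
      all_goals simp [g] at h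
      · rw [h]
      · obtain ⟨rfl, h⟩ := h
        rw [eq_of_heq h]
    have h3 := h2.reindex hg
    convert h3 using 1
    funext ⟨i, k⟩ x
    induction i using Fin.cases <;> rfl

/-- A nonzero polynomial in one variable has finitely many roots, and finite sets are null. -/
theorem of_noAtoms {μ : Measure ℂ} [NullSingletonClass μ] : PolyGeneric μ (fun (_ : Unit) z => z) := by
  refine ⟨fun _ => measurable_id, fun p hp => ?_⟩
  let q := MvPolynomial.uniqueAlgEquiv ℂ Unit p
  have hq : q ≠ 0 := fun h => hp ((MvPolynomial.uniqueAlgEquiv ℂ Unit).injective (by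
    rw [map_zero]; exact h))
  have hqe : ∀ z, q.eval z = MvPolynomial.eval (fun _ => z) p := by
    intro z
    exact (MvPolynomial.eval₂_uniqueAlgEquiv (φ := RingHom.id ℂ) (f := p) (a := fun _ => z))
  have := (q.roots.toFinset.finite_toSet.countable).ae_notMem μ
  filter_upwards [this] with z hz h0
  apply hz
  simp only [Finset.mem_coe, Multiset.mem_toFinset]
  rw [Polynomial.mem_roots hq, Polynomial.IsRoot, hqe, h0]

end PolyGeneric

/-! ### The Gaussian channel law and almost sure algebraic independence -/

theorem measurable_complex_mk :
    Measurable (fun p : ℝ × ℝ => (p.1 : ℂ) + (p.2 : ℂ) * Complex.I) := by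
  fun_prop

instance : IsProbabilityMeasure complexGaussian :=
  Measure.isProbabilityMeasure_map measurable_complex_mk.aemeasurable

instance : NullSingletonClass complexGaussian := by
  refine ⟨fun z => ?_⟩
  have := nullSingletonClass_gaussianReal (μ := 0) (v := 1 / 2) (by norm_num)
  rw [complexGaussian, Measure.map_apply measurable_complex_mk (measurableSet_singleton z)]
  refine measure_mono_null (t := ({z.re} : Set ℝ) ×ˢ (Set.univ : Set ℝ)) ?_ ?_
  · rintro ⟨a, b⟩ h
    have h := congrArg Complex.re (Set.mem_singleton_iff.1 h)
    simpa using h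
  · rw [Measure.prod_prod, measure_singleton, zero_mul]

/-- Each nonzero polynomial is avoided almost surely; restricting to rational coefficients leaves
only countably many polynomials, so all are avoided at once. -/
theorem ae_algebraicIndependent {K : ℕ} (M N : Fin K → ℕ) :
    ∀ᵐ E ∂(channelLaw M N), AlgebraicIndependent ℚ
      (fun s : (Σ j : Fin K, Σ i : Fin K, Fin (M j) × Fin (N i)) =>
        E s.1 s.2.1 s.2.2.1 s.2.2.2) := by
  have h : PolyGeneric (channelLaw M N)
      (fun (s : Σ j : Fin K, Σ i : Fin K, Σ _ : Fin (M j), Σ _ : Fin (N i), Unit) E =>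
        E s.1 s.2.1 s.2.2.1 s.2.2.2.1) :=
    PolyGeneric.pi_fin fun j => PolyGeneric.pi_fin fun i => PolyGeneric.pi_fin fun a =>
      PolyGeneric.pi_fin fun b => PolyGeneric.of_noAtoms
  have h' := h.reindex (g := fun s : (Σ j : Fin K, Σ i : Fin K, Fin (M j) × Fin (N i)) =>
    ⟨s.1, s.2.1, s.2.2.1, s.2.2.2, ()⟩) (Function.LeftInverse.injective
      (g := fun s => ⟨s.1, s.2.1, s.2.2.1, s.2.2.2.1⟩) fun _ => rfl)
  have h'' : ∀ p : MvPolynomial (Σ j : Fin K, Σ i : Fin K, Fin (M j) × Fin (N i)) ℚ, p ≠ 0 →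
      ∀ᵐ E ∂(channelLaw M N), MvPolynomial.aeval
        (fun s : (Σ j : Fin K, Σ i : Fin K, Fin (M j) × Fin (N i)) =>
        E s.1 s.2.1 s.2.2.1 s.2.2.2) p ≠ 0 := by
    intro p hp
    have := h'.ae_ne (MvPolynomial.map (algebraMap ℚ ℂ) p) (fun h0 => hp
      (MvPolynomial.map_injective _ (algebraMap ℚ ℂ).injective (by rw [h0, map_zero])))
    simpa only [MvPolynomial.eval_map, ← MvPolynomial.aeval_def] using this
  have hcount : Countable (MvPolynomial (Σ j : Fin K, Σ i : Fin K, Fin (M j) × Fin (N i)) ℚ) := by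
    rw [← Cardinal.mk_le_aleph0_iff]
    refine MvPolynomial.cardinalMk_le_max.trans ?_
    exact max_le (max_le Cardinal.mk_le_aleph0 Cardinal.mk_le_aleph0) le_rfl
  have h3 := ae_all_iff.2 fun p => ae_all_iff.2 (h'' p)
  filter_upwards [h3] with E hE
  rw [algebraicIndependent_iff]
  intro p hp
  by_contra h0
  exact hE p h0 hp

/-! ### Assignment of equations to variables -/

open Classical in
/-- The counting condition on whole blocks of equations yields a system of distinct variables,
one for each scalar equation. -/
theorem exists_injective_assignment {K : ℕ} (S : Finset (Fin K × Fin K)) (D : Fin K → Type)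
    [∀ j, Fintype (D j)] (r s : Fin K → ℕ)
    (h : ∀ Ω ⊆ S, ∑ x ∈ Ω, Fintype.card (D x.1) ≤
      ∑ j ∈ Ω.image Prod.fst, Fintype.card (D j) * r j + ∑ i ∈ Ω.image Prod.snd, s i) :
    ∃ f : (Σ x : S, D x.1.1) → (Σ i, Fin (s i)) ⊕ (Σ j, D j × Fin (r j)),
      f.Injective ∧ ∀ q, (∃ t, f q = Sum.inl ⟨q.1.1.2, t⟩) ∨
        ∃ t, f q = Sum.inr ⟨q.1.1.1, q.2, t⟩ := by
  let T : (Σ x : S, D x.1.1) → Finset ((Σ i, Fin (s i)) ⊕ (Σ j, D j × Fin (r j))) := fun q =>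
    (Finset.univ.image fun t => Sum.inl ⟨q.1.1.2, t⟩) ∪
      Finset.univ.image fun t => Sum.inr ⟨q.1.1.1, q.2, t⟩
  suffices hT : ∃ f : (Σ x : S, D x.1.1) → (Σ i, Fin (s i)) ⊕ (Σ j, D j × Fin (r j)),
      f.Injective ∧ ∀ q, f q ∈ T q by
    obtain ⟨f, hf, hfT⟩ := hT
    refine ⟨f, hf, fun q => ?_⟩
    have := hfT q
    simp only [T, Finset.mem_union, Finset.mem_image, Finset.mem_univ, true_and] at this
    rcases this with ⟨t, ht⟩ | ⟨t, ht⟩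
    · exact Or.inl ⟨t, ht.symm⟩
    · exact Or.inr ⟨t, ht.symm⟩
  rw [← Finset.all_card_le_biUnion_card_iff_exists_injective]
  intro E
  -- the users and the rows that occur in `E`
  let I : Finset (Fin K) := E.image fun q => q.1.1.2
  let R : Finset (Σ j, D j) := E.image fun q => ⟨q.1.1.1, q.2⟩
  let c : Fin K → ℕ := fun j => (I.filter fun i => (j, i) ∈ S).card
  have hcard : ∑ i ∈ I, s i + ∑ p ∈ R, r p.1 ≤ (E.biUnion T).card := by
    let X : Finset ((Σ i, Fin (s i)) ⊕ (Σ j, D j × Fin (r j))) :=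
      (I.sigma fun _ => Finset.univ).disjSum
        (((R.sigma fun p => (Finset.univ : Finset (Fin (r p.1)))).map
          ⟨fun p => ⟨p.1.1, p.1.2, p.2⟩, by
            rintro ⟨⟨j, l⟩, t⟩ ⟨⟨j', l'⟩, t'⟩ h
            simp only [Sigma.mk.injEq] at h
            obtain ⟨rfl, h⟩ := h
            simpa using h⟩))
    have hX : X.card = ∑ i ∈ I, s i + ∑ p ∈ R, r p.1 := by
      simp [X]
    rw [← hX]
    refine Finset.card_le_card ?_
    rintro (⟨i, t⟩ | ⟨j, l, t⟩) hx
    · simp only [X, Finset.inl_mem_disjSum, Finset.mem_sigma, Finset.mem_univ, and_true] at hx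
      obtain ⟨q, hq, rfl⟩ := Finset.mem_image.1 hx
      exact Finset.mem_biUnion.2 ⟨q, hq, Finset.mem_union_left _
        (Finset.mem_image_of_mem _ (Finset.mem_univ t))⟩
    · simp only [X, Finset.inr_mem_disjSum, Finset.mem_map, Finset.mem_sigma, Finset.mem_univ,
        and_true] at hx
      obtain ⟨⟨p, t'⟩, hp, hpt⟩ := hx
      obtain ⟨q, hq, rfl⟩ := Finset.mem_image.1 hp
      rw [← hpt]
      exact Finset.mem_biUnion.2 ⟨q, hq, Finset.mem_union_right _
        (Finset.mem_image_of_mem _ (Finset.mem_univ t'))⟩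
  refine le_trans ?_ hcard
  have hE : E.card ≤ ∑ p ∈ R, c p.1 := by
    let Y : Finset (Σ _ : (Σ j, D j), Fin K) := R.sigma fun p => I.filter fun i => (p.1, i) ∈ S
    have hY : Y.card = ∑ p ∈ R, c p.1 := by simp [Y, c]
    rw [← hY]
    refine Finset.card_le_card_of_injOn (fun q => ⟨⟨q.1.1.1, q.2⟩, q.1.1.2⟩) ?_ ?_
    · intro q hq
      simp only [Y, Finset.coe_sigma, Set.mem_sigma_iff, Finset.mem_coe, Finset.mem_filter]
      exact ⟨Finset.mem_image_of_mem _ hq, Finset.mem_image_of_mem _ hq, q.1.2⟩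
    · rintro ⟨⟨⟨j, i⟩, hx⟩, l⟩ - ⟨⟨⟨j', i'⟩, hx'⟩, l'⟩ - h
      simp only [Sigma.mk.injEq] at h
      obtain ⟨⟨rfl, h⟩, h2⟩ := h
      obtain rfl := eq_of_heq h
      obtain rfl := eq_of_heq h2
      rfl
  refine hE.trans ?_
  -- Receivers with `c j ≤ r j` can serve each of their rows from its own variables. The hypothesis
  -- is applied only to the blocks of the remaining receivers, which are saturated to all of `I`;
  -- passing from arbitrary subsets of equations to whole blocks costs nothing, as the excess `c j -
  -- r j` is positive exactly on `J`.
  let J : Finset (Fin K) := Finset.univ.filter fun j => r j < c j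
  let Ω : Finset (Fin K × Fin K) := S.filter fun x => x.1 ∈ J ∧ x.2 ∈ I
  have h1 := h Ω (Finset.filter_subset _ _)
  have hΩ : ∑ x ∈ Ω, Fintype.card (D x.1) = ∑ j ∈ J, Fintype.card (D j) * c j := by
    rw [← Finset.sum_fiberwise_of_maps_to (s := Ω) (t := J) (g := Prod.fst)
      (fun x hx => (Finset.mem_filter.1 hx).2.1)]
    refine Finset.sum_congr rfl fun j hj => ?_
    rw [Finset.sum_congr rfl (g := fun _ => Fintype.card (D j))
      (fun x hx => by rw [(Finset.mem_filter.1 hx).2]), Finset.sum_const, smul_eq_mul, mul_comm]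
    congr 1
    refine Finset.card_bij (fun x _ => x.2) ?_ ?_ ?_
    · rintro ⟨j', i⟩ hx
      simp only [Ω, Finset.mem_filter] at hx ⊢
      obtain ⟨⟨hS, -, hI⟩, rfl⟩ := hx
      exact ⟨hI, hS⟩
    · rintro ⟨j1, i1⟩ h1 ⟨j2, i2⟩ h2 h
      simp only [Finset.mem_filter] at h1 h2
      exact Prod.ext (h1.2.trans h2.2.symm) h
    · intro i hi
      simp only [Finset.mem_filter] at hi
      exact ⟨(j, i), by simp [Ω, hi, hj], rfl⟩
  have h2 : ∑ j ∈ Ω.image Prod.fst, Fintype.card (D j) * r j ≤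
      ∑ j ∈ J, Fintype.card (D j) * r j :=
    Finset.sum_le_sum_of_subset fun j hj => by
      obtain ⟨x, hx, rfl⟩ := Finset.mem_image.1 hj
      exact (Finset.mem_filter.1 hx).2.1
  have h3 : ∑ i ∈ Ω.image Prod.snd, s i ≤ ∑ i ∈ I, s i :=
    Finset.sum_le_sum_of_subset fun j hj => by
      obtain ⟨x, hx, rfl⟩ := Finset.mem_image.1 hj
      exact (Finset.mem_filter.1 hx).2.2
  rw [hΩ] at h1
  have h4 : ∑ j ∈ J, Fintype.card (D j) * c j ≤
      ∑ j ∈ J, Fintype.card (D j) * r j + ∑ i ∈ I, s i := by omega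
  have h5 : ∑ p ∈ R, (c p.1 - r p.1) ≤ ∑ j ∈ J, Fintype.card (D j) * (c j - r j) := by
    calc ∑ p ∈ R, (c p.1 - r p.1) ≤ ∑ p : (Σ j, D j), (c p.1 - r p.1) :=
          Finset.sum_le_sum_of_subset (Finset.subset_univ _)
      _ = ∑ j, Fintype.card (D j) * (c j - r j) := by
          rw [Fintype.sum_sigma]; simp
      _ = ∑ j ∈ J, Fintype.card (D j) * (c j - r j) := by
          refine (Finset.sum_subset (Finset.subset_univ J) fun j _ hj => ?_).symm
          have : c j ≤ r j := by simpa [J] using hj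
          rw [Nat.sub_eq_zero_of_le this, mul_zero]
  have h6 : ∑ j ∈ J, Fintype.card (D j) * (c j - r j) + ∑ j ∈ J, Fintype.card (D j) * r j =
      ∑ j ∈ J, Fintype.card (D j) * c j := by
    rw [← Finset.sum_add_distrib]
    refine Finset.sum_congr rfl fun j hj => ?_
    have : r j < c j := by simpa [J] using hj
    rw [← mul_add, Nat.sub_add_cancel this.le]
  have h7 : ∑ p ∈ R, c p.1 ≤ ∑ p ∈ R, (c p.1 - r p.1) + ∑ p ∈ R, r p.1 := by
    rw [← Finset.sum_add_distrib]
    exact Finset.sum_le_sum fun p _ => by omega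
  omega

/-! ### The linearised equations at a special channel -/

open Classical in
/-- A special point at which the linearised alignment equations can be solved. -/
theorem exists_scalar_solution {K : ℕ} (S : Finset (Fin K × Fin K)) (D : Fin K → Type)
    [∀ j, Fintype (D j)] (r s : Fin K → ℕ)
    (h : ∀ Ω ⊆ S, ∑ x ∈ Ω, Fintype.card (D x.1) ≤
      ∑ j ∈ Ω.image Prod.fst, Fintype.card (D j) * r j + ∑ i ∈ Ω.image Prod.snd, s i) :
    ∃ (b : ∀ j i, D j → Fin (s i) → ℚ) (c : ∀ j, Fin K → Fin (r j) → ℚ),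
      ∀ y : (Σ x : S, D x.1.1) → ℚ, ∃ (v : ∀ i, Fin (s i) → ℚ) (C : ∀ j, D j → Fin (r j) → ℚ),
        ∀ q : (Σ x : S, D x.1.1), ∑ t, b q.1.1.1 q.1.1.2 q.2 t * v q.1.1.2 t +
          ∑ t, C q.1.1.1 q.2 t * c q.1.1.1 q.1.1.2 t = y q := by
  obtain ⟨f, hf, hfq⟩ := exists_injective_assignment S D r s h
  -- `b` selects the variable assigned to each equation. The vectors `c j i` are shared by all rows
  -- `l`, so they cannot be adapted to the assignment; Vandermonde vectors work because any `r j` of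
  -- them with distinct nodes `i` are independent.
  refine ⟨fun j i l t => if ∃ hx : (j, i) ∈ S, f ⟨⟨(j, i), hx⟩, l⟩ = Sum.inl ⟨i, t⟩ then 1 else 0,
    fun j i t => (i : ℚ) ^ (t : ℕ), fun y => ?_⟩
  -- At most `r j` equations of the row `(j, l)` are assigned to its variables, by injectivity of
  -- `f`. They are solved by the coefficients of an interpolation polynomial of degree below `r j`.
  have hC : ∀ (j : Fin K) (l : D j), ∃ C : Fin (r j) → ℚ, ∀ (i : Fin K) (hx : (j, i) ∈ S) (t),
      f ⟨⟨(j, i), hx⟩, l⟩ = Sum.inr ⟨j, l, t⟩ →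
        ∑ t, C t * (i : ℚ) ^ (t : ℕ) = y ⟨⟨(j, i), hx⟩, l⟩ := by
    intro j l
    let I : Finset (Fin K) := Finset.univ.filter fun i =>
      ∃ (hx : (j, i) ∈ S) (t : Fin (r j)), f ⟨⟨(j, i), hx⟩, l⟩ = Sum.inr ⟨j, l, t⟩
    have hI : I.card ≤ r j := by
      have : ∀ i ∈ I, ∃ (hx : (j, i) ∈ S) (t : Fin (r j)),
          f ⟨⟨(j, i), hx⟩, l⟩ = Sum.inr ⟨j, l, t⟩ := fun i hi => (Finset.mem_filter.1 hi).2
      choose hx t ht using this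
      have hinj : Function.Injective fun i : I => t i.1 i.2 := by
        intro i i' hii
        have h1 := ht i.1 i.2
        rw [show t i.1 i.2 = t i'.1 i'.2 from hii, ← ht i'.1 i'.2] at h1
        have := hf h1
        simp only [Sigma.mk.injEq, Subtype.mk.injEq, Prod.mk.injEq, true_and] at this
        exact Subtype.ext this.1
      simpa using Fintype.card_le_of_injective _ hinj
    let Y : Fin K → ℚ := fun i => if hx : (j, i) ∈ S then y ⟨⟨(j, i), hx⟩, l⟩ else 0
    let node : Fin K → ℚ := fun i => (i : ℚ)
    have hnode : Set.InjOn node I := fun i _ i' _ h =>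
      Fin.ext (Nat.cast_injective (R := ℚ) h)
    let p := Lagrange.interpolate I node Y
    refine ⟨fun t => p.coeff t, fun i hx t ht => ?_⟩
    have hiI : i ∈ I := Finset.mem_filter.2 ⟨Finset.mem_univ _, hx, t, ht⟩
    have hp : p.eval (node i) = Y i := Lagrange.eval_interpolate_at_node Y hnode hiI
    have hdeg : p.degree < (r j : ℕ) := (Lagrange.degree_interpolate_lt Y hnode).trans_le
      (by exact_mod_cast hI)
    have hr : 0 < r j := t.pos
    have hnat : p.natDegree < r j := by
      by_cases hp0 : p = 0
      · simpa [hp0] using hr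
      · exact (Polynomial.natDegree_lt_iff_degree_lt hp0).2 hdeg
    rw [Polynomial.eval_eq_sum_range' hnat, ← Fin.sum_univ_eq_sum_range
      (fun t => p.coeff t * node i ^ t)] at hp
    rw [hp]
    simp [Y, hx]
  choose C hC using hC
  -- What is left of the other equations once `C` is fixed. Each of them owns a precoder variable,
  -- which is set to this residual; the equations already solved have zero coefficients `b`, so they
  -- are not disturbed.
  let w : (Σ x : S, D x.1.1) → ℚ := fun q =>
    y q - ∑ t, C q.1.1.1 q.2 t * (q.1.1.2 : ℚ) ^ (t : ℕ)
  refine ⟨fun i t => if hq : ∃ q, f q = Sum.inl ⟨i, t⟩ then w hq.choose else 0, C, ?_⟩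
  rintro ⟨⟨⟨j, i⟩, hx⟩, l⟩
  dsimp only
  rcases hfq ⟨⟨⟨j, i⟩, hx⟩, l⟩ with ⟨t, ht⟩ | ⟨t, ht⟩
  · rw [Finset.sum_eq_single t]
    · have hq : ∃ q, f q = Sum.inl ⟨i, t⟩ := ⟨_, ht⟩
      rw [if_pos ⟨hx, ht⟩, dif_pos hq, hf (hq.choose_spec.trans ht.symm), one_mul]
      simp [w]
    · intro t' _ hne
      rw [if_neg, zero_mul]
      rintro ⟨_, h'⟩
      replace h' := ht.symm.trans h'
      simp only [Sum.inl.injEq, Sigma.mk.injEq, heq_eq_eq, true_and] at h'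
      exact hne h'.symm
    · simp
  · rw [hC j l i hx t ht, Finset.sum_eq_zero, zero_add]
    intro t' _
    rw [if_neg, zero_mul]
    rintro ⟨_, h'⟩
    cases ht.symm.trans h'

/-- The index type of the scalar equations `(C_j H_{ji} V_i)_{uβ} = 0`. -/
abbrev EqIdx {K : ℕ} (S : Finset (Fin K × Fin K)) (D : Fin K → Type) (δ : ℕ) : Type :=
  Σ x : S, (D x.1.1 × Fin δ) × Fin δ

open Classical in
/-- The solution of the linearised equations at the special point, in blocks of size `δ`. -/
theorem exists_block_solution {K : ℕ} (S : Finset (Fin K × Fin K)) (D : Fin K → Type)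
    [∀ j, Fintype (D j)] (r s : Fin K → ℕ) (δ : ℕ)
    (h : ∀ Ω ⊆ S, ∑ x ∈ Ω, Fintype.card (D x.1) ≤
      ∑ j ∈ Ω.image Prod.fst, Fintype.card (D j) * r j + ∑ i ∈ Ω.image Prod.snd, s i) :
    ∃ (b : ∀ j i, Matrix (D j × Fin δ) (Fin (s i) × Fin δ) ℂ)
      (c : ∀ j, Fin K → Matrix (Fin (r j) × Fin δ) (Fin δ) ℂ)
      (v : ∀ i, EqIdx S D δ → Matrix (Fin (s i) × Fin δ) (Fin δ) ℂ)
      (C : ∀ j, EqIdx S D δ → Matrix (D j × Fin δ) (Fin (r j) × Fin δ) ℂ),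
      (∀ (k : IntermediateField ℚ ℂ) i q t β, v i q t β ∈ k) ∧
      (∀ (k : IntermediateField ℚ ℂ) j q u t, C j q u t ∈ k) ∧
      ∀ q q' : EqIdx S D δ,
        (b q.1.1.1 q.1.1.2 * v q.1.1.2 q' + C q.1.1.1 q' * c q.1.1.1 q.1.1.2) q.2.1 q.2.2 =
          if q = q' then 1 else 0 := by
  obtain ⟨b, c, hbc⟩ := exists_scalar_solution S D r s h
  choose v C hvC using fun q' : (Σ x : S, D x.1.1) =>
    hbc fun q => if q = q' then 1 else 0
  let π : EqIdx S D δ → (Σ x : S, D x.1.1) := fun q => ⟨q.1, q.2.1.1⟩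
  -- The scalar coefficients tensored with the identity of size `δ`. The equation at `((l, α), β)`
  -- then involves only the unknowns with the same `(α, β)`, so the system splits into `δ * δ`
  -- copies of the scalar one.
  refine ⟨fun j i => Matrix.of fun u t => if u.2 = t.2 then (b j i u.1 t.1 : ℂ) else 0,
    fun j i => Matrix.of fun t β => if t.2 = β then (c j i t.1 : ℂ) else 0,
    fun i q => Matrix.of fun t β => if t.2 = q.2.1.2 ∧ β = q.2.2 then (v (π q) i t.1 : ℂ) else 0,
    fun j q => Matrix.of fun u t => if u.2 = q.2.1.2 ∧ t.2 = q.2.2 then (C (π q) j u.1 t.1 : ℂ) else 0,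
    ?_, ?_, ?_⟩
  · intro k i q t β
    simp only [Matrix.of_apply]
    split_ifs
    · exact SubfieldClass.ratCast_mem k _
    · exact k.zero_mem
  · intro k j q u t
    simp only [Matrix.of_apply]
    split_ifs
    · exact SubfieldClass.ratCast_mem k _
    · exact k.zero_mem
  · rintro ⟨⟨⟨j, i⟩, hx⟩, ⟨l, α⟩, β⟩ q'
    have h1 := hvC (π q') ⟨⟨⟨j, i⟩, hx⟩, l⟩
    have h2 := congrArg (fun x : ℚ => (x : ℂ)) h1
    simp only [Rat.cast_add, Rat.cast_sum, Rat.cast_mul] at h2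
    rw [Matrix.add_apply, Matrix.mul_apply, Matrix.mul_apply, Fintype.sum_prod_type,
      Fintype.sum_prod_type]
    simp only [Matrix.of_apply]
    have e1 : ∀ t : Fin (s i), ∑ α' : Fin δ, (if α = α' then (b j i l t : ℂ) else 0) *
        (if α' = q'.2.1.2 ∧ β = q'.2.2 then (v (π q') i t : ℂ) else 0) =
        if α = q'.2.1.2 ∧ β = q'.2.2 then (b j i l t : ℂ) * v (π q') i t else 0 := by
      intro t
      rw [Finset.sum_eq_single α]
      · simp
      · intro α' _ hne
        rw [if_neg hne.symm, zero_mul]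
      · simp
    have e2 : ∀ t : Fin (r j), ∑ γ : Fin δ,
        (if α = q'.2.1.2 ∧ γ = q'.2.2 then (C (π q') j l t : ℂ) else 0) *
        (if γ = β then (c j i t : ℂ) else 0) =
        if α = q'.2.1.2 ∧ β = q'.2.2 then (C (π q') j l t : ℂ) * c j i t else 0 := by
      intro t
      rw [Finset.sum_eq_single β]
      · simp
      · intro α' _ hne
        rw [if_neg hne, mul_zero]
      · simp
    rw [Finset.sum_congr rfl fun t _ => e1 t, Finset.sum_congr rfl fun t _ => e2 t]
    by_cases hαβ : α = q'.2.1.2 ∧ β = q'.2.2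
    · simp only [if_pos hαβ]
      rw [h2]
      obtain ⟨x', ⟨l', α'⟩, β'⟩ := q'
      obtain ⟨rfl, rfl⟩ := hαβ
      by_cases hq : (⟨⟨⟨j, i⟩, hx⟩, l⟩ : (Σ x : S, D x.1.1)) = ⟨x', l'⟩
      · obtain ⟨rfl, hl⟩ := Sigma.mk.inj_iff.1 hq
        obtain rfl := eq_of_heq hl
        simp [π]
      · rw [if_neg hq, if_neg]
        · simp
        · intro h
          apply hq
          obtain ⟨rfl, hl⟩ := Sigma.mk.inj_iff.1 h
          have hl := eq_of_heq hl
          simp only [Prod.mk.injEq] at hl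
          rw [hl.1.1]
    · simp only [if_neg hαβ, Finset.sum_const_zero, add_zero]
      rw [if_neg]
      rintro rfl
      exact hαβ ⟨rfl, rfl⟩

/-! ### Fields of definition -/

theorem det_mem {m : Type*} [Fintype m] [DecidableEq m] {k : IntermediateField ℚ ℂ}
    {A : Matrix m m ℂ} (hA : ∀ a b, A a b ∈ k) : A.det ∈ k := by
  rw [Matrix.det_apply]
  refine sum_mem fun τ _ => ?_
  rw [Units.smul_def]
  exact zsmul_mem (prod_mem fun c _ => hA _ _) _

theorem matrix_inv_mem {m : Type*} [Fintype m] [DecidableEq m] {k : IntermediateField ℚ ℂ}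
    {A : Matrix m m ℂ} (hA : ∀ a b, A a b ∈ k) (a b : m) : A⁻¹ a b ∈ k := by
  rw [Matrix.inv_def, Matrix.smul_apply, smul_eq_mul, Ring.inverse_eq_inv', Matrix.adjugate_apply]
  refine mul_mem (inv_mem (det_mem hA)) (det_mem fun c d => ?_)
  rw [Matrix.updateRow_apply]
  split_ifs
  · rw [Pi.single_apply]
    split_ifs
    · exact one_mem k
    · exact zero_mem k
  · exact hA _ _

theorem matrix_mul_mem {l m n : Type*} [Fintype m] {k : IntermediateField ℚ ℂ}
    {A : Matrix l m ℂ} {B : Matrix m n ℂ} (hA : ∀ a b, A a b ∈ k) (hB : ∀ a b, B a b ∈ k)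
    (a : l) (b : n) : (A * B) a b ∈ k := by
  rw [Matrix.mul_apply]
  exact sum_mem fun c _ => mul_mem (hA _ _) (hB _ _)

theorem one_matrix_mem {m : Type*} [DecidableEq m] (k : IntermediateField ℚ ℂ) (a b : m) :
    (1 : Matrix m m ℂ) a b ∈ k := by
  rw [Matrix.one_apply]
  split_ifs
  · exact one_mem k
  · exact zero_mem k

/-- A subspace of `ℂ^ι` has a canonical basis: its entries lie in every algebraically closed
subfield over which the subspace is defined. -/
theorem exists_canonical_basis {ι : Type*} [Fintype ι] (W : Submodule ℂ (ι → ℂ)) :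
    ∃ B : Matrix ι (Fin (Module.finrank ℂ W)) ℂ, colSpan B = W ∧
      ∀ (k : IntermediateField ℚ ℂ) [IsAlgClosed k] (κ : Type) [Fintype κ] (A : Matrix ι κ ℂ),
        (∀ a b, A a b ∈ k) → colSpan A = W → ∀ a b, B a b ∈ k := by
  classical
  -- The coordinate functionals span the dual of `W`. A maximal independent set of them identifies
  -- `W` with `κ → ℂ`, and the preimages of the unit vectors form a basis in reduced echelon form,
  -- which depends on `W` only.
  let f : ι → Module.Dual ℂ W := fun i => (LinearMap.proj i).comp W.subtype
  obtain ⟨κ, a, ha, hspan, hli⟩ := exists_linearIndependent' ℂ f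
  have : Finite κ := Finite.of_injective a ha
  have : Fintype κ := Fintype.ofFinite κ
  let φ : W →ₗ[ℂ] (κ → ℂ) := LinearMap.pi fun x => f (a x)
  have hφ : Function.Injective φ := by
    rw [injective_iff_map_eq_zero]
    intro w hw
    have h1 : ∀ g ∈ Submodule.span ℂ (Set.range f), g w = 0 := by
      intro g hg
      rw [← hspan] at hg
      induction hg using Submodule.span_induction with
      | mem g hg =>
        obtain ⟨x, rfl⟩ := hg
        exact congrFun hw x
      | zero => rfl
      | add g g' _ _ h h' => rw [LinearMap.add_apply, h, h', add_zero]
      | smul c g _ h => rw [LinearMap.smul_apply, h, smul_zero]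
    ext i
    exact h1 (f i) (Submodule.subset_span ⟨i, rfl⟩)
  have hcard : Module.finrank ℂ W = Fintype.card κ := by
    apply le_antisymm
    · simpa using LinearMap.finrank_le_finrank_of_injective hφ
    · have := hli.fintype_card_le_finrank
      rwa [Subspace.dual_finrank_eq] at this
  let e : W ≃ₗ[ℂ] (κ → ℂ) := LinearEquiv.ofInjectiveOfFinrankEq φ hφ (by simpa using hcard)
  let ε : Fin (Module.finrank ℂ W) ≃ κ := (finCongr hcard).trans (Fintype.equivFin κ).symm
  have heφ : ∀ w, e w = φ w := fun w => rfl
  refine ⟨Matrix.of fun i x => (e.symm (Pi.single (ε x) 1) : ι → ℂ) i, ?_, ?_⟩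
  · apply le_antisymm
    · rintro _ ⟨c, rfl⟩
      have : Matrix.mulVec (Matrix.of fun i x => (e.symm (Pi.single (ε x) 1) : ι → ℂ) i) c =
          ((∑ x, c x • e.symm (Pi.single (ε x) 1) : W) : ι → ℂ) := by
        ext i
        simp [Matrix.mulVec, dotProduct, mul_comm]
      rw [Matrix.mulVecLin_apply, this]
      exact Subtype.mem _
    · intro w hw
      refine ⟨fun x => e ⟨w, hw⟩ (ε x), ?_⟩
      have h1 : (⟨w, hw⟩ : W) = ∑ x, e ⟨w, hw⟩ (ε x) • e.symm (Pi.single (ε x) 1) := by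
        apply e.injective
        rw [map_sum]
        ext y
        simp only [map_smul, LinearEquiv.apply_symm_apply, Finset.sum_apply, Pi.smul_apply,
          smul_eq_mul, Pi.single_apply, mul_ite, mul_one, mul_zero]
        rw [Finset.sum_eq_single (ε.symm y)]
        · simp
        · intro x _ hx
          rw [if_neg]
          rintro rfl
          simp at hx
        · simp
      have h2 := congrArg (fun w : W => (w : ι → ℂ)) h1
      rw [Matrix.mulVecLin_apply]
      ext i
      have h3 := congrFun h2 i
      simp only [Submodule.coe_sum, Finset.sum_apply, Submodule.coe_smul, Pi.smul_apply,
        smul_eq_mul] at h3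
      rw [h3]
      simp [Matrix.mulVec, dotProduct, mul_comm]
  · intro k _ κ' _ A hA hAW i x
    have hmem : (e.symm (Pi.single (ε x) 1) : ι → ℂ) ∈ colSpan A := by
      rw [hAW]
      exact Subtype.mem _
    obtain ⟨c, hc⟩ := hmem
    rw [Matrix.mulVecLin_apply] at hc
    have hval : ∀ y, (e.symm (Pi.single (ε x) 1) : ι → ℂ) (a y) = if y = ε x then 1 else 0 := by
      intro y
      have := congrFun (e.apply_symm_apply (Pi.single (ε x) 1)) y
      rw [Pi.single_apply] at this
      exact this
    -- A basis vector is determined by its pivot coordinates. Expressing it through `A` is a system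
    -- over `k` with a complex solution, so coefficients in `k` exist.
    obtain ⟨c', hc'k, hc'⟩ := exists_zero_mem k
      (fun (y : κ) (z : κ' → ℂ) => ∑ m, A (a y) m * z m - if y = ε x then 1 else 0)
      (fun y => (IsPolyOn.sum _ fun m _ => (IsPolyOn.const (hA _ _)).mul
        (IsPolyOn.coord (Set.mem_univ m))).sub (by
          split_ifs
          · exact IsPolyOn.one
          · exact IsPolyOn.zero)) c
      (fun y => by
        rw [sub_eq_zero, ← hval y, ← hc]; rfl)
    have hw : A *ᵥ c' ∈ W := hAW.le ⟨c', rfl⟩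
    have heq : (⟨A *ᵥ c', hw⟩ : W) = e.symm (Pi.single (ε x) 1) := by
      apply e.injective
      rw [LinearEquiv.apply_symm_apply]
      ext y
      rw [Pi.single_apply]
      exact sub_eq_zero.1 (hc' y)
    rw [Matrix.of_apply, ← heq]
    exact sum_mem fun m _ => mul_mem (hA _ _) (hc'k m)

/-! ### Kernels of generic matrices -/

/-- The matrix `[1 X]`. -/
abbrev oneCols {R κ : Type*} [DecidableEq R] (X : Matrix R κ ℂ) : Matrix R (R ⊕ κ) ℂ :=
  Matrix.fromCols 1 X

/-- The matrix `[1; Y]`. -/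
abbrev oneRows {C l : Type*} [DecidableEq C] (Y : Matrix l C ℂ) : Matrix (C ⊕ l) C ℂ :=
  Matrix.fromRows 1 Y

theorem oneCols_mul_fromBlocks_mul_oneRows {R κ C l : Type*} [Fintype R] [Fintype κ]
    [Fintype C] [Fintype l] [DecidableEq R] [DecidableEq C] (X : Matrix R κ ℂ)
    (Y : Matrix l C ℂ) (P : Matrix R C ℂ) :
    oneCols X * (Matrix.fromBlocks P 0 0 0 : Matrix (R ⊕ κ) (C ⊕ l) ℂ) * oneRows Y = P := by
  rw [Matrix.fromCols_mul_fromBlocks, Matrix.fromCols_mul_fromRows]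
  simp

theorem oneCols_mem {R κ : Type*} [DecidableEq R] {k : IntermediateField ℚ ℂ}
    {X : Matrix R κ ℂ} (hX : ∀ a b, X a b ∈ k) (a : R) (b : R ⊕ κ) :
    oneCols X a b ∈ k := by
  rcases b with b | b
  · exact one_matrix_mem k _ _
  · exact hX _ _

theorem oneRows_mem {C l : Type*} [DecidableEq C] {k : IntermediateField ℚ ℂ}
    {Y : Matrix l C ℂ} (hY : ∀ a b, Y a b ∈ k) (a : C ⊕ l) (b : C) :
    oneRows Y a b ∈ k := by
  rcases a with a | a
  · exact one_matrix_mem k _ _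
  · exact hY _ _

/-- Block elimination: with invertible lower block `Hb` and upper block `Ht`, a left kernel vector
is determined by its first part, and `X = -Ht Hb⁻¹`, which is rational in the entries of `H`. -/
theorem exists_left_kernel {R κ : Type*} [Fintype R] [Fintype κ] [DecidableEq R] [DecidableEq κ]
    {k : IntermediateField ℚ ℂ} (H : Matrix (R ⊕ κ) κ ℂ) (hH : ∀ a b, H a b ∈ k)
    (hdet : (H.submatrix Sum.inr id).det ≠ 0) :
    ∃ X : Matrix R κ ℂ, (∀ a b, X a b ∈ k) ∧ oneCols X * H = 0 ∧
      ∀ w, w ᵥ* H = 0 → w = (w ∘ Sum.inl) ᵥ* oneCols X := by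
  set Hb := H.submatrix Sum.inr id with hHb
  set Ht := H.submatrix Sum.inl id with hHt
  have hHs : H = Matrix.fromRows Ht Hb := by
    ext (a | a) b <;> rfl
  have hu : IsUnit Hb.det := isUnit_iff_ne_zero.2 hdet
  refine ⟨-(Ht * Hb⁻¹), fun a b => ?_, ?_, fun w hw => ?_⟩
  · exact neg_mem (matrix_mul_mem (fun _ _ => hH _ _) (matrix_inv_mem fun _ _ => hH _ _) a b)
  · rw [hHs, Matrix.fromCols_mul_fromRows, Matrix.one_mul, Matrix.neg_mul, Matrix.mul_assoc,
      Matrix.nonsing_inv_mul _ hu, Matrix.mul_one, add_neg_cancel]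
  · rw [hHs, Matrix.vecMul_fromRows] at hw
    have h1 : (w ∘ Sum.inr) = (w ∘ Sum.inl) ᵥ* (-(Ht * Hb⁻¹)) := by
      have h2 : (w ∘ Sum.inr) ᵥ* Hb = -((w ∘ Sum.inl) ᵥ* Ht) :=
        eq_neg_of_add_eq_zero_right hw
      have h3 := congrArg (· ᵥ* Hb⁻¹) h2
      simp only [Matrix.vecMul_vecMul, Matrix.mul_nonsing_inv _ hu, Matrix.vecMul_one,
        Matrix.neg_vecMul] at h3
      rw [h3, Matrix.vecMul_neg]
    rw [Matrix.vecMul_fromCols, Matrix.vecMul_one, ← h1]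
    ext (a | a) <;> rfl

theorem exists_right_kernel {C l : Type*} [Fintype C] [Fintype l] [DecidableEq C] [DecidableEq l]
    {k : IntermediateField ℚ ℂ} (G : Matrix l (C ⊕ l) ℂ) (hG : ∀ a b, G a b ∈ k)
    (hdet : (G.submatrix id Sum.inr).det ≠ 0) :
    ∃ Y : Matrix l C ℂ, (∀ a b, Y a b ∈ k) ∧ G * oneRows Y = 0 ∧
      ∀ v, G *ᵥ v = 0 → v = oneRows Y *ᵥ (v ∘ Sum.inl) := by
  obtain ⟨X, hX, h1, h2⟩ := exists_left_kernel Gᵀ (fun a b => hG b a)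
    (by rw [← Matrix.det_transpose] at hdet; exact hdet)
  have hT : (oneCols X)ᵀ = oneRows Xᵀ := by
    rw [Matrix.transpose_fromCols, Matrix.transpose_one]
  refine ⟨Xᵀ, fun a b => hX b a, ?_, fun v hv => ?_⟩
  · rw [← hT, ← Matrix.transpose_transpose G, ← Matrix.transpose_mul, h1, Matrix.transpose_zero]
  · rw [← hT, Matrix.mulVec_transpose]
    exact h2 v (by rw [Matrix.vecMul_transpose, hv])

/-! ### Channel matrices split into blocks -/

/-- The classes of links together with block sizes: `r j` and `s i` are the numbers of spare
blocks of `δ` dimensions at receiver `j` and at transmitter `i`. -/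
structure Layout (K : ℕ) where
  I : Fin K → Finset (Fin K)
  II : Fin K → Finset (Fin K)
  III : Fin K → Finset (Fin K)
  IV : Fin K → Finset (Fin K)
  r : Fin K → ℕ
  s : Fin K → ℕ
  δ : ℕ
  II_III : ∀ {j i}, i ∈ II j → i ∉ III j
  II_IV : ∀ {j i}, i ∈ II j → i ∉ IV j
  III_IV : ∀ {j i}, i ∈ III j → i ∉ IV j

namespace Layout

variable {K : ℕ} (G : Layout K)

/-- The users whose streams span the signal space that receiver `j` must keep. -/
abbrev D (j : Fin K) : Type := {i // i ∈ insert j (G.I j)}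

/-- The rows of `(S_j^r)† H_{ji}^s`. -/
abbrev RowT (j : Fin K) : Type := (G.D j × Fin G.δ) ⊕ (Fin (G.r j) × Fin G.δ)

/-- The columns of `H_{ji}^s S_i^t`. -/
abbrev ColT (i : Fin K) : Type := Fin G.δ ⊕ (Fin (G.s i) × Fin G.δ)

/-- The columns used to null the class III links of transmitter `i`. -/
abbrev ColB (i : Fin K) : Type := Σ j : {j // i ∈ G.III j}, G.RowT j

abbrev Col (i : Fin K) : Type := G.ColT i ⊕ G.ColB i

/-- The rows used to null the class II links of receiver `j`. -/
abbrev RowB (j : Fin K) : Type := Σ i : G.II j, G.Col i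

abbrev Row (j : Fin K) : Type := G.RowT j ⊕ G.RowB j

abbrev Idx : Type := Σ j : Fin K, Σ i : Fin K, G.Row j × G.Col i

/-- The channel matrix of the link `(j, i)`. -/
def mat (E : G.Idx → ℂ) (j i : Fin K) : Matrix (G.Row j) (G.Col i) ℂ :=
  Matrix.of fun a b => E ⟨j, i, a, b⟩

/-- The entries of all the links in a class. -/
def links (C : Fin K → Finset (Fin K)) : Set G.Idx := {x | x.2.1 ∈ C x.1}

variable {G}

theorem mat_mem_acl {E : G.Idx → ℂ} {C : Fin K → Finset (Fin K)} {j i : Fin K} (h : i ∈ C j)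
    (a : G.Row j) (b : G.Col i) : G.mat E j i a b ∈ acl (E '' G.links C) :=
  subset_acl _ ⟨⟨j, i, a, b⟩, h, rfl⟩

theorem isPolyOn_mat {k : IntermediateField ℚ ℂ} {C : Fin K → Finset (Fin K)} {j i : Fin K}
    (h : i ∈ C j) (a : G.Row j) (b : G.Col i) :
    IsPolyOn k (G.links C) fun E => G.mat E j i a b :=
  IsPolyOn.coord (show (⟨j, i, a, b⟩ : G.Idx) ∈ G.links C from h)

/-- The lower block of the concatenated class II channels is square by the choice of `RowB`. Its
determinant is 1 at a suitable specialisation, hence nonzero at independent entries. -/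
theorem exists_rx_kernel {E : G.Idx → ℂ} (hE : AlgebraicIndependent ℚ E) (j : Fin K) :
    ∃ X : Matrix (G.RowT j) (G.RowB j) ℂ, (∀ a b, X a b ∈ acl (E '' G.links G.II)) ∧
      (∀ i ∈ G.II j, oneCols X * G.mat E j i = 0) ∧
      ∀ w, (∀ i ∈ G.II j, w ᵥ* G.mat E j i = 0) → w = (w ∘ Sum.inl) ᵥ* oneCols X := by
  classical
  let H : (G.Idx → ℂ) → Matrix (G.Row j) (G.RowB j) ℂ := fun E => Matrix.of fun a b =>
    G.mat E j b.1 a b.2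
  have hHk : ∀ a b, H E a b ∈ acl (E '' G.links G.II) := fun a b => mat_mem_acl b.1.2 a b.2
  have hdet : ((H E).submatrix Sum.inr id).det ≠ 0 := by
    have hind := algebraicIndependent_acl hE (Set.empty_disjoint (G.links G.II))
    refine IsPolyOn.ne_zero (f := fun E => ((H E).submatrix Sum.inr id).det)
      (IsPolyOn.det fun a b => isPolyOn_mat b.1.2 _ _) hind
      (e := fun x => if ∃ h : x.2.1 ∈ G.II x.1, x.2.2.1 = Sum.inr ⟨⟨x.2.1, h⟩, x.2.2.2⟩
        then 1 else 0) ?_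
    have : (H (fun x => if ∃ h : x.2.1 ∈ G.II x.1, x.2.2.1 = Sum.inr ⟨⟨x.2.1, h⟩, x.2.2.2⟩
        then 1 else 0)).submatrix Sum.inr id = 1 := by
      ext a ⟨i, b⟩
      simp only [H, mat, Matrix.submatrix_apply, Matrix.of_apply, id, Sum.inr.injEq]
      rw [Matrix.one_apply]
      congr 1
      exact propext ⟨fun ⟨_, h⟩ => h, fun h => ⟨i.2, h⟩⟩
    rw [this, Matrix.det_one]
    exact one_ne_zero
  obtain ⟨X, hX, h1, h2⟩ := exists_left_kernel (H E) hHk hdet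
  refine ⟨X, hX, fun i hi => ?_, fun w hw => h2 w ?_⟩
  · ext a b
    have := congrFun (congrFun h1 a) ⟨⟨i, hi⟩, b⟩
    exact this
  · ext b
    exact congrFun (hw b.1 b.1.2) b.2

/-- Here `X` consists of constants algebraic over class II, and the determinant is a polynomial in
the independent class III entries. The specialisation puts an identity in the `RowT` rows and zeros
in the `RowB` rows, so `X` drops out of the product. -/
theorem exists_tx_kernel {E : G.Idx → ℂ} (hE : AlgebraicIndependent ℚ E)
    {X : ∀ j, Matrix (G.RowT j) (G.RowB j) ℂ}
    (hX : ∀ j a b, X j a b ∈ acl (E '' G.links G.II)) (i : Fin K) :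
    ∃ Y : Matrix (G.ColB i) (G.ColT i) ℂ,
      (∀ a b, Y a b ∈ acl (E '' (G.links G.II ∪ G.links G.III))) ∧
      (∀ j, i ∈ G.III j → oneCols (X j) * G.mat E j i * oneRows Y = 0) ∧
      ∀ v, (∀ j, i ∈ G.III j → (oneCols (X j) * G.mat E j i) *ᵥ v = 0) →
        v = oneRows Y *ᵥ (v ∘ Sum.inl) := by
  classical
  let H : (G.Idx → ℂ) → Matrix (G.ColB i) (G.Col i) ℂ := fun E => Matrix.of fun a b =>
    (oneCols (X a.1) * G.mat E a.1 i) a.2 b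
  have hXm := fun j a b => oneCols_mem (k := acl (E '' G.links G.II)) (hX j) a b
  have hHk : ∀ a b, H E a b ∈ acl (E '' (G.links G.II ∪ G.links G.III)) := fun a b =>
    matrix_mul_mem (fun c d => acl_mono (Set.image_mono Set.subset_union_left) (hXm _ c d))
      (fun c d => acl_mono (Set.image_mono Set.subset_union_right) (mat_mem_acl a.1.2 c d)) _ _
  have hdet : ((H E).submatrix id Sum.inr).det ≠ 0 := by
    have hind := algebraicIndependent_acl hE (S := G.links G.II) (T := G.links G.III)
      (Set.disjoint_left.2 fun x hx hx' => G.II_III hx hx')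
    let e : G.Idx → ℂ := fun x => if ∃ (a : G.RowT x.1) (h : x.2.1 ∈ G.III x.1),
        x.2.2.1 = Sum.inl a ∧ x.2.2.2 = Sum.inr ⟨⟨x.1, h⟩, a⟩ then 1 else 0
    refine IsPolyOn.ne_zero (f := fun E => ((H E).submatrix id Sum.inr).det)
      (IsPolyOn.det fun a b => IsPolyOn.matrix_mul (A := fun _ => oneCols (X a.1))
        (fun c d => IsPolyOn.const (hXm _ c d)) (fun c d => isPolyOn_mat a.1.2 c d) _ _) hind (e := e) ?_
    have : (H e).submatrix id Sum.inr = 1 := by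
      ext ⟨j, a⟩ b
      simp only [H, Matrix.submatrix_apply, Matrix.of_apply, id, Matrix.mul_apply]
      rw [Fintype.sum_sum_type]
      rw [Finset.sum_eq_single a]
      · rw [Finset.sum_eq_zero]
        · have h1 : (∃ (a' : G.RowT j) (h : i ∈ G.III j), (Sum.inl a : G.Row j) = Sum.inl a' ∧
              (Sum.inr b : G.Col i) = Sum.inr ⟨⟨j, h⟩, a'⟩) ↔ (⟨j, a⟩ : G.ColB i) = b := by
            constructor
            · rintro ⟨a', h, h1, h2⟩
              rw [Sum.inl.inj h1, Sum.inr.inj h2]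
            · rintro rfl
              exact ⟨a, j.2, rfl, rfl⟩
          simp only [mat, e, Matrix.of_apply, h1, Matrix.fromCols_apply_inl, Matrix.one_apply_eq,
            Matrix.one_apply, one_mul, add_zero]
        · intro c _
          have : ¬ ∃ (a' : G.RowT j) (h : i ∈ G.III j), (Sum.inr c : G.Row j) = Sum.inl a' ∧
              (Sum.inr b : G.Col i) = Sum.inr ⟨⟨j, h⟩, a'⟩ := by
            rintro ⟨_, _, h, _⟩
            cases h
          simp only [mat, e, Matrix.of_apply, if_neg this, mul_zero]
      · intro c _ hc
        have : oneCols (X j) a (Sum.inl c) = 0 := Matrix.one_apply_ne hc.symm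
        rw [this, zero_mul]
      · simp
    rw [this, Matrix.det_one]
    exact one_ne_zero
  obtain ⟨Y, hY, h1, h2⟩ := exists_right_kernel (H E) hHk hdet
  refine ⟨Y, hY, fun j hj => ?_, fun v hv => h2 v ?_⟩
  · ext a b
    have := congrFun (congrFun h1 ⟨⟨j, hj⟩, a⟩) b
    exact this
  · ext a
    exact congrFun (hv a.1 a.1.2) a.2

end Layout

/-! ### Dominant maps -/

theorem hasStrictFDerivAt_mul_mul {σ : Type*} [Fintype σ] (i j : σ) (g : ℂ) :
    HasStrictFDerivAt (fun z : σ → ℂ => z i * g * z j) (0 : (σ → ℂ) →L[ℂ] ℂ) 0 := by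
  have h1 : HasStrictFDerivAt (fun z : σ → ℂ => z i)
      (ContinuousLinearMap.proj (R := ℂ) (φ := fun _ : σ => ℂ) i) 0 :=
    (ContinuousLinearMap.proj (R := ℂ) (φ := fun _ : σ => ℂ) i).hasStrictFDerivAt
  have h2 : HasStrictFDerivAt (fun z : σ → ℂ => z j)
      (ContinuousLinearMap.proj (R := ℂ) (φ := fun _ : σ => ℂ) j) 0 :=
    (ContinuousLinearMap.proj (R := ℂ) (φ := fun _ : σ => ℂ) j).hasStrictFDerivAt
  refine ((h1.mul_const g).mul h2).congr_fderiv ?_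
  ext v
  simp

/-- A polynomial that vanishes on the image of a map with surjective derivative is zero. -/
theorem eq_zero_of_surjective_deriv {σ τ : Type*} [Fintype σ] [Fintype τ]
    {φ : (σ → ℂ) → τ → ℂ} (c : τ → ℂ) (l : (σ → ℂ) →ₗ[ℂ] (τ → ℂ)) (q : (σ → ℂ) → τ → ℂ)
    (hφ : ∀ z t, φ z t = c t + l z t + q z t) (hl : Function.Surjective l)
    (hq : ∀ t, HasStrictFDerivAt (fun z => q z t) (0 : (σ → ℂ) →L[ℂ] ℂ) 0)
    (P : MvPolynomial τ ℂ) (hP : ∀ z, MvPolynomial.eval (φ z) P = 0) : P = 0 := by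
  classical
  let l' : (σ → ℂ) →L[ℂ] (τ → ℂ) := l.toContinuousLinearMap
  have h1 : HasStrictFDerivAt φ l' 0 := by
    rw [hasStrictFDerivAt_pi']
    intro t
    have h2 : HasStrictFDerivAt (fun z => l' z t)
        ((ContinuousLinearMap.proj (R := ℂ) (φ := fun _ : τ => ℂ) t).comp l') 0 :=
      ((ContinuousLinearMap.proj (R := ℂ) (φ := fun _ : τ => ℂ) t).comp l').hasStrictFDerivAt
    have h3 := (h2.const_add (c t)).add (hq t)
    rw [add_zero] at h3
    refine h3.congr_of_eventuallyEq (Filter.Eventually.of_forall fun z => ?_)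
    exact (hφ z t).symm
  -- A map with surjective strict derivative is open at the point, so `P` vanishes on a
  -- neighbourhood of `φ 0`, in particular on a product of infinite sets.
  have h4 := h1.map_nhds_eq_of_surj (LinearMap.range_eq_top.2 hl)
  have h5 : ∀ᶠ y in nhds (φ 0), MvPolynomial.eval y P = 0 := by
    rw [← h4, Filter.eventually_map]
    exact Filter.Eventually.of_forall hP
  obtain ⟨ε, hε, hball⟩ := Metric.eventually_nhds_iff.1 h5
  refine MvPolynomial.funext_set (fun t => Metric.ball (φ 0 t) ε) (fun t => ?_) fun y hy => ?_
  · exact infinite_of_mem_nhds _ (Metric.ball_mem_nhds _ hε)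
  · rw [map_zero]
    refine hball ((dist_pi_lt_iff hε).2 fun t => hy t trivial)

theorem oneCols_mul_mul_oneRows {R κ C l : Type*} [Fintype R] [Fintype κ]
    [Fintype C] [Fintype l] [DecidableEq R] [DecidableEq C] (X : Matrix R κ ℂ)
    (Y : Matrix l C ℂ) (G : Matrix (R ⊕ κ) (C ⊕ l) ℂ) :
    oneCols X * G * oneRows Y = G.toBlocks₁₁ + (G.toBlocks₁₂ * Y + X * G.toBlocks₂₁) +
      X * G.toBlocks₂₂ * Y := by
  conv_lhs => rw [← Matrix.fromBlocks_toBlocks G]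
  rw [Matrix.fromCols_mul_fromBlocks, Matrix.fromCols_mul_fromRows, Matrix.one_mul,
    Matrix.one_mul, Matrix.mul_one, Matrix.add_mul]
  abel

/-! ### The class IV alignment equations -/

namespace Layout

variable {K : ℕ} {G : Layout K}

/-- The class IV links. -/
def linksIV (G : Layout K) : Finset (Fin K × Fin K) :=
  Finset.univ.filter fun x => x.2 ∈ G.IV x.1

/-- The effective channel `[1 X_j] H_{ji} [1; Y_i]`. -/
def eff (X : ∀ j, Matrix (G.RowT j) (G.RowB j) ℂ) (Y : ∀ i, Matrix (G.ColB i) (G.ColT i) ℂ)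
    (E : G.Idx → ℂ) (j i : Fin K) : Matrix (G.RowT j) (G.ColT i) ℂ :=
  oneCols (X j) * G.mat E j i * oneRows (Y i)

theorem isPolyOn_eff {X : ∀ j, Matrix (G.RowT j) (G.RowB j) ℂ}
    {Y : ∀ i, Matrix (G.ColB i) (G.ColT i) ℂ} {k : IntermediateField ℚ ℂ}
    (hX : ∀ j a b, X j a b ∈ k) (hY : ∀ i a b, Y i a b ∈ k) {C : Fin K → Finset (Fin K)}
    {j i : Fin K} (h : i ∈ C j) (a : G.RowT j) (b : G.ColT i) :
    IsPolyOn k (G.links C) fun E => eff X Y E j i a b :=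
  IsPolyOn.matrix_mul (A := fun E => oneCols (X j) * G.mat E j i) (B := fun _ => oneRows (Y i))
    (fun c d => IsPolyOn.matrix_mul (A := fun _ => oneCols (X j))
      (fun c d => IsPolyOn.const (oneCols_mem (hX j) c d)) (fun c d => isPolyOn_mat h c d) c d)
    (fun c d => IsPolyOn.const (oneRows_mem (hY i) c d)) a b

/-- The index type of the free entries of the precoders and decorrelators. -/
abbrev Unk (G : Layout K) : Type :=
  (Σ i : Fin K, (Fin (G.s i) × Fin G.δ) × Fin G.δ) ⊕
    (Σ j : Fin K, (G.D j × Fin G.δ) × (Fin (G.r j) × Fin G.δ))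

/-- The precoder part of a vector of unknowns. -/
def unkV (z : G.Unk → ℂ) (i : Fin K) : Matrix (Fin (G.s i) × Fin G.δ) (Fin G.δ) ℂ :=
  Matrix.of fun t β => z (Sum.inl ⟨i, t, β⟩)

/-- The decorrelator part of a vector of unknowns. -/
def unkC (z : G.Unk → ℂ) (j : Fin K) : Matrix (G.D j × Fin G.δ) (Fin (G.r j) × Fin G.δ) ℂ :=
  Matrix.of fun u t => z (Sum.inr ⟨j, u, t⟩)

/-- The linearised alignment equations. -/
def linEq (W : ∀ j i, Matrix (G.RowT j) (G.ColT i) ℂ) :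
    (G.Unk → ℂ) →ₗ[ℂ] (EqIdx G.linksIV G.D G.δ → ℂ) where
  toFun z q := -((W q.1.1.1 q.1.1.2).toBlocks₁₂ * unkV z q.1.1.2 +
    unkC z q.1.1.1 * (W q.1.1.1 q.1.1.2).toBlocks₂₁) q.2.1 q.2.2
  map_add' z z' := by
    ext q
    have h1 : unkV (z + z') q.1.1.2 = unkV z q.1.1.2 + unkV z' q.1.1.2 := rfl
    have h2 : unkC (z + z') q.1.1.1 = unkC z q.1.1.1 + unkC z' q.1.1.1 := rfl
    rw [h1, h2, Matrix.mul_add, Matrix.add_mul]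
    simp only [Matrix.add_apply, Pi.add_apply]
    ring
  map_smul' c z := by
    ext q
    have h1 : unkV (c • z) q.1.1.2 = c • unkV z q.1.1.2 := rfl
    have h2 : unkC (c • z) q.1.1.1 = c • unkC z q.1.1.1 := rfl
    rw [h1, h2, Matrix.mul_smul, Matrix.smul_mul]
    simp only [Matrix.add_apply, Matrix.smul_apply, Pi.smul_apply, RingHom.id_apply, smul_eq_mul]
    ring

/-- The special solution provides one candidate direction `(v, C)` per equation. `Q` is the matrix
of the linearised equations on these directions, up to sign: its determinant is a polynomial in
class IV over the field of classes II and III, and `Q` is the identity at the special channel `e`.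
-/
theorem linEq_surjective {E : G.Idx → ℂ} (hE : AlgebraicIndependent ℚ E)
    {X : ∀ j, Matrix (G.RowT j) (G.RowB j) ℂ}
    (hX : ∀ j a b, X j a b ∈ acl (E '' (G.links G.II ∪ G.links G.III)))
    {Y : ∀ i, Matrix (G.ColB i) (G.ColT i) ℂ}
    (hY : ∀ i a b, Y i a b ∈ acl (E '' (G.links G.II ∪ G.links G.III)))
    (hcount : ∀ Ω ⊆ G.linksIV, ∑ x ∈ Ω, Fintype.card (G.D x.1) ≤
      ∑ j ∈ Ω.image Prod.fst, Fintype.card (G.D j) * G.r j + ∑ i ∈ Ω.image Prod.snd, G.s i) :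
    Function.Surjective (linEq (eff X Y E)) := by
  classical
  obtain ⟨b, c, v, C, hv, hC, hbc⟩ := exists_block_solution G.linksIV G.D G.r G.s G.δ hcount
  let Q : (G.Idx → ℂ) → Matrix (EqIdx G.linksIV G.D G.δ) (EqIdx G.linksIV G.D G.δ) ℂ :=
    fun E => Matrix.of fun q q' =>
      ((eff X Y E q.1.1.1 q.1.1.2).toBlocks₁₂ * v q.1.1.2 q' +
        C q.1.1.1 q' * (eff X Y E q.1.1.1 q.1.1.2).toBlocks₂₁) q.2.1 q.2.2
  have hdet : (Q E).det ≠ 0 := by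
    have hind := algebraicIndependent_acl hE (S := G.links G.II ∪ G.links G.III)
      (T := G.links G.IV) (Set.disjoint_left.2 fun x hx hx' => by
        rcases hx with hx | hx
        · exact G.II_IV hx hx'
        · exact G.III_IV hx hx')
    let e : G.Idx → ℂ := fun x => (Matrix.fromBlocks (Matrix.fromBlocks 0 (b x.1 x.2.1)
      (c x.1 x.2.1) 0) 0 0 0 : Matrix (G.Row x.1) (G.Col x.2.1) ℂ) x.2.2.1 x.2.2.2
    refine IsPolyOn.ne_zero (f := fun E => (Q E).det) (IsPolyOn.det fun q q' => ?_) hind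
      (e := e) ?_
    · have hq : q.1.1.2 ∈ G.IV q.1.1.1 := (Finset.mem_filter.1 q.1.2).2
      exact (IsPolyOn.matrix_mul (A := fun E => (eff X Y E q.1.1.1 q.1.1.2).toBlocks₁₂)
        (B := fun _ => v q.1.1.2 q') (fun _ _ => isPolyOn_eff hX hY hq _ _)
        (fun _ _ => IsPolyOn.const (hv _ _ _ _ _)) _ _).add
        (IsPolyOn.matrix_mul (B := fun E => (eff X Y E q.1.1.1 q.1.1.2).toBlocks₂₁)
        (A := fun _ => C q.1.1.1 q') (fun _ _ => IsPolyOn.const (hC _ _ _ _ _))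
        (fun _ _ => isPolyOn_eff hX hY hq _ _) _ _)
    · have heff : ∀ j i, eff X Y e j i = Matrix.fromBlocks 0 (b j i) (c j i) 0 := fun j i =>
        oneCols_mul_fromBlocks_mul_oneRows (X j) (Y i) (Matrix.fromBlocks 0 (b j i) (c j i) 0)
      have hQ : Q e = 1 := by
        ext q q'
        simp only [Q, heff, Matrix.of_apply]
        rw [Matrix.toBlocks_fromBlocks₁₂, Matrix.toBlocks_fromBlocks₂₁, hbc, Matrix.one_apply]
        congr
      rw [hQ, Matrix.det_one]
      exact one_ne_zero
  let col : EqIdx G.linksIV G.D G.δ → G.Unk → ℂ := fun q' =>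
    Sum.elim (fun x => v x.1 q' x.2.1 x.2.2) fun x => C x.1 q' x.2.1 x.2.2
  have hcol : ∀ q q', linEq (eff X Y E) (col q') q = -Q E q q' := fun q q' => rfl
  intro y
  refine ⟨∑ q', -((Q E)⁻¹ *ᵥ y) q' • col q', ?_⟩
  ext q
  rw [map_sum, Finset.sum_apply]
  have h1 : ∀ q', linEq (eff X Y E) (-((Q E)⁻¹ *ᵥ y) q' • col q') q =
      Q E q q' * ((Q E)⁻¹ *ᵥ y) q' := by
    intro q'
    rw [map_smul, Pi.smul_apply, hcol, smul_eq_mul]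
    ring
  rw [Finset.sum_congr rfl fun q' _ => h1 q']
  have h2 : Q E *ᵥ ((Q E)⁻¹ *ᵥ y) = y := by
    rw [Matrix.mulVec_mulVec, Matrix.mul_nonsing_inv _ (isUnit_iff_ne_zero.2 hdet),
      Matrix.one_mulVec]
  exact congrFun h2 q

theorem isPolyOn_align {k : IntermediateField ℚ ℂ} {j i : Fin K}
    {W : Matrix (G.RowT j) (G.ColT i) ℂ} (hW : ∀ a b, W a b ∈ k) (u : G.D j × Fin G.δ)
    (β : Fin G.δ) : IsPolyOn k Set.univ fun z : G.Unk → ℂ =>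
      (oneCols (unkC z j) * W * oneRows (unkV z i)) u β := by
  have h1 : ∀ a b, IsPolyOn k Set.univ fun z : G.Unk → ℂ => oneCols (unkC z j) a b := by
    rintro p (p' | p')
    · exact IsPolyOn.const (one_matrix_mem k p p')
    · exact IsPolyOn.coord (σ := G.Unk) (t := Sum.inr ⟨j, p, p'⟩) (Set.mem_univ _)
  have h2 : ∀ a b, IsPolyOn k Set.univ fun z : G.Unk → ℂ => oneRows (unkV z i) a b := by
    rintro (p | p) p'
    · exact IsPolyOn.const (one_matrix_mem k p p')
    · exact IsPolyOn.coord (σ := G.Unk) (t := Sum.inl ⟨i, p, p'⟩) (Set.mem_univ _)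
  have h3 : ∀ a b, IsPolyOn k Set.univ fun z : G.Unk → ℂ => (oneCols (unkC z j) * W) a b :=
    IsPolyOn.matrix_mul (A := fun z : G.Unk → ℂ => oneCols (unkC z j)) (B := fun _ => W) h1
      fun _ _ => IsPolyOn.const (hW _ _)
  exact IsPolyOn.matrix_mul (A := fun z : G.Unk → ℂ => oneCols (unkC z j) * W)
    (B := fun z => oneRows (unkV z i)) h3 h2 u β

/-- Expanding the product of blocks gives a constant, the linear part `linEq W`, and a term bilinear
in `C` and `v`, whose derivative vanishes at the origin. -/
theorem eq_zero_of_align {W : ∀ j i, Matrix (G.RowT j) (G.ColT i) ℂ}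
    (hW : Function.Surjective (linEq W)) (P : MvPolynomial (EqIdx G.linksIV G.D G.δ) ℂ)
    (hP : ∀ z : G.Unk → ℂ, MvPolynomial.eval (fun q => 0 - (oneCols (unkC z q.1.1.1) *
      W q.1.1.1 q.1.1.2 * oneRows (unkV z q.1.1.2)) q.2.1 q.2.2) P = 0) : P = 0 := by
  refine eq_zero_of_surjective_deriv (fun q => -(W q.1.1.1 q.1.1.2).toBlocks₁₁ q.2.1 q.2.2)
    (linEq W) (fun z q => -(unkC z q.1.1.1 * (W q.1.1.1 q.1.1.2).toBlocks₂₂ *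
      unkV z q.1.1.2) q.2.1 q.2.2) (fun z q => ?_) hW (fun q => ?_) P hP
  · simp only [oneCols_mul_mul_oneRows]
    simp only [linEq, LinearMap.coe_mk, AddHom.coe_mk, Matrix.add_apply]
    ring
  · have h : ∀ z : G.Unk → ℂ, -(unkC z q.1.1.1 *
        (W q.1.1.1 q.1.1.2).toBlocks₂₂ * unkV z q.1.1.2) q.2.1 q.2.2 =
        -∑ t', ∑ t, z (Sum.inr ⟨q.1.1.1, q.2.1, t⟩) *
          (W q.1.1.1 q.1.1.2).toBlocks₂₂ t t' * z (Sum.inl ⟨q.1.1.2, t', q.2.2⟩) := by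
      intro z
      simp only [Matrix.mul_apply, Finset.sum_mul]
      rfl
    simp only [h]
    have h1 := (HasStrictFDerivAt.fun_sum (u := Finset.univ) fun t' _ =>
      HasStrictFDerivAt.fun_sum (u := Finset.univ) fun t _ =>
      hasStrictFDerivAt_mul_mul (σ := G.Unk) (Sum.inr ⟨q.1.1.1, q.2.1, t⟩)
        (Sum.inl ⟨q.1.1.2, t', q.2.2⟩) ((W q.1.1.1 q.1.1.2).toBlocks₂₂ t t')).neg
    refine h1.congr_fderiv ?_
    simp

/-- The corner entries of the class IV channels enter the alignment equations additively and with
coefficient 1, one for each equation. Moved to the other side, they form a value that is generic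
over the field of all remaining coefficients, and a dominant polynomial map attains it. -/
theorem exists_alignment {E : G.Idx → ℂ} (hE : AlgebraicIndependent ℚ E)
    {X : ∀ j, Matrix (G.RowT j) (G.RowB j) ℂ}
    (hX : ∀ j a b, X j a b ∈ acl (E '' (G.links G.II ∪ G.links G.III)))
    {Y : ∀ i, Matrix (G.ColB i) (G.ColT i) ℂ}
    (hY : ∀ i a b, Y i a b ∈ acl (E '' (G.links G.II ∪ G.links G.III)))
    (hcount : ∀ Ω ⊆ G.linksIV, ∑ x ∈ Ω, Fintype.card (G.D x.1) ≤
      ∑ j ∈ Ω.image Prod.fst, Fintype.card (G.D j) * G.r j + ∑ i ∈ Ω.image Prod.snd, G.s i) :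
    ∃ z : G.Unk → ℂ, ∀ j, ∀ i ∈ G.IV j,
      oneCols (unkC z j) * eff X Y E j i * oneRows (unkV z i) = 0 := by
  classical
  -- `T` holds the corner entries and `E'` is the channel with these set to zero, so the effective
  -- channels of `E'` have entries in `k`.
  let T : Set G.Idx := {x | x.2.1 ∈ G.IV x.1 ∧ ∃ u β, x.2.2 = (Sum.inl (Sum.inl u),
    Sum.inl (Sum.inl β))}
  let S : Set G.Idx := (G.links G.II ∪ G.links G.III) ∪ (G.links G.IV \ T)
  have hST : Disjoint S T := Set.disjoint_left.2 fun x hx hx' => by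
    rcases hx with (hx | hx) | hx
    · exact G.II_IV hx hx'.1
    · exact G.III_IV hx hx'.1
    · exact hx.2 hx'
  set k := acl (E '' S) with hk
  have hsub : acl (E '' (G.links G.II ∪ G.links G.III)) ≤ k :=
    acl_mono (Set.image_mono Set.subset_union_left)
  let E' : G.Idx → ℂ := fun x => if x ∈ T then 0 else E x
  let a : ∀ j i, Matrix (G.D j × Fin G.δ) (Fin G.δ) ℂ := fun j i => Matrix.of fun u β =>
    E ⟨j, i, Sum.inl (Sum.inl u), Sum.inl (Sum.inl β)⟩
  have hmat : ∀ {j i}, i ∈ G.IV j → G.mat E j i =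
      G.mat E' j i + Matrix.fromBlocks (Matrix.fromBlocks (a j i) 0 0 0) 0 0 0 := by
    intro j i hi
    ext p p'
    by_cases hx : (⟨j, i, p, p'⟩ : G.Idx) ∈ T
    · obtain ⟨u, β, h⟩ : ∃ (u : G.D j × Fin G.δ) (β : Fin G.δ), (p, p') =
          ((Sum.inl (Sum.inl u) : G.Row j), (Sum.inl (Sum.inl β) : G.Col i)) := hx.2
      obtain ⟨rfl, rfl⟩ := Prod.mk.inj h
      have hx : (⟨j, i, Sum.inl (Sum.inl u), Sum.inl (Sum.inl β)⟩ : G.Idx) ∈ T :=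
        ⟨hi, u, β, rfl⟩
      simp [mat, E', hx, a]
    · have hx' : ¬ ∃ u β, (p, p') = ((Sum.inl (Sum.inl u) : G.Row j),
          (Sum.inl (Sum.inl β) : G.Col i)) := fun h => hx ⟨hi, h⟩
      have h0 : (Matrix.fromBlocks (Matrix.fromBlocks (a j i) 0 0 0) 0 0 0 :
          Matrix (G.Row j) (G.Col i) ℂ) p p' = 0 := by
        rcases p with (p | p) | p <;> rcases p' with (p' | p') | p' <;> try rfl
        exact absurd ⟨p, p', rfl⟩ hx'
      rw [Matrix.add_apply, h0, add_zero]
      simp [mat, E', hx]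
  have heff : ∀ {j i}, i ∈ G.IV j → eff X Y E j i =
      eff X Y E' j i + Matrix.fromBlocks (a j i) 0 0 0 := by
    intro j i hi
    rw [eff, hmat hi, Matrix.mul_add, Matrix.add_mul, oneCols_mul_fromBlocks_mul_oneRows]
    rfl
  have hE'k : ∀ {j i}, i ∈ G.IV j → ∀ p p', eff X Y E' j i p p' ∈ k := by
    intro j i hi p p'
    refine matrix_mul_mem (matrix_mul_mem (oneCols_mem fun _ _ => hsub (hX _ _ _))
      fun p p' => ?_) (oneRows_mem fun _ _ => hsub (hY _ _ _)) p p'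
    by_cases hx : (⟨j, i, p, p'⟩ : G.Idx) ∈ T
    · simp only [mat, E', Matrix.of_apply, if_pos hx]
      exact k.zero_mem
    · simp only [mat, E', Matrix.of_apply, if_neg hx]
      exact subset_acl _ ⟨_, Or.inr ⟨hi, hx⟩, rfl⟩
  have hsurj : Function.Surjective (linEq (eff X Y E')) := by
    -- The linear part sees only the off-diagonal blocks, which do not contain the corner entries.
    have : linEq (eff X Y E') = linEq (eff X Y E) := by
      refine LinearMap.ext fun z => funext fun q => ?_
      have hq : q.1.1.2 ∈ G.IV q.1.1.1 := (Finset.mem_filter.1 q.1.2).2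
      have h12 : (eff X Y E' q.1.1.1 q.1.1.2).toBlocks₁₂ =
          (eff X Y E q.1.1.1 q.1.1.2).toBlocks₁₂ := by
        rw [heff hq]
        ext p p'
        simp [Matrix.toBlocks₁₂]
      have h21 : (eff X Y E' q.1.1.1 q.1.1.2).toBlocks₂₁ =
          (eff X Y E q.1.1.1 q.1.1.2).toBlocks₂₁ := by
        rw [heff hq]
        ext p p'
        simp [Matrix.toBlocks₂₁]
      simp only [linEq, LinearMap.coe_mk, AddHom.coe_mk, h12, h21]
    rw [this]
    exact linEq_surjective hE hX hY hcount
  let φ : EqIdx G.linksIV G.D G.δ → (G.Unk → ℂ) → ℂ := fun q z =>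
    0 - (oneCols (unkC z q.1.1.1) * eff X Y E' q.1.1.1 q.1.1.2 * oneRows (unkV z q.1.1.2))
      q.2.1 q.2.2
  have hind : AlgebraicIndependent k
      (fun q : EqIdx G.linksIV G.D G.δ => a q.1.1.1 q.1.1.2 q.2.1 q.2.2) := by
    have h := algebraicIndependent_acl hE hST
    let g : EqIdx G.linksIV G.D G.δ → T := fun q => ⟨⟨q.1.1.1, q.1.1.2,
      Sum.inl (Sum.inl q.2.1), Sum.inl (Sum.inl q.2.2)⟩,
      (Finset.mem_filter.1 q.1.2).2, q.2.1, q.2.2, rfl⟩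
    refine h.comp g ?_
    rintro ⟨⟨⟨j, i⟩, hx⟩, u, β⟩ ⟨⟨⟨j', i'⟩, hx'⟩, u', β'⟩ h
    have h := congrArg Subtype.val h
    simp only [g, Sigma.mk.injEq] at h
    obtain ⟨rfl, h⟩ := h
    have h := eq_of_heq h
    simp only [Sigma.mk.injEq] at h
    obtain ⟨rfl, h⟩ := h
    have h := eq_of_heq h
    simp only [Prod.mk.injEq, Sum.inl.injEq] at h
    obtain ⟨rfl, rfl⟩ := h
    rfl
  have hpoly : ∀ q, IsPolyOn k Set.univ (φ q) := fun q =>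
    IsPolyOn.zero.sub (isPolyOn_align (hE'k (Finset.mem_filter.1 q.1.2).2) _ _)
  have hdom : ∀ P : MvPolynomial (EqIdx G.linksIV G.D G.δ) ℂ,
      (∀ z, MvPolynomial.eval (fun q => φ q z) P = 0) → P = 0 := eq_zero_of_align hsurj
  obtain ⟨z, hz⟩ := exists_eval_eq_of_algebraicIndependent k φ hpoly hdom hind
  refine ⟨z, fun j i hi => ?_⟩
  ext u β
  have h := hz ⟨⟨(j, i), Finset.mem_filter.2 ⟨Finset.mem_univ _, hi⟩⟩, u, β⟩
  simp only [φ] at h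
  rw [heff hi, Matrix.mul_add, Matrix.add_mul, oneCols_mul_fromBlocks_mul_oneRows,
    Matrix.add_apply, ← h, Matrix.zero_apply]
  ring

end Layout

/-! ### Matrices and subspaces -/

theorem col_mem_colSpan {m n : Type*} [Fintype n] (A : Matrix m n ℂ) (b : n) :
    (fun a => A a b) ∈ colSpan A := by
  classical
  refine ⟨Pi.single b 1, ?_⟩
  rw [Matrix.mulVecLin_apply, Matrix.mulVec_single_one]
  rfl

theorem exists_eq_mul_of_col_mem {m n p : Type*} [Fintype p] {A : Matrix m n ℂ}
    {B : Matrix m p ℂ} (h : ∀ b, (fun a => A a b) ∈ colSpan B) : ∃ C : Matrix p n ℂ, A = B * C := by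
  choose c hc using h
  refine ⟨Matrix.of fun x b => c b x, ?_⟩
  ext a b
  exact (congrFun (hc b) a).symm

theorem colSpan_mul_le {m n p : Type*} [Fintype n] [Fintype p] (A : Matrix m n ℂ)
    (B : Matrix n p ℂ) : colSpan (A * B) ≤ colSpan A := by
  rintro _ ⟨c, rfl⟩
  exact ⟨B *ᵥ c, by rw [Matrix.mulVecLin_apply, Matrix.mulVecLin_apply, Matrix.mulVec_mulVec]⟩

theorem exists_isOrthonormalBasisMatrix {m n : ℕ} (W : Submodule ℂ (Fin m → ℂ))
    (h : Module.finrank ℂ W = n) :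
    ∃ S : Matrix (Fin m) (Fin n) ℂ, IsOrthonormalBasisMatrix S W := by
  let e : EuclideanSpace ℂ (Fin m) ≃ₗ[ℂ] (Fin m → ℂ) := WithLp.linearEquiv 2 ℂ (Fin m → ℂ)
  let W' : Submodule ℂ (EuclideanSpace ℂ (Fin m)) := W.comap e.toLinearMap
  have hW' : Module.finrank ℂ W' = n := by
    have h1 : W' = W.map e.symm.toLinearMap := by
      ext x
      rw [Submodule.mem_comap, Submodule.mem_map]
      exact ⟨fun hx => ⟨e x, hx, e.symm_apply_apply x⟩, by
        rintro ⟨y, hy, rfl⟩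
        have h2 : e (e.symm y) = y := e.apply_symm_apply y
        exact (congrArg (· ∈ W) h2).mpr hy⟩
    rw [← h, h1]
    exact LinearEquiv.finrank_map_eq e.symm W
  let b := (stdOrthonormalBasis ℂ W').reindex (finCongr hW')
  refine ⟨Matrix.of fun a x => (b x : EuclideanSpace ℂ (Fin m)) a, ?_, ?_⟩
  · ext x y
    have := orthonormal_iff_ite.1 b.orthonormal x y
    rw [Submodule.coe_inner, PiLp.inner_apply] at this
    rw [Matrix.mul_apply, Matrix.one_apply, ← this]
    refine Finset.sum_congr rfl fun a _ => ?_
    rw [Matrix.conjTranspose_apply, Matrix.of_apply, Matrix.of_apply]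
    simp [mul_comm]
  · apply le_antisymm
    · rintro _ ⟨c, rfl⟩
      have : (Matrix.of fun a x => (b x : EuclideanSpace ℂ (Fin m)) a) *ᵥ c =
          e ((∑ x, c x • b x : W') : EuclideanSpace ℂ (Fin m)) := by
        ext a
        simp [Matrix.mulVec, dotProduct, mul_comm, e]
      rw [Matrix.mulVecLin_apply, this]
      exact Subtype.mem (∑ x, c x • b x : W')
    · intro w hw
      have hw' : e.symm w ∈ W' := by
        change e (e.symm w) ∈ W
        rwa [LinearEquiv.apply_symm_apply]
      refine ⟨fun x => b.repr ⟨e.symm w, hw'⟩ x, ?_⟩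
      have h1 := congrArg (fun v : W' => e (v : EuclideanSpace ℂ (Fin m)))
        (b.sum_repr ⟨e.symm w, hw'⟩)
      simp only [LinearEquiv.apply_symm_apply] at h1
      rw [Matrix.mulVecLin_apply]
      conv_rhs => rw [← h1]
      ext a
      simp [Matrix.mulVec, dotProduct, mul_comm, e]

theorem finrank_colSpan {m n : Type*} [Fintype m] [Fintype n] [DecidableEq n] {A : Matrix m n ℂ}
    {B : Matrix n m ℂ} (h : B * A = 1) : Module.finrank ℂ (colSpan A) = Fintype.card n := by
  have hinj : Function.Injective A.mulVecLin := by
    intro x y hxy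
    have := congrArg (B *ᵥ ·) hxy
    simpa [Matrix.mulVecLin_apply, Matrix.mulVec_mulVec, h] using this
  rw [colSpan, LinearMap.finrank_range_of_inj hinj, Module.finrank_fintype_fun_eq_card]

theorem exists_linearIndependent_fun {V a : Type*} [AddCommGroup V] [Module ℂ V]
    [FiniteDimensional ℂ V] [Fintype a] (h : Fintype.card a ≤ Module.finrank ℂ V) :
    ∃ x : a → V, LinearIndependent ℂ x := by
  refine ⟨fun x => Module.finBasis ℂ V (Fin.castLE h (Fintype.equivFin a x)), ?_⟩
  exact (Module.finBasis ℂ V).linearIndependent.comp _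
    ((Fin.castLE_injective h).comp (Fintype.equivFin a).injective)

theorem exists_mul_eq_one_of_linearIndependent {a c : Type*} [Fintype a] [Fintype c]
    [DecidableEq a] (Q : Matrix a c ℂ) (h : LinearIndependent ℂ Q.row) :
    ∃ Q' : Matrix c a ℂ, Q * Q' = 1 := by
  classical
  have hinj : Function.Injective Q.vecMulLinear := by
    exact Matrix.vecMul_injective_iff.2 h
  obtain ⟨g, hg⟩ := Q.vecMulLinear.exists_leftInverse_of_injective (LinearMap.ker_eq_bot.2 hinj)
  refine ⟨(LinearMap.toMatrix' g)ᵀ, ?_⟩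
  ext x y
  have h1 := congrArg (fun f => f (Pi.single x 1) y) hg
  simp only [LinearMap.comp_apply, LinearMap.id_apply, Matrix.vecMulLinear_apply,
    Matrix.single_one_vecMul] at h1
  rw [Matrix.mul_apply_eq_vecMul, Matrix.vecMul_transpose, LinearMap.toMatrix'_mulVec]
  refine Eq.trans h1 ?_
  rw [Matrix.one_apply, Pi.single_apply]
  simp [eq_comm]

/-- The left kernel of a matrix with more rows than columns. -/
theorem exists_left_annihilator {a b c : Type*} [Fintype a] [Fintype b] [Fintype c]
    [DecidableEq a] (hc : Fintype.card c = Fintype.card a + Fintype.card b) (Ξ : Matrix c b ℂ) :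
    ∃ (Q : Matrix a c ℂ) (Q' : Matrix c a ℂ), Q * Q' = 1 ∧ Q * Ξ = 0 := by
  have hdim : Fintype.card a ≤ Module.finrank ℂ (LinearMap.ker Ξ.vecMulLinear) := by
    have h1 := LinearMap.finrank_range_add_finrank_ker Ξ.vecMulLinear
    have h2 := Submodule.finrank_le (LinearMap.range Ξ.vecMulLinear)
    rw [Module.finrank_fintype_fun_eq_card] at h1 h2
    omega
  obtain ⟨x, hx⟩ := exists_linearIndependent_fun hdim
  have hli := hx.map' _ (Submodule.ker_subtype _)
  obtain ⟨Q', hQ'⟩ := exists_mul_eq_one_of_linearIndependent (Matrix.of fun t => (x t : c → ℂ)) hli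
  refine ⟨_, Q', hQ', ?_⟩
  ext t y
  rw [Matrix.mul_apply_eq_vecMul]
  exact congrFun (x t).2 y

theorem padRows_mul_mul_padRows {m n M N : ℕ} (hm : m ≤ M) (hn : n ≤ N) {p q : Type*} [Fintype p]
    [Fintype q] (U : Matrix (Fin m) p ℂ) (V : Matrix (Fin n) q ℂ) (H : Matrix (Fin M) (Fin N) ℂ) :
    (padRows M U)ᴴ * H * padRows N V =
      Uᴴ * H.submatrix (Fin.castLE hm) (Fin.castLE hn) * V := by
  have hsum : ∀ {m M : ℕ} (hm : m ≤ M) (f : Fin M → ℂ), (∀ a : Fin M, m ≤ a → f a = 0) →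
      ∑ a, f a = ∑ a : Fin m, f (Fin.castLE hm a) := by
    intro m M hm f hf
    have h1 : ∑ a : Fin m, f (Fin.castLE hm a) =
        ∑ a ∈ Finset.univ.map (Fin.castLEEmb hm), f a :=
      (Finset.sum_map Finset.univ (Fin.castLEEmb hm) f).symm
    rw [h1]
    refine (Finset.sum_subset (Finset.subset_univ _) fun a _ ha => hf a ?_).symm
    by_contra h
    exact ha (Finset.mem_map.2 ⟨⟨a, by omega⟩, Finset.mem_univ _, rfl⟩)
  ext x y
  rw [Matrix.mul_apply, Matrix.mul_apply, hsum hn]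
  · refine Finset.sum_congr rfl fun b _ => ?_
    congr 1
    · rw [Matrix.mul_apply, Matrix.mul_apply, hsum hm]
      · refine Finset.sum_congr rfl fun a _ => ?_
        simp [padRows]
      · intro a ha
        simp [padRows, not_lt.2 ha]
    · simp [padRows]
  · intro b hb
    simp [padRows, not_lt.2 hb]

theorem IsPolyOn.blockDiagonal' {σ o : Type*} {m n : o → Type*} [DecidableEq o]
    {k : IntermediateField ℚ ℂ} {T : Set σ} {A : (σ → ℂ) → ∀ i, Matrix (m i) (n i) ℂ}
    (hA : ∀ i a b, IsPolyOn k T fun z => A z i a b) (a : Σ i, m i) (b : Σ i, n i) :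
    IsPolyOn k T fun z => Matrix.blockDiagonal' (A z) a b := by
  obtain ⟨i, a⟩ := a
  obtain ⟨i', b⟩ := b
  by_cases h : i = i'
  · subst h
    simp only [Matrix.blockDiagonal'_apply_eq]
    exact hA i a b
  · simp only [Matrix.blockDiagonal'_apply_ne _ _ _ h]
    exact IsPolyOn.zero

/-! ### Precoders computed from the feedback -/

/-- A basis of a subspace of `ℂ^ι` that is defined over every algebraically closed subfield over
which the subspace is defined. -/
def canonicalBasis {ι : Type*} [Fintype ι] (W : Submodule ℂ (ι → ℂ)) :
    Matrix ι (Fin (Module.finrank ℂ W)) ℂ :=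
  (exists_canonical_basis W).choose

theorem colSpan_canonicalBasis {ι : Type*} [Fintype ι] (W : Submodule ℂ (ι → ℂ)) :
    colSpan (canonicalBasis W) = W :=
  (exists_canonical_basis W).choose_spec.1

theorem canonicalBasis_mem {ι : Type*} [Fintype ι] {W : Submodule ℂ (ι → ℂ)}
    {k : IntermediateField ℚ ℂ} [IsAlgClosed k] {κ : Type} [Fintype κ] {A : Matrix ι κ ℂ}
    (hA : ∀ a b, A a b ∈ k) (hAW : colSpan A = W) (a : ι) (b : Fin (Module.finrank ℂ W)) :
    canonicalBasis W a b ∈ k :=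
  (exists_canonical_basis W).choose_spec.2 k κ A hA hAW a b

/-- The left side depends on `P` only through its row space. This is why the fed back row space
suffices to decide alignment, which on the right is a factorisation through a space with index set
`p`. -/
theorem forall_mem_colSpan_transpose_iff {l m n p : Type*} [Fintype l] [Fintype m] [Fintype p]
    (P : Matrix l m ℂ) (D : Matrix m n ℂ) (Y : Matrix p n ℂ) :
    (∀ w ∈ colSpan Pᵀ, ∃ c, w ᵥ* D = c ᵥ* Y) ↔ ∃ X : Matrix l p ℂ, P * D = X * Y := by
  constructor
  · intro h
    choose c hc using fun a => h _ (col_mem_colSpan Pᵀ a)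
    refine ⟨Matrix.of c, ?_⟩
    ext a b
    exact congrFun (hc a) b
  · rintro ⟨X, hX⟩ _ ⟨c, rfl⟩
    refine ⟨c ᵥ* X, ?_⟩
    rw [Matrix.mulVecLin_apply, Matrix.mulVec_transpose, Matrix.vecMul_vecMul, hX,
      Matrix.vecMul_vecMul]

namespace FeedbackProfile

variable {K : ℕ} {M N : Fin K → ℕ} (L : FeedbackProfile M N)

/-- Precoders that align the class IV interference in `r j * δ` dimensions at receiver `j`,
expressed in terms of the feedback only. -/
structure IsFeedbackPrecoder (r : Fin K → ℕ) (δ : ℕ) (F : ∀ j, L.FeedbackTuple j)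
    (V : ∀ i, Matrix (Fin (L.Ns i)) (Fin δ) ℂ) : Prop where
  mem_txSpace : ∀ i β, (fun a => V i a β) ∈ L.txSpace F i
  exists_left_inverse : ∀ i, ∃ W : Matrix (Fin δ) (Fin (L.Ns i)) ℂ, W * V i = 1
  -- Stated on the row space itself, hence independent of the choice of a basis at the receiver.
  exists_aligned : ∀ j, ∃ Y : Matrix (Fin (r j) × Fin δ) ((_ : L.ΩIV j) × Fin δ) ℂ,
    ∀ w ∈ (F j).2, ∃ c, w ᵥ* Matrix.blockDiagonal' (fun q : L.ΩIV j => V q) = c ᵥ* Y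

/-- The algebraically closed field generated by the feedback. -/
def feedbackField (F : ∀ j, L.FeedbackTuple j) : IntermediateField ℚ ℂ :=
  acl ({c | ∃ i a b, c = canonicalBasis (L.txSpace F i) a b} ∪
    {c | ∃ j a b, c = canonicalBasis (F j).2 a b})

instance (F : ∀ j, L.FeedbackTuple j) : IsAlgClosed (L.feedbackField F) :=
  inferInstanceAs (IsAlgClosed (acl _))

variable {L}

theorem feedbackField_le {F : ∀ j, L.FeedbackTuple j} {s : Set ℂ}
    (h1 : ∀ i, ∃ (κ : Type) (_ : Fintype κ) (A : Matrix (Fin (L.Ns i)) κ ℂ),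
      (∀ a b, A a b ∈ acl s) ∧ colSpan A = L.txSpace F i)
    (h2 : ∀ j, ∃ (κ : Type) (_ : Fintype κ)
      (A : Matrix ((q : L.ΩIV j) × Fin (L.Ns q)) κ ℂ),
      (∀ a b, A a b ∈ acl s) ∧ colSpan A = (F j).2) :
    L.feedbackField F ≤ acl s := by
  refine acl_le ?_
  rintro _ (⟨i, a, b, rfl⟩ | ⟨j, a, b, rfl⟩)
  · obtain ⟨κ, _, A, hA, hAW⟩ := h1 i
    exact canonicalBasis_mem hA hAW a b
  · obtain ⟨κ, _, A, hA, hAW⟩ := h2 j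
    exact canonicalBasis_mem hA hAW a b

/-- All requirements are polynomial equations over the feedback field once auxiliary unknowns are
added: coordinates `C` in the canonical basis, a left inverse `W` witnessing full rank, and a
factorisation `X * Y` witnessing alignment. `exists_zero_mem` then moves a complex solution into the
field. -/
theorem IsFeedbackPrecoder.exists_mem_feedbackField {r : Fin K → ℕ} {δ : ℕ}
    {F : ∀ j, L.FeedbackTuple j} {V : ∀ i, Matrix (Fin (L.Ns i)) (Fin δ) ℂ}
    (hV : L.IsFeedbackPrecoder r δ F V) :
    ∃ V', L.IsFeedbackPrecoder r δ F V' ∧ ∀ i a b, V' i a b ∈ L.feedbackField F := by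
  set k := L.feedbackField F with hk
  let B := fun i => canonicalBasis (L.txSpace F i)
  let P := fun j => (canonicalBasis (F j).2)ᵀ
  have hB : ∀ i a b, B i a b ∈ k := fun i a b => subset_acl _ (Or.inl ⟨i, a, b, rfl⟩)
  have hP : ∀ j a b, P j a b ∈ k := fun j a b => subset_acl _ (Or.inr ⟨j, b, a, rfl⟩)
  have hPW : ∀ j, colSpan (P j)ᵀ = (F j).2 := fun j => colSpan_canonicalBasis _
  have hBV : ∀ i, ∃ C : Matrix _ (Fin δ) ℂ, V i = B i * C := fun i =>
    exists_eq_mul_of_col_mem fun β => by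
    rw [colSpan_canonicalBasis]
    exact hV.mem_txSpace i β
  choose C hC using hBV
  choose W hW using hV.exists_left_inverse
  have hPV : ∀ j, ∃ (Y : Matrix (Fin (r j) × Fin δ) ((_ : L.ΩIV j) × Fin δ) ℂ)
      (X : Matrix _ (Fin (r j) × Fin δ) ℂ),
      P j * Matrix.blockDiagonal' (fun q : L.ΩIV j => V q) = X * Y := by
    intro j
    obtain ⟨Y, hY⟩ := hV.exists_aligned j
    exact ⟨Y, (forall_mem_colSpan_transpose_iff (P j) _ Y).1 fun w hw => hY w (hPW j ▸ hw)⟩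
  choose Y X hXY using hPV
  let σ : Type := ((Σ i : Fin K, Fin (Module.finrank ℂ (L.txSpace F i)) × Fin δ) ⊕
    (Σ i : Fin K, Fin δ × Fin (L.Ns i))) ⊕
    ((Σ j : Fin K, Fin (Module.finrank ℂ (F j).2) × (Fin (r j) × Fin δ)) ⊕
    (Σ j : Fin K, (Fin (r j) × Fin δ) × ((_ : L.ΩIV j) × Fin δ)))
  let C' : (σ → ℂ) → ∀ i, Matrix (Fin (Module.finrank ℂ (L.txSpace F i))) (Fin δ) ℂ :=
    fun z i => Matrix.of fun a b => z (Sum.inl (Sum.inl ⟨i, a, b⟩))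
  let W' : (σ → ℂ) → ∀ i, Matrix (Fin δ) (Fin (L.Ns i)) ℂ :=
    fun z i => Matrix.of fun a b => z (Sum.inl (Sum.inr ⟨i, a, b⟩))
  let X' : (σ → ℂ) → ∀ j, Matrix (Fin (Module.finrank ℂ (F j).2)) (Fin (r j) × Fin δ) ℂ :=
    fun z j => Matrix.of fun a b => z (Sum.inr (Sum.inl ⟨j, a, b⟩))
  let Y' : (σ → ℂ) → ∀ j, Matrix (Fin (r j) × Fin δ) ((_ : L.ΩIV j) × Fin δ) ℂ :=
    fun z j => Matrix.of fun a b => z (Sum.inr (Sum.inr ⟨j, a, b⟩))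
  have hC' : ∀ i a b, IsPolyOn k Set.univ fun z : σ → ℂ => C' z i a b :=
    fun i a b => IsPolyOn.coord (Set.mem_univ _)
  have hW' : ∀ i a b, IsPolyOn k Set.univ fun z : σ → ℂ => W' z i a b :=
    fun i a b => IsPolyOn.coord (Set.mem_univ _)
  have hX' : ∀ i a b, IsPolyOn k Set.univ fun z : σ → ℂ => X' z i a b :=
    fun i a b => IsPolyOn.coord (Set.mem_univ _)
  have hY' : ∀ i a b, IsPolyOn k Set.univ fun z : σ → ℂ => Y' z i a b :=
    fun i a b => IsPolyOn.coord (Set.mem_univ _)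
  have hBC : ∀ i a b, IsPolyOn k Set.univ fun z : σ → ℂ => (B i * C' z i) a b :=
    fun i => IsPolyOn.matrix_mul (A := fun _ => B i) (B := fun z => C' z i)
      (fun a b => IsPolyOn.const (hB i a b)) (hC' i)
  have hone : ∀ a b : Fin δ, IsPolyOn k (Set.univ : Set σ) fun _ => (1 : Matrix _ _ ℂ) a b :=
    fun a b => IsPolyOn.const (one_matrix_mem k a b)
  let f : (Σ _ : Fin K, Fin δ × Fin δ) ⊕
      (Σ j : Fin K, Fin (Module.finrank ℂ (F j).2) × ((_ : L.ΩIV j) × Fin δ)) → (σ → ℂ) → ℂ :=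
    Sum.elim (fun x z => (W' z x.1 * (B x.1 * C' z x.1)) x.2.1 x.2.2 -
        (1 : Matrix (Fin δ) (Fin δ) ℂ) x.2.1 x.2.2)
      (fun x z => (P x.1 * Matrix.blockDiagonal' (fun q : L.ΩIV x.1 => B q * C' z q)) x.2.1 x.2.2 -
        (X' z x.1 * Y' z x.1) x.2.1 x.2.2)
  have hf : ∀ x, IsPolyOn k Set.univ (f x) := by
    rintro (⟨i, a, b⟩ | ⟨j, a, b⟩)
    · exact (IsPolyOn.matrix_mul (A := fun z => W' z i) (B := fun z => B i * C' z i)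
        (hW' i) (hBC i) a b).sub (hone a b)
    · exact (IsPolyOn.matrix_mul (A := fun _ => P j)
        (B := fun z => Matrix.blockDiagonal' (fun q : L.ΩIV j => B q * C' z q))
        (fun a b => IsPolyOn.const (hP j a b))
        (IsPolyOn.blockDiagonal' (A := fun z (q : L.ΩIV j) => B q * C' z q) fun q => hBC q)
        a b).sub (IsPolyOn.matrix_mul (A := fun z => X' z j) (B := fun z => Y' z j)
          (hX' j) (hY' j) a b)
  obtain ⟨z, hz, hfz⟩ := exists_zero_mem k f hf
    (Sum.elim (Sum.elim (fun x => C x.1 x.2.1 x.2.2) fun x => W x.1 x.2.1 x.2.2)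
      (Sum.elim (fun x => X x.1 x.2.1 x.2.2) fun x => Y x.1 x.2.1 x.2.2)) (by
    rintro (⟨i, a, b⟩ | ⟨j, a, b⟩)
    · exact sub_eq_zero.2 (congrFun (congrFun (by rw [← hW i, hC i]; rfl) a) b)
    · refine sub_eq_zero.2 (congrFun (congrFun (?_ : P j * Matrix.blockDiagonal'
        (fun q : L.ΩIV j => B q * C q) = X j * Y j) a) b)
      rw [← hXY j]
      simp only [hC]
      rfl)
  refine ⟨fun i => B i * C' z i, ⟨fun i β => ?_, fun i => ⟨W' z i, ?_⟩, fun j => ⟨Y' z j, ?_⟩⟩,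
    fun i => matrix_mul_mem (hB i) fun a b => hz _⟩
  · have h := colSpan_mul_le (B i) (C' z i) (col_mem_colSpan _ β)
    rwa [colSpan_canonicalBasis] at h
  · ext a b
    exact sub_eq_zero.1 (hfz (Sum.inl ⟨i, a, b⟩))
  · rw [← hPW j]
    refine (forall_mem_colSpan_transpose_iff (P j) _ _).2 ⟨X' z j, ?_⟩
    ext a b
    exact sub_eq_zero.1 (hfz (Sum.inr ⟨j, a, b⟩))

end FeedbackProfile

namespace Layout

variable {K : ℕ} {G : Layout K}

/-! ### Alignment for generic channels -/

/-- `[1 C] A = 0` says that the upper part of `A` is `-C` times its lower part, so the received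
interference factors through the columns of `[-C; 1]`. -/
theorem exists_aligned_precoders {E : G.Idx → ℂ}
    {X : ∀ j, Matrix (G.RowT j) (G.RowB j) ℂ} {Y : ∀ i, Matrix (G.ColB i) (G.ColT i) ℂ}
    (hz : ∃ z : G.Unk → ℂ, ∀ j, ∀ i ∈ G.IV j,
      oneCols (unkC z j) * eff X Y E j i * oneRows (unkV z i) = 0) :
    ∃ V : ∀ i, Matrix (G.ColT i) (Fin G.δ) ℂ, (∀ i, ∃ W : Matrix (Fin G.δ) (G.ColT i) ℂ,
      W * V i = 1) ∧ ∀ j, ∃ (Ξ : Matrix (G.RowT j) (Fin (G.r j) × Fin G.δ) ℂ)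
        (Z : ∀ _ : Fin K, Matrix (Fin (G.r j) × Fin G.δ) (Fin G.δ) ℂ),
          ∀ i ∈ G.IV j, oneCols (X j) * G.mat E j i * (oneRows (Y i) * V i) = Ξ * Z i := by
  obtain ⟨z, hz⟩ := hz
  refine ⟨fun i => oneRows (unkV z i), fun i => ⟨Matrix.fromCols 1 0, ?_⟩, fun j =>
    ⟨Matrix.fromRows (-unkC z j) 1, fun i =>
      (eff X Y E j i * oneRows (unkV z i)).toRows₂, fun i hi => ?_⟩⟩
  · rw [Matrix.fromCols_mul_fromRows, Matrix.one_mul, Matrix.zero_mul, add_zero]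
  · have h := hz j i hi
    rw [Matrix.mul_assoc] at h
    rw [← Matrix.mul_assoc]
    change eff X Y E j i * oneRows (unkV z i) = _
    set A := eff X Y E j i * oneRows (unkV z i)
    rw [← Matrix.fromRows_toRows A, Matrix.fromCols_mul_fromRows, Matrix.one_mul] at h
    conv_lhs => rw [← Matrix.fromRows_toRows A]
    rw [Matrix.fromRows_mul, Matrix.one_mul, Matrix.neg_mul, eq_neg_of_add_eq_zero_left h]

/-- A dimension count gives a full rank annihilator over ℂ. The right inverse `Q'` expresses full
rank by equations, so the annihilator can be taken over `k`. -/
theorem exists_mem_left_annihilator {k : IntermediateField ℚ ℂ} [IsAlgClosed k]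
    {a b ι : Type*} [Fintype a] [Fintype b] [DecidableEq a] [DecidableEq b]
    {n : ι → Type*} (A : ∀ i, Matrix (a ⊕ b) (n i) ℂ) (hA : ∀ i x y, A i x y ∈ k)
    (Ξ : Matrix (a ⊕ b) b ℂ) (Z : ∀ i, Matrix b (n i) ℂ) (h : ∀ i, A i = Ξ * Z i) :
    ∃ (Q : Matrix a (a ⊕ b) ℂ) (Q' : Matrix (a ⊕ b) a ℂ), Q * Q' = 1 ∧ (∀ i, Q * A i = 0) ∧
      ∀ x y, Q x y ∈ k := by
  obtain ⟨Q, Q', h1, h2⟩ := exists_left_annihilator (a := a) Fintype.card_sum Ξ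
  let σ := (a × (a ⊕ b)) ⊕ ((a ⊕ b) × a)
  let q : (σ → ℂ) → Matrix a (a ⊕ b) ℂ := fun z => Matrix.of fun x y => z (Sum.inl (x, y))
  let q' : (σ → ℂ) → Matrix (a ⊕ b) a ℂ := fun z => Matrix.of fun x y => z (Sum.inr (x, y))
  have hq : ∀ x y, IsPolyOn k Set.univ fun z : σ → ℂ => q z x y :=
    fun x y => IsPolyOn.coord (Set.mem_univ _)
  have hq' : ∀ x y, IsPolyOn k Set.univ fun z : σ → ℂ => q' z x y :=
    fun x y => IsPolyOn.coord (Set.mem_univ _)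
  let f : (a × a) ⊕ (Σ i, a × n i) → (σ → ℂ) → ℂ :=
    Sum.elim (fun t z => (q z * q' z) t.1 t.2 - (1 : Matrix a a ℂ) t.1 t.2)
      (fun t z => (q z * A t.1) t.2.1 t.2.2)
  obtain ⟨z, hz, hfz⟩ := exists_zero_mem k f (by
      rintro (⟨x, y⟩ | ⟨i, x, y⟩)
      · exact (IsPolyOn.matrix_mul (A := q) (B := q') hq hq' x y).sub
          (IsPolyOn.const (one_matrix_mem k x y))
      · exact IsPolyOn.matrix_mul (A := q) (B := fun _ => A i) hq
          (fun x y => IsPolyOn.const (hA i x y)) x y)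
    (Sum.elim (fun t => Q t.1 t.2) fun t => Q' t.1 t.2) (by
      rintro (⟨x, y⟩ | ⟨i, x, y⟩)
      · exact sub_eq_zero.2 (congrFun (congrFun h1 x) y)
      · have : Q * A i = 0 := by rw [h, ← Matrix.mul_assoc, h2, Matrix.zero_mul]
        exact congrFun (congrFun this x) y)
  refine ⟨q z, q' z, ?_, fun i => ?_, fun x y => hz _⟩
  · ext x y
    exact sub_eq_zero.1 (hfz (Sum.inl (x, y)))
  · ext x y
    exact hfz (Sum.inr ⟨i, x, y⟩)

/-- Zero forcing decorrelators for precoders that do not depend on the direct links and on the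
links in class I. -/
theorem exists_decorrelators {E : G.Idx → ℂ} (hE : AlgebraicIndependent ℚ E)
    (hI : ∀ j, ∀ i ∈ insert j (G.I j), i ∉ G.II j ∧ i ∉ G.III j ∧ i ∉ G.IV j)
    {X : ∀ j, Matrix (G.RowT j) (G.RowB j) ℂ}
    (hX : ∀ j a b, X j a b ∈ acl (E '' (G.links G.II ∪ G.links G.III ∪ G.links G.IV)))
    {V : ∀ i, Matrix (G.Col i) (Fin G.δ) ℂ}
    (hV : ∀ i a b, V i a b ∈ acl (E '' (G.links G.II ∪ G.links G.III ∪ G.links G.IV)))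
    (hW : ∀ i, ∃ W : Matrix (Fin G.δ) (G.Col i) ℂ, W * V i = 1)
    (hIV : ∀ j, ∃ (Ξ : Matrix (G.RowT j) (Fin (G.r j) × Fin G.δ) ℂ)
        (Z : ∀ _ : Fin K, Matrix (Fin (G.r j) × Fin G.δ) (Fin G.δ) ℂ),
          ∀ i ∈ G.IV j, oneCols (X j) * G.mat E j i * V i = Ξ * Z i) (j : Fin K) :
    ∃ T : Matrix (Fin G.δ) (G.RowT j) ℂ, T * (oneCols (X j) * G.mat E j j * V j) = 1 ∧
      (∀ i ∈ G.I j, i ≠ j → T * (oneCols (X j) * G.mat E j i * V i) = 0) ∧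
      ∀ i ∈ G.IV j, T * (oneCols (X j) * G.mat E j i * V i) = 0 := by
  classical
  set S := G.links G.II ∪ G.links G.III ∪ G.links G.IV with hS
  set k := acl (E '' S) with hk
  choose W hW using hW
  have hAk : ∀ j, ∀ i : G.IV j, ∀ a b, (oneCols (X j) * G.mat E j i * V i) a b ∈ k := by
    intro j i
    have h : ∀ a b, G.mat E j i a b ∈ k := fun a b =>
      acl_mono (Set.image_mono Set.subset_union_right) (mat_mem_acl i.2 a b)
    exact matrix_mul_mem (matrix_mul_mem (oneCols_mem (hX j)) h) (hV i)
  have hQ : ∀ j, ∃ (Q : Matrix (G.D j × Fin G.δ) (G.RowT j) ℂ)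
      (Q' : Matrix (G.RowT j) (G.D j × Fin G.δ) ℂ), Q * Q' = 1 ∧
      (∀ i : G.IV j, Q * (oneCols (X j) * G.mat E j i * V i) = 0) ∧ ∀ x y, Q x y ∈ k := by
    intro j
    obtain ⟨Ξ, Z, h⟩ := hIV j
    exact exists_mem_left_annihilator (fun i : G.IV j => oneCols (X j) * G.mat E j i * V i)
      (hAk j) Ξ (fun i => Z i) fun i => h i i.2
  choose Q Q' hQQ' hQIV hQk using hQ
  -- What the desired and the class I streams look like after class IV is removed. `A` is square
  -- because the annihilator has one row per such stream.
  let A : (G.Idx → ℂ) → Matrix (G.D j × Fin G.δ) (G.D j × Fin G.δ) ℂ := fun E =>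
    Matrix.of fun u v => (Q j * oneCols (X j) * G.mat E j v.1 * V v.1) u v.2
  have hQXk : ∀ (a : G.D j × Fin G.δ) (b : G.Row j), (Q j * oneCols (X j)) a b ∈ k :=
    matrix_mul_mem (hQk j) (oneCols_mem (hX j))
  have hdet : (A E).det ≠ 0 := by
    have hind := algebraicIndependent_acl hE (S := S) (T := G.links fun j => insert j (G.I j))
      (Set.disjoint_left.2 fun x hx hx' => by
        have := hI x.1 x.2.1 hx'
        rcases hx with (hx | hx) | hx
        · exact this.1 hx
        · exact this.2.1 hx
        · exact this.2.2 hx)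
    -- The test channel composes a left inverse of `V i` with the block of `Q' j` belonging to user
    -- `i`, so that `A` becomes `Q j * Q' j = 1`.
    let B : ∀ j i, Matrix (G.Row j) (G.Col i) ℂ := fun j i =>
      if h : i ∈ insert j (G.I j) then
        (Matrix.fromRows 1 0 : Matrix (G.Row j) (G.RowT j) ℂ) *
          (Q' j).submatrix id (fun β => ((⟨i, h⟩ : G.D j), β)) * W i else 0
    refine IsPolyOn.ne_zero (f := fun E => (A E).det) (IsPolyOn.det fun u v => ?_) hind
      (e := fun x => B x.1 x.2.1 x.2.2.1 x.2.2.2) ?_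
    · exact IsPolyOn.matrix_mul (A := fun E => Q j * oneCols (X j) * G.mat E j v.1)
        (B := fun _ => V v.1) (IsPolyOn.matrix_mul (A := fun _ => Q j * oneCols (X j))
          (B := fun E => G.mat E j v.1) (fun a b => IsPolyOn.const (hQXk a b))
          (isPolyOn_mat (C := fun j => insert j (G.I j)) v.1.2))
        (fun a b => IsPolyOn.const (hV _ a b)) _ _
    · have hA : A (fun x => B x.1 x.2.1 x.2.2.1 x.2.2.2) = 1 := by
        ext u ⟨⟨i, hi⟩, β⟩
        have h1 : G.mat (fun x => B x.1 x.2.1 x.2.2.1 x.2.2.2) j i =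
            (Matrix.fromRows 1 0 : Matrix (G.Row j) (G.RowT j) ℂ) *
              (Q' j).submatrix id (fun β => ((⟨i, hi⟩ : G.D j), β)) * W i := by
          ext a b
          simp only [mat, B, Matrix.of_apply, dif_pos hi]
        have h2 : Q j * oneCols (X j) * G.mat (fun x => B x.1 x.2.1 x.2.2.1 x.2.2.2) j i * V i =
            Q j * (Q' j).submatrix id (fun β => ((⟨i, hi⟩ : G.D j), β)) := by
          rw [h1, Matrix.mul_assoc (Q j), ← Matrix.mul_assoc (oneCols (X j)),
            ← Matrix.mul_assoc (oneCols (X j)), Matrix.fromCols_mul_fromRows, Matrix.mul_zero,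
            add_zero, Matrix.one_mul, Matrix.one_mul, ← Matrix.mul_assoc, Matrix.mul_assoc, hW i,
            Matrix.mul_one]
        simp only [A, Matrix.of_apply]
        rw [h2, ← hQQ' j]
        rfl
      rw [hA, Matrix.det_one]
      exact one_ne_zero
  have hinv : (A E)⁻¹ * A E = 1 := Matrix.nonsing_inv_mul _ (isUnit_iff_ne_zero.2 hdet)
  -- Picks the rows of the inverse of `A` that recover the streams of user `j`; they annihilate the
  -- other users' streams.
  let d : Fin G.δ → G.D j × Fin G.δ := fun β => (⟨j, Finset.mem_insert_self _ _⟩, β)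
  have key : ∀ i (hi : i ∈ insert j (G.I j)) β β', ((A E)⁻¹.submatrix d id * Q j *
      (oneCols (X j) * G.mat E j i * V i)) β β' =
        (1 : Matrix (G.D j × Fin G.δ) (G.D j × Fin G.δ) ℂ) (d β) (⟨i, hi⟩, β') := by
    intro i hi β β'
    rw [← hinv, Matrix.mul_assoc, ← Matrix.mul_assoc (Q j), ← Matrix.mul_assoc (Q j)]
    rfl
  refine ⟨(A E)⁻¹.submatrix d id * Q j, ?_, fun i hi hij => ?_, fun i hi => ?_⟩
  · ext β β'
    rw [key j (Finset.mem_insert_self _ _), Matrix.one_apply, Matrix.one_apply]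
    simp [d]
  · ext β β'
    rw [key i (Finset.mem_insert_of_mem hi), Matrix.one_apply_ne]
    · rfl
    · intro h
      exact hij (congrArg (fun x => (x.1 : Fin K)) h).symm
  · rw [Matrix.mul_assoc, hQIV j ⟨i, hi⟩, Matrix.mul_zero]

end Layout

/-! ### The feedback expressed through the block structure -/

/-- The matrices `[1 X_j]` span the left null spaces of the class II links, and the matrices
`[1; Y_i]` span the null spaces of the projected class III links. -/
structure Layout.IsNullBasis {K : ℕ} {G : Layout K} (E : G.Idx → ℂ)
    (X : ∀ j, Matrix (G.RowT j) (G.RowB j) ℂ) (Y : ∀ i, Matrix (G.ColB i) (G.ColT i) ℂ) :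
    Prop where
  mul_mat : ∀ j, ∀ i ∈ G.II j, oneCols (X j) * G.mat E j i = 0
  eq_vecMul : ∀ j w, (∀ i ∈ G.II j, w ᵥ* G.mat E j i = 0) → w = (w ∘ Sum.inl) ᵥ* oneCols (X j)
  mul_mat_mul : ∀ i j, i ∈ G.III j → oneCols (X j) * G.mat E j i * oneRows (Y i) = 0
  eq_mulVec : ∀ i v, (∀ j, i ∈ G.III j → (oneCols (X j) * G.mat E j i) *ᵥ v = 0) →
    v = oneRows (Y i) *ᵥ (v ∘ Sum.inl)

theorem leftNullSpace_eq_colSpan {m n p : Type*} [Fintype m] [Fintype n] [Fintype p]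
    {A : Matrix p m ℂ} {H : Matrix m n ℂ} (h0 : A * H = 0)
    (h : ∀ w, w ᵥ* H = 0 → ∃ c, w = c ᵥ* A) : leftNullSpace H = colSpan Aᴴ := by
  apply le_antisymm
  · intro u hu
    have hu' : Hᴴ *ᵥ u = 0 := hu
    obtain ⟨c, hc⟩ := h (star u) (by
      have := congrArg star hu'
      rwa [Matrix.star_mulVec, Matrix.conjTranspose_conjTranspose, star_zero] at this)
    refine ⟨star c, ?_⟩
    rw [Matrix.mulVecLin_apply, ← star_star u, hc, Matrix.star_vecMul]
  · rintro _ ⟨c, rfl⟩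
    change Hᴴ *ᵥ (Aᴴ *ᵥ c) = 0
    rw [Matrix.mulVec_mulVec, ← Matrix.conjTranspose_mul, h0, Matrix.conjTranspose_zero,
      Matrix.zero_mulVec]

namespace FeedbackProfile

variable {K : ℕ} {M N : Fin K → ℕ} (L : FeedbackProfile M N)

theorem notMem_of_mem_ΩI {j i : Fin K} (h : i ∈ insert j (L.ΩI j)) :
    i ∉ L.ΩII j ∧ i ∉ L.ΩIII j ∧ i ∉ L.ΩIV j := by
  have hu := L.union_eq j
  have hd := L.disjoint j
  simp only [List.pairwise_cons, List.mem_cons, List.not_mem_nil, or_false, forall_eq_or_imp,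
    forall_eq, Finset.disjoint_left] at hd
  have hj : ∀ x, x ∈ L.ΩI j ∪ L.ΩII j ∪ L.ΩIII j ∪ L.ΩIV j → x ≠ j := fun x hx => by
    rw [hu] at hx
    exact Finset.ne_of_mem_erase hx
  simp only [Finset.mem_union] at hj
  rcases Finset.mem_insert.1 h with rfl | h
  · exact ⟨fun h => hj i (by tauto) rfl, fun h => hj i (by tauto) rfl,
      fun h => hj i (by tauto) rfl⟩
  · exact ⟨hd.1.1 h, hd.1.2.1 h, hd.1.2.2 h⟩

/-- The block structure of the channel matrices under a feedback profile. -/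
abbrev layout (r s : Fin K → ℕ) (δ : ℕ) : Layout K where
  I := L.ΩI
  II := L.ΩII
  III := L.ΩIII
  IV := L.ΩIV
  r := r
  s := s
  δ := δ
  II_III {j i} h h' := by
    have hd := L.disjoint j
    simp only [List.pairwise_cons, List.mem_cons, List.not_mem_nil, or_false, forall_eq_or_imp,
      forall_eq, Finset.disjoint_left] at hd
    exact hd.2.1.1 h h'
  II_IV {j i} h h' := by
    have hd := L.disjoint j
    simp only [List.pairwise_cons, List.mem_cons, List.not_mem_nil, or_false, forall_eq_or_imp,
      forall_eq, Finset.disjoint_left] at hd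
    exact hd.2.1.2 h h'
  III_IV {j i} h h' := by
    have hd := L.disjoint j
    simp only [List.pairwise_cons, List.mem_cons, List.not_mem_nil, or_false, forall_eq_or_imp,
      forall_eq, Finset.disjoint_left] at hd
    exact hd.2.2.1 h h'

theorem mul_concat_mul_blockDiagonal' (H : Channels M N) (j : Fin K) (T : Finset (Fin K))
    {p : Type*} {n : ℕ} (A : Matrix p (Fin (L.Ms j)) ℂ) (V : ∀ i, Matrix (Fin (L.Ns i)) (Fin n) ℂ)
    (a : p) (c : (_ : T) × Fin n) :
    (A * L.concat H j T * Matrix.blockDiagonal' (fun q : T => V q)) a c =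
      (A * L.subChannel H j c.1 * V c.1) a c.2 := by
  obtain ⟨q, β⟩ := c
  have h : ∀ b, (L.concat H j T * Matrix.blockDiagonal' (fun q : T => V q)) b ⟨q, β⟩ =
      (L.subChannel H j q * V q) b β := by
    intro b
    rw [Matrix.mul_apply, Matrix.mul_apply, Fintype.sum_sigma, Finset.sum_eq_single q]
    · simp [concat, Matrix.blockDiagonal'_apply_eq]
    · intro q' _ hq'
      refine Finset.sum_eq_zero fun x _ => ?_
      rw [Matrix.blockDiagonal'_apply_ne _ _ _ hq', mul_zero]
    · simp
  rw [Matrix.mul_assoc, Matrix.mul_assoc, Matrix.mul_apply, Matrix.mul_apply]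
  exact Finset.sum_congr rfl fun b _ => by rw [h]

variable {L} {r s : Fin K → ℕ} {δ : ℕ} {H : Channels M N}
  {ρ : ∀ j, (L.layout r s δ).Row j ≃ Fin (L.Ms j)} {τ : ∀ i, (L.layout r s δ).Col i ≃ Fin (L.Ns i)}
  {E : (L.layout r s δ).Idx → ℂ}
  {X : ∀ j, Matrix ((L.layout r s δ).RowT j) ((L.layout r s δ).RowB j) ℂ}
  {Y : ∀ i, Matrix ((L.layout r s δ).ColB i) ((L.layout r s δ).ColT i) ℂ}

variable (ρ X) in
/-- The matrix `[1 X_j]` with its columns in the original order. -/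
def rxMat (j : Fin K) : Matrix ((L.layout r s δ).RowT j) (Fin (L.Ms j)) ℂ :=
  (oneCols (X j)).submatrix id (ρ j).symm

variable (τ Y) in
/-- The matrix `[1; Y_i]` with its rows in the original order. -/
def txMat (i : Fin K) : Matrix (Fin (L.Ns i)) ((L.layout r s δ).ColT i) ℂ :=
  (oneRows (Y i)).submatrix (τ i).symm id

theorem subChannel_eq
    (hmat : ∀ j i, (L.layout r s δ).mat E j i = (L.subChannel H j i).submatrix (ρ j) (τ i))
    (j i : Fin K) :
    L.subChannel H j i = ((L.layout r s δ).mat E j i).submatrix (ρ j).symm (τ i).symm := by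
  rw [hmat]
  ext a b
  simp

theorem rxMat_mul_subChannel
    (hmat : ∀ j i, (L.layout r s δ).mat E j i = (L.subChannel H j i).submatrix (ρ j) (τ i))
    (j i : Fin K) : rxMat ρ X j * L.subChannel H j i =
      (oneCols (X j) * (L.layout r s δ).mat E j i).submatrix id (τ i).symm := by
  rw [subChannel_eq hmat, rxMat, Matrix.submatrix_mul_equiv]

theorem rxMat_mul_concat_eq_zero
    (hmat : ∀ j i, (L.layout r s δ).mat E j i = (L.subChannel H j i).submatrix (ρ j) (τ i))
    (hXY : Layout.IsNullBasis E X Y) (j : Fin K) :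
    rxMat ρ X j * L.concat H j (L.ΩII j) = 0 := by
  ext a ⟨q, b⟩
  have h : (rxMat ρ X j * L.subChannel H j q) a b = 0 := by
    rw [rxMat_mul_subChannel hmat, hXY.mul_mat j q q.2]
    rfl
  exact h

theorem rxSpace_eq_colSpan
    (hmat : ∀ j i, (L.layout r s δ).mat E j i = (L.subChannel H j i).submatrix (ρ j) (τ i))
    (hXY : Layout.IsNullBasis E X Y) (j : Fin K) :
    L.rxSpace H j = colSpan (rxMat ρ X j)ᴴ := by
  refine leftNullSpace_eq_colSpan (rxMat_mul_concat_eq_zero hmat hXY j) fun w hw => ?_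
  have h := hXY.eq_vecMul j (w ∘ ρ j) fun i hi => by
    rw [hmat]
    ext b
    have := congrFun hw ⟨⟨i, hi⟩, τ i b⟩
    rw [Pi.zero_apply] at this ⊢
    rw [← this]
    exact Equiv.sum_comp (ρ j) fun a => w a * L.subChannel H j i a (τ i b)
  refine ⟨(w ∘ ρ j) ∘ Sum.inl, ?_⟩
  ext a
  have h1 := congrFun h ((ρ j).symm a)
  rw [Function.comp_apply, Equiv.apply_symm_apply] at h1
  rw [h1]
  rfl

theorem feedback_fst
    (hmat : ∀ j i, (L.layout r s δ).mat E j i = (L.subChannel H j i).submatrix (ρ j) (τ i))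
    (hXY : Layout.IsNullBasis E X Y) (j : Fin K) (p : L.ΩIII j) :
    (L.feedback H j).1 p = nullSpace (rxMat ρ X j * L.subChannel H j p) := by
  change projNullSpace (L.rxSpace H j) (L.subChannel H j p) = _
  rw [rxSpace_eq_colSpan hmat hXY, projNullSpace_colSpan, Matrix.conjTranspose_conjTranspose]

theorem feedback_snd
    (hmat : ∀ j i, (L.layout r s δ).mat E j i = (L.subChannel H j i).submatrix (ρ j) (τ i))
    (hXY : Layout.IsNullBasis E X Y) (j : Fin K) :
    (L.feedback H j).2 = colSpan (rxMat ρ X j * L.concat H j (L.ΩIV j))ᵀ := by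
  change projRowSpace (L.rxSpace H j) (L.concat H j (L.ΩIV j)) = _
  rw [rxSpace_eq_colSpan hmat hXY, projRowSpace_colSpan, Matrix.conjTranspose_conjTranspose]

theorem rxMat_mul_subChannel_mul_txMat
    (hmat : ∀ j i, (L.layout r s δ).mat E j i = (L.subChannel H j i).submatrix (ρ j) (τ i))
    (j i : Fin K) : rxMat ρ X j * L.subChannel H j i * txMat τ Y i =
      oneCols (X j) * (L.layout r s δ).mat E j i * oneRows (Y i) := by
  rw [rxMat_mul_subChannel hmat, txMat, Matrix.submatrix_mul_equiv, Matrix.submatrix_id_id]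

theorem txSpace_feedback
    (hmat : ∀ j i, (L.layout r s δ).mat E j i = (L.subChannel H j i).submatrix (ρ j) (τ i))
    (hXY : Layout.IsNullBasis E X Y) (i : Fin K) :
    L.txSpace (L.feedback H) i = colSpan (txMat τ Y i) := by
  apply le_antisymm
  · intro v hv
    simp only [txSpace, Submodule.mem_iInf, feedback_fst hmat hXY] at hv
    have h := hXY.eq_mulVec i (v ∘ τ i) fun j hj => by
      have h1 : (rxMat ρ X j * L.subChannel H j i) *ᵥ v = 0 := hv j hj
      rw [rxMat_mul_subChannel hmat, Matrix.submatrix_mulVec_equiv, Equiv.symm_symm] at h1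
      exact h1
    refine ⟨(v ∘ τ i) ∘ Sum.inl, ?_⟩
    ext a
    have h1 := congrFun h ((τ i).symm a)
    rw [Function.comp_apply, Equiv.apply_symm_apply] at h1
    rw [h1]
    rfl
  · rintro _ ⟨c, rfl⟩
    simp only [txSpace, Submodule.mem_iInf, feedback_fst hmat hXY]
    intro j hj
    change (rxMat ρ X j * L.subChannel H j i) *ᵥ (txMat τ Y i *ᵥ c) = 0
    rw [Matrix.mulVec_mulVec, rxMat_mul_subChannel_mul_txMat hmat, hXY.mul_mat_mul i j hj,
      Matrix.zero_mulVec]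

theorem exists_mul_txMat_eq_one (i : Fin K) :
    ∃ B : Matrix ((L.layout r s δ).ColT i) (Fin (L.Ns i)) ℂ, B * txMat τ Y i = 1 := by
  refine ⟨(Matrix.fromCols 1 0 : Matrix ((L.layout r s δ).ColT i)
    ((L.layout r s δ).Col i) ℂ).submatrix id (τ i).symm, ?_⟩
  rw [txMat, Matrix.submatrix_mul_equiv, Matrix.fromCols_mul_fromRows, Matrix.one_mul,
    Matrix.zero_mul, add_zero, Matrix.submatrix_id_id]

theorem exists_rxMat_mul_eq_one (j : Fin K) :
    ∃ B : Matrix (Fin (L.Ms j)) ((L.layout r s δ).RowT j) ℂ, rxMat ρ X j * B = 1 := by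
  refine ⟨(Matrix.fromRows 1 0 : Matrix ((L.layout r s δ).Row j)
    ((L.layout r s δ).RowT j) ℂ).submatrix (ρ j).symm id, ?_⟩
  rw [rxMat, Matrix.submatrix_mul_equiv, Matrix.fromCols_mul_fromRows, Matrix.one_mul,
    Matrix.mul_zero, add_zero, Matrix.submatrix_id_id]

theorem finrank_txSpace
    (hmat : ∀ j i, (L.layout r s δ).mat E j i = (L.subChannel H j i).submatrix (ρ j) (τ i))
    (hXY : Layout.IsNullBasis E X Y) (i : Fin K) :
    Module.finrank ℂ (L.txSpace (L.feedback H) i) =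
      Fintype.card ((L.layout r s δ).ColT i) := by
  obtain ⟨B, hB⟩ := exists_mul_txMat_eq_one (τ := τ) (Y := Y) i
  rw [txSpace_feedback hmat hXY, finrank_colSpan hB]

theorem finrank_rxSpace
    (hmat : ∀ j i, (L.layout r s δ).mat E j i = (L.subChannel H j i).submatrix (ρ j) (τ i))
    (hXY : Layout.IsNullBasis E X Y) (j : Fin K) :
    Module.finrank ℂ (L.rxSpace H j) = Fintype.card ((L.layout r s δ).RowT j) := by
  obtain ⟨B, hB⟩ := exists_rxMat_mul_eq_one (ρ := ρ) (X := X) j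
  have hB' : Bᴴ * (rxMat ρ X j)ᴴ = 1 := by
    rw [← Matrix.conjTranspose_mul, hB, Matrix.conjTranspose_one]
  rw [rxSpace_eq_colSpan hmat hXY, finrank_colSpan hB']

/-- Solvability of the alignment equations in block coordinates is rephrased through the fed back
subspaces, so that a choice can be made from the feedback alone. -/
theorem exists_isFeedbackPrecoder
    (hmat : ∀ j i, (L.layout r s δ).mat E j i = (L.subChannel H j i).submatrix (ρ j) (τ i))
    (hXY : Layout.IsNullBasis E X Y)
    (hz : ∃ z : (L.layout r s δ).Unk → ℂ, ∀ j, ∀ i ∈ L.ΩIV j,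
      oneCols (Layout.unkC z j) * Layout.eff X Y E j i * oneRows (Layout.unkV z i) = 0) :
    ∃ V, L.IsFeedbackPrecoder r δ (L.feedback H) V := by
  obtain ⟨V, hW, hV⟩ := Layout.exists_aligned_precoders hz
  refine ⟨fun i => txMat τ Y i * V i, fun i β => ?_, fun i => ?_, fun j => ?_⟩
  · rw [txSpace_feedback hmat hXY]
    exact colSpan_mul_le _ _ (col_mem_colSpan (txMat τ Y i * V i) β)
  · obtain ⟨W, hW⟩ := hW i
    obtain ⟨B, hB⟩ := exists_mul_txMat_eq_one (τ := τ) (Y := Y) i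
    refine ⟨W * B, ?_⟩
    rw [Matrix.mul_assoc, ← Matrix.mul_assoc B, hB, Matrix.one_mul]
    exact hW
  · obtain ⟨Ξ, Z, hΞ⟩ := hV j
    let Y' : Matrix (Fin (r j) × Fin δ) ((_ : L.ΩIV j) × Fin δ) ℂ :=
      Matrix.of fun t c => Z c.1 t c.2
    refine ⟨Y', ?_⟩
    rw [feedback_snd hmat hXY]
    refine (forall_mem_colSpan_transpose_iff _ _ Y').2 ⟨Ξ, ?_⟩
    ext a c
    rw [mul_concat_mul_blockDiagonal' L H j _ (rxMat ρ X j) (fun i => txMat τ Y i * V i),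
      ← Matrix.mul_assoc, rxMat_mul_subChannel_mul_txMat hmat, Matrix.mul_assoc _ _ (V c.1),
      hΞ c.1 c.1.2]
    rfl

end FeedbackProfile

/-! ### Structured precoders and decorrelators -/

namespace FeedbackProfile

variable {K : ℕ} {M N : Fin K → ℕ} {L : FeedbackProfile M N} {r s : Fin K → ℕ} {δ : ℕ}
  {H : Channels M N}
  {ρ : ∀ j, (L.layout r s δ).Row j ≃ Fin (L.Ms j)} {τ : ∀ i, (L.layout r s δ).Col i ≃ Fin (L.Ns i)}
  {E : (L.layout r s δ).Idx → ℂ}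
  {X : ∀ j, Matrix ((L.layout r s δ).RowT j) ((L.layout r s δ).RowB j) ℂ}
  {Y : ∀ i, Matrix ((L.layout r s δ).ColB i) ((L.layout r s δ).ColT i) ℂ}

/-- The entries of the links in the classes II, III and IV. -/
def fedBack (L : FeedbackProfile M N) (r s : Fin K → ℕ) (δ : ℕ) : Set (L.layout r s δ).Idx :=
  (L.layout r s δ).links L.ΩII ∪ (L.layout r s δ).links L.ΩIII ∪ (L.layout r s δ).links L.ΩIV

/-- The fed back subspaces have bases with entries algebraic over the links of classes II, III and
IV. Precoders over the feedback field thus leave the direct and class I links independent. -/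
theorem feedbackField_feedback_le
    (hmat : ∀ j i, (L.layout r s δ).mat E j i = (L.subChannel H j i).submatrix (ρ j) (τ i))
    (hXY : Layout.IsNullBasis E X Y)
    (hX : ∀ j a b, X j a b ∈ acl (E '' L.fedBack r s δ))
    (hY : ∀ i a b, Y i a b ∈ acl (E '' L.fedBack r s δ)) :
    L.feedbackField (L.feedback H) ≤ acl (E '' L.fedBack r s δ) := by
  refine feedbackField_le (fun i => ⟨_, inferInstance, txMat τ Y i, ?_, ?_⟩)
    fun j => ⟨_, inferInstance, (rxMat ρ X j * L.concat H j (L.ΩIV j))ᵀ, ?_, ?_⟩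
  · exact fun a b => oneRows_mem (hY i) _ _
  · exact (txSpace_feedback hmat hXY i).symm
  · rintro ⟨q, b⟩ a
    have h1 : (rxMat ρ X j * L.concat H j (L.ΩIV j)) a ⟨q, b⟩ =
        (oneCols (X j) * (L.layout r s δ).mat E j q) a ((τ q).symm b) :=
      congrFun (congrFun (rxMat_mul_subChannel hmat j q) a) b
    rw [Matrix.transpose_apply, h1]
    refine matrix_mul_mem (oneCols_mem (hX j)) (fun c d => ?_) _ _
    exact acl_mono (Set.image_mono Set.subset_union_right)
      (Layout.mat_mem_acl (G := L.layout r s δ) (C := L.ΩIV) q.2 c d)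
  · exact (feedback_snd hmat hXY j).symm

theorem isStructuredPrecoder_padRows
    (hmat : ∀ j i, (L.layout r s δ).mat E j i = (L.subChannel H j i).submatrix (ρ j) (τ i))
    (hXY : Layout.IsNullBasis E X Y)
    (hNe : ∀ i, L.Ne i = Fintype.card ((L.layout r s δ).ColT i)) {i : Fin K}
    {V : Matrix (Fin (L.Ns i)) (Fin δ) ℂ}
    (hV : ∀ β, (fun a => V a β) ∈ L.txSpace (L.feedback H) i) :
    L.IsStructuredPrecoder (L.feedback H) i (padRows (N i) V) := by
  obtain ⟨St, hSt⟩ := exists_isOrthonormalBasisMatrix (n := (L.Ne i).toNat)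
    (L.txSpace (L.feedback H) i) (by rw [finrank_txSpace hmat hXY, hNe, Int.toNat_natCast])
  obtain ⟨Va, hVa⟩ := exists_eq_mul_of_col_mem (A := V) (B := St) (by rwa [hSt.2])
  exact ⟨St, Va, hSt, by rw [← hVa]⟩

theorem isStructuredDecorrelator_padRows
    (hmat : ∀ j i, (L.layout r s δ).mat E j i = (L.subChannel H j i).submatrix (ρ j) (τ i))
    (hXY : Layout.IsNullBasis E X Y)
    (hMe : ∀ j, L.Me j = Fintype.card ((L.layout r s δ).RowT j)) (j : Fin K)
    (T : Matrix (Fin δ) ((L.layout r s δ).RowT j) ℂ) :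
    L.IsStructuredDecorrelator H j (padRows (M j) (T * rxMat ρ X j)ᴴ) := by
  obtain ⟨Sr, hSr⟩ := exists_isOrthonormalBasisMatrix (n := (L.Me j).toNat)
    (L.rxSpace H j) (by rw [finrank_rxSpace hmat hXY, hMe, Int.toNat_natCast])
  obtain ⟨Ua, hUa⟩ := exists_eq_mul_of_col_mem (A := (T * rxMat ρ X j)ᴴ) (B := Sr) (fun b => by
    rw [hSr.2, rxSpace_eq_colSpan hmat hXY, Matrix.conjTranspose_mul]
    exact colSpan_mul_le _ _ (col_mem_colSpan ((rxMat ρ X j)ᴴ * Tᴴ) b))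
  -- `R = 1` is enough, since `Ua` absorbs any change of basis.
  exact ⟨Sr, 1, Ua, hSr, isUnit_one, by
    rw [Matrix.conjTranspose_one, Matrix.mul_one, ← hUa]⟩

/-- Each class is nulled by a different mechanism: II by the receive space, III by the transmit
space, IV and I by the zero forcing matrix `T`, which also turns the direct link into the identity.
-/
theorem exists_structured_decorrelators
    (hmat : ∀ j i, (L.layout r s δ).mat E j i = (L.subChannel H j i).submatrix (ρ j) (τ i))
    (hXY : Layout.IsNullBasis E X Y)
    (hX : ∀ j a b, X j a b ∈ acl (E '' L.fedBack r s δ))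
    (hE : AlgebraicIndependent ℚ E)
    (hMe : ∀ j, L.Me j = Fintype.card ((L.layout r s δ).RowT j))
    {V : ∀ i, Matrix (Fin (L.Ns i)) (Fin δ) ℂ}
    (hV : L.IsFeedbackPrecoder r δ (L.feedback H) V)
    (hVk : ∀ i a b, V i a b ∈ acl (E '' L.fedBack r s δ)) :
    ∃ U : ∀ j, Matrix (Fin (M j)) (Fin δ) ℂ, (∀ j, L.IsStructuredDecorrelator H j (U j)) ∧
      IsAligned (fun _ => δ) H (fun i => padRows (N i) (V i)) U := by
  let V' : ∀ i, Matrix ((L.layout r s δ).Col i) (Fin δ) ℂ := fun i => (V i).submatrix (τ i) id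
  have hAV : ∀ j i, oneCols (X j) * (L.layout r s δ).mat E j i * V' i =
      rxMat ρ X j * L.subChannel H j i * V i := by
    intro j i
    rw [rxMat_mul_subChannel hmat]
    have : V i = (V' i).submatrix (τ i).symm id := by
      ext a b
      simp [V']
    conv_rhs => rw [this, Matrix.submatrix_mul_equiv, Matrix.submatrix_id_id]
  have hII : ∀ j, ∀ i ∈ L.ΩII j, rxMat ρ X j * L.subChannel H j i * V i = 0 := by
    intro j i hi
    rw [rxMat_mul_subChannel hmat, hXY.mul_mat j i hi]
    exact Matrix.zero_mul _
  have hIII : ∀ j, ∀ i ∈ L.ΩIII j, rxMat ρ X j * L.subChannel H j i * V i = 0 := by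
    intro j i hi
    obtain ⟨C, hC⟩ := exists_eq_mul_of_col_mem (A := V i) (B := txMat τ Y i) (fun β => by
      rw [← txSpace_feedback hmat hXY]
      exact hV.mem_txSpace i β)
    rw [hC, ← Matrix.mul_assoc, rxMat_mul_subChannel_mul_txMat hmat, hXY.mul_mat_mul i j hi,
      Matrix.zero_mul]
  have hT := Layout.exists_decorrelators hE (fun j i hi => L.notMem_of_mem_ΩI hi) hX
    (V := V') (fun i a b => hVk i _ _) (fun i => by
      obtain ⟨W, hW⟩ := hV.exists_left_inverse i
      refine ⟨W.submatrix id (τ i), ?_⟩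
      rw [Matrix.submatrix_mul_equiv, hW]
      exact Matrix.submatrix_id_id _) (fun j => by
      obtain ⟨Y', hY'⟩ := hV.exists_aligned j
      rw [feedback_snd hmat hXY] at hY'
      obtain ⟨Ξ, hΞ⟩ := (forall_mem_colSpan_transpose_iff _ _ Y').1 hY'
      refine ⟨Ξ, fun i => Matrix.of fun t β => if h : i ∈ L.ΩIV j then Y' t ⟨⟨i, h⟩, β⟩ else 0,
        fun i hi => ?_⟩
      ext a β
      have h1 := congrFun (congrFun hΞ a) ⟨⟨i, hi⟩, β⟩
      rw [mul_concat_mul_blockDiagonal'] at h1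
      rw [hAV, h1, Matrix.mul_apply, Matrix.mul_apply]
      refine Finset.sum_congr rfl fun t _ => ?_
      have hi' : i ∈ L.ΩIV j := hi
      change _ = Ξ a t * (if h : i ∈ L.ΩIV j then Y' t ⟨⟨i, h⟩, β⟩ else 0)
      rw [dif_pos hi'])
  choose T hT1 hTI hTIV using hT
  refine ⟨fun j => padRows (M j) (T j * rxMat ρ X j)ᴴ,
    fun j => isStructuredDecorrelator_padRows hmat hXY hMe j (T j), ?_⟩
  have key : ∀ j i, (padRows (M j) (T j * rxMat ρ X j)ᴴ)ᴴ * H j i * padRows (N i) (V i) =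
      T j * (rxMat ρ X j * L.subChannel H j i * V i) := by
    intro j i
    rw [padRows_mul_mul_padRows (L.Ms_le j) (L.Ns_le i), Matrix.conjTranspose_conjTranspose,
      ← Matrix.mul_assoc, ← Matrix.mul_assoc]
    rfl
  refine ⟨fun j => ?_, fun j i hij => ?_⟩
  · rw [key, ← hAV, hT1, Matrix.rank_one, Fintype.card_fin]
  · rw [key]
    have hi : i ∈ L.ΩI j ∪ L.ΩII j ∪ L.ΩIII j ∪ L.ΩIV j := by
      rw [L.union_eq]
      exact Finset.mem_erase.2 ⟨hij, Finset.mem_univ _⟩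
    simp only [Finset.mem_union] at hi
    rcases hi with ((hi | hi) | hi) | hi
    · rw [← hAV, hTI j i hi hij]
    · rw [hII j i hi, Matrix.mul_zero]
    · rw [hIII j i hi, Matrix.mul_zero]
    · rw [← hAV, hTIV j i hi]

theorem exists_isNullBasis (hE : AlgebraicIndependent ℚ E) :
    ∃ (X : ∀ j, Matrix ((L.layout r s δ).RowT j) ((L.layout r s δ).RowB j) ℂ)
      (Y : ∀ i, Matrix ((L.layout r s δ).ColB i) ((L.layout r s δ).ColT i) ℂ),
      Layout.IsNullBasis E X Y ∧
      (∀ j a b, X j a b ∈ acl (E '' ((L.layout r s δ).links L.ΩII ∪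
        (L.layout r s δ).links L.ΩIII))) ∧
      ∀ i a b, Y i a b ∈ acl (E '' ((L.layout r s δ).links L.ΩII ∪
        (L.layout r s δ).links L.ΩIII)) := by
  choose X hX h1 h2 using Layout.exists_rx_kernel hE
  choose Y hY h3 h4 using Layout.exists_tx_kernel hE hX
  exact ⟨X, Y, ⟨h1, h2, h3, h4⟩,
    fun j a b => acl_mono (Set.image_mono Set.subset_union_left) (hX j a b), hY⟩

/-! ### Functions of the feedback and the almost sure statement -/

variable (L r δ) in
open Classical in
/-- The precoders computed from the feedback. -/
def precoder (F : ∀ j, L.FeedbackTuple j) (i : Fin K) : Matrix (Fin (N i)) (Fin δ) ℂ :=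
  -- The choice refers to `F` only. The default 0 is not reached when the channel entries are
  -- algebraically independent.
  if h : ∃ V, L.IsFeedbackPrecoder r δ F V ∧ ∀ i a b, V i a b ∈ L.feedbackField F then
    padRows (N i) (h.choose i) else 0

open Classical in
/-- A decorrelator computed from the effective channels of receiver `j`. -/
def decorrelator (M : Fin K → ℕ) (δ : ℕ) (j : Fin K)
    (A : ∀ _ : Fin K, Matrix (Fin (M j)) (Fin δ) ℂ) : Matrix (Fin (M j)) (Fin δ) ℂ :=
  if h : ∃ U : Matrix (Fin (M j)) (Fin δ) ℂ, (Uᴴ * A j).rank = δ ∧ ∀ i, i ≠ j → Uᴴ * A i = 0 then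
    h.choose else 0

theorem decorrelator_spec {j : Fin K} {A : ∀ _ : Fin K, Matrix (Fin (M j)) (Fin δ) ℂ}
    (h : ∃ U : Matrix (Fin (M j)) (Fin δ) ℂ, (Uᴴ * A j).rank = δ ∧ ∀ i, i ≠ j → Uᴴ * A i = 0) :
    ((decorrelator M δ j A)ᴴ * A j).rank = δ ∧
      ∀ i, i ≠ j → (decorrelator M δ j A)ᴴ * A i = 0 := by
  have h1 : decorrelator M δ j A = h.choose := dif_pos h
  rw [h1]
  exact h.choose_spec

/-- The equations of receiver `j` involve the channels only through the products `H j i * V i`, so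
any solution chosen from these products serves. -/
theorem isAligned_decorrelator {V : ∀ i, Matrix (Fin (N i)) (Fin δ) ℂ}
    {U : ∀ j, Matrix (Fin (M j)) (Fin δ) ℂ} (h : IsAligned (fun _ => δ) H V U) :
    IsAligned (fun _ => δ) H V fun j => decorrelator M δ j fun i => H j i * V i := by
  have hex : ∀ j, ∃ U : Matrix (Fin (M j)) (Fin δ) ℂ, (Uᴴ * (H j j * V j)).rank = δ ∧
      ∀ i, i ≠ j → Uᴴ * (H j i * V i) = 0 := fun j => ⟨U j, by
    rw [← Matrix.mul_assoc]
    exact h.1 j, fun i hi => by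
    rw [← Matrix.mul_assoc]
    exact h.2 j i hi⟩
  refine ⟨fun j => ?_, fun j i hi => ?_⟩
  · rw [Matrix.mul_assoc]
    exact (decorrelator_spec (A := fun i => H j i * V i) (hex j)).1
  · rw [Matrix.mul_assoc]
    exact (decorrelator_spec (A := fun i => H j i * V i) (hex j)).2 i hi

theorem almostSurelyFeasible_of_blocks (L : FeedbackProfile M N) (r s : Fin K → ℕ) (δ : ℕ)
    (ρ : ∀ j, (L.layout r s δ).Row j ≃ Fin (L.Ms j))
    (τ : ∀ i, (L.layout r s δ).Col i ≃ Fin (L.Ns i))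
    (hMe : ∀ j, L.Me j = Fintype.card ((L.layout r s δ).RowT j))
    (hNe : ∀ i, L.Ne i = Fintype.card ((L.layout r s δ).ColT i))
    (hcount : ∀ Ω ⊆ (L.layout r s δ).linksIV,
      ∑ x ∈ Ω, Fintype.card ((L.layout r s δ).D x.1) ≤
        ∑ j ∈ Ω.image Prod.fst, Fintype.card ((L.layout r s δ).D j) * r j +
          ∑ i ∈ Ω.image Prod.snd, s i) :
    L.AlmostSurelyFeasible fun _ => δ := by
  refine ⟨L.precoder r δ, decorrelator M δ, ?_⟩
  filter_upwards [ae_algebraicIndependent M N] with E₀ hE₀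
  intro H
  -- The entries of the used submatrices, relabelled by blocks. The bijections `ρ` and `τ` can be
  -- arbitrary, as an injective relabelling keeps independence.
  let E : (L.layout r s δ).Idx → ℂ := fun x => E₀ x.1 x.2.1
    (Fin.castLE (L.Ms_le _) (ρ x.1 x.2.2.1)) (Fin.castLE (L.Ns_le _) (τ x.2.1 x.2.2.2))
  have hE : AlgebraicIndependent ℚ E := by
    refine hE₀.comp (fun x : (L.layout r s δ).Idx => ⟨x.1, x.2.1,
      Fin.castLE (L.Ms_le _) (ρ x.1 x.2.2.1), Fin.castLE (L.Ns_le _) (τ x.2.1 x.2.2.2)⟩) ?_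
    rintro ⟨j, i, a, b⟩ ⟨j', i', a', b'⟩ h
    simp only [Sigma.mk.injEq] at h
    obtain ⟨rfl, h⟩ := h
    have h := eq_of_heq h
    simp only [Sigma.mk.injEq] at h
    obtain ⟨rfl, h⟩ := h
    have h := eq_of_heq h
    simp only [Prod.mk.injEq] at h
    rw [(ρ j).injective (Fin.castLE_injective _ h.1),
      (τ i).injective (Fin.castLE_injective _ h.2)]
  have hmat : ∀ j i, (L.layout r s δ).mat E j i =
      (L.subChannel H j i).submatrix (ρ j) (τ i) := fun j i => rfl
  obtain ⟨X, Y, hXY, hX, hY⟩ := exists_isNullBasis (L := L) hE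
  have hX' : ∀ j a b, X j a b ∈ acl (E '' L.fedBack r s δ) := fun j a b =>
    acl_mono (Set.image_mono Set.subset_union_left) (hX j a b)
  have hY' : ∀ j a b, Y j a b ∈ acl (E '' L.fedBack r s δ) := fun j a b =>
    acl_mono (Set.image_mono Set.subset_union_left) (hY j a b)
  obtain ⟨V₀, hV₀⟩ := exists_isFeedbackPrecoder hmat hXY (Layout.exists_alignment hE hX hY hcount)
  have hex := hV₀.exists_mem_feedbackField
  obtain ⟨hV, hVk⟩ := hex.choose_spec
  have hprec : L.precoder r δ (L.feedback H) = fun i => padRows (N i) (hex.choose i) := by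
    funext i
    rw [precoder, dif_pos hex]
  obtain ⟨U, hU, hUa⟩ := exists_structured_decorrelators hmat hXY hX' hE hMe hV fun i a b =>
    feedbackField_feedback_le hmat hXY hX' hY' (hVk i a b)
  intro V
  have hVeq : V = fun i => padRows (N i) (hex.choose i) := hprec
  rw [hVeq]
  exact ⟨fun i => isStructuredPrecoder_padRows hmat hXY hNe (hV.mem_txSpace i), ⟨U, hU, hUa⟩,
    isAligned_decorrelator hUa⟩

end FeedbackProfile

namespace FeedbackProfile

variable {K : ℕ} {M N : Fin K → ℕ} (L : FeedbackProfile M N)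

/-! ### Block sizes -/

/-- The definition of `Ne` subtracts exactly the columns collected in `ColB`. -/
theorem card_Col {r s : Fin K → ℕ} {δ : ℕ}
    (hMe : ∀ j, L.Me j = Fintype.card ((L.layout r s δ).RowT j))
    (hNe : ∀ i, L.Ne i = Fintype.card ((L.layout r s δ).ColT i)) (i : Fin K) :
    Fintype.card ((L.layout r s δ).Col i) = L.Ns i := by
  have h1 : (∑ j : {j // i ∈ L.ΩIII j}, Fintype.card ((L.layout r s δ).RowT j) : ℤ) =
      ∑ j ∈ Finset.univ.filter (fun j => i ∈ L.ΩIII j), L.Me j := by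
    rw [Finset.sum_subtype (p := fun j => i ∈ L.ΩIII j) _ (fun j => by simp)]
    exact Finset.sum_congr rfl fun j _ => (hMe j).symm
  have h2 := hNe i
  rw [Ne, ← h1] at h2
  have h3 : Fintype.card ((L.layout r s δ).Col i) = Fintype.card ((L.layout r s δ).ColT i) +
      ∑ j : {j // i ∈ L.ΩIII j}, Fintype.card ((L.layout r s δ).RowT j) := by
    rw [Fintype.card_sum, Fintype.card_sigma]
  zify
  rw [h3]
  push_cast at h2 ⊢
  linarith

theorem card_Row {r s : Fin K → ℕ} {δ : ℕ}
    (hMe : ∀ j, L.Me j = Fintype.card ((L.layout r s δ).RowT j))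
    (hNe : ∀ i, L.Ne i = Fintype.card ((L.layout r s δ).ColT i)) (j : Fin K) :
    Fintype.card ((L.layout r s δ).Row j) = L.Ms j := by
  have h2 := hMe j
  rw [Me, ← Finset.sum_coe_sort] at h2
  have h3 : Fintype.card ((L.layout r s δ).Row j) = Fintype.card ((L.layout r s δ).RowT j) +
      ∑ i : L.ΩII j, L.Ns i := by
    rw [Fintype.card_sum, Fintype.card_sigma]
    exact congrArg _ (Finset.sum_congr rfl fun i _ => L.card_Col hMe hNe i)
  zify
  rw [h3]
  push_cast at h2 ⊢
  linarith

theorem dvd_Me {δ : ℕ} (hMs : ∀ i, δ ∣ L.Ms i) (hNs : ∀ i, δ ∣ L.Ns i) (j : Fin K) :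
    (δ : ℤ) ∣ L.Me j :=
  dvd_sub (Int.natCast_dvd_natCast.2 (hMs j))
    (Finset.dvd_sum fun i _ => Int.natCast_dvd_natCast.2 (hNs i))

theorem dvd_Ne {δ : ℕ} (hMs : ∀ i, δ ∣ L.Ms i) (hNs : ∀ i, δ ∣ L.Ns i) (i : Fin K) :
    (δ : ℤ) ∣ L.Ne i :=
  dvd_sub (Int.natCast_dvd_natCast.2 (hNs i)) (Finset.dvd_sum fun j _ => L.dvd_Me hMs hNs j)

theorem dZero_const (δ : ℕ) (j : Fin K) :
    L.dZero (fun _ => δ) j = (insert j (L.ΩI j)).card * δ := by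
  have hj : j ∉ L.ΩI j := fun h => by
    have : j ∈ Finset.univ.erase j := by
      rw [← L.union_eq j]
      simp [h]
    simp at this
  rw [dZero, Finset.card_insert_of_notMem hj, Finset.sum_const, smul_eq_mul]
  ring

/-- Divisibility makes `Me` and `Ne` multiples of `δ`, and the first two conditions make the numbers
of spare blocks nonnegative. Every term of the counting condition carries the factor `δ * δ`, which
cancels when `δ` is positive. -/
theorem exists_block_sizes {δ : ℕ} (hMs : ∀ i, δ ∣ L.Ms i) (hNs : ∀ i, δ ∣ L.Ns i)
    (h1 : ∀ i, (δ : ℤ) ≤ L.Ne i) (h2 : ∀ j, (L.dZero (fun _ => δ) j : ℤ) ≤ L.Me j)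
    (h3 : ∀ Ωsub : Finset (Fin K × Fin K), (∀ x ∈ Ωsub, x.2 ∈ L.ΩIV x.1) →
      ∑ x ∈ Ωsub, L.Ccon (fun _ => δ) x.1 x.2 ≤
        ∑ j ∈ Ωsub.image Prod.fst, L.Uvar (fun _ => δ) j +
          ∑ i ∈ Ωsub.image Prod.snd, L.Vvar (fun _ => δ) i) :
    ∃ r s : Fin K → ℕ, (∀ j, L.Me j = ((insert j (L.ΩI j)).card * δ + r j * δ : ℕ)) ∧
      (∀ i, L.Ne i = (δ + s i * δ : ℕ)) ∧
      ∀ Ω : Finset (Fin K × Fin K), (∀ x ∈ Ω, x.2 ∈ L.ΩIV x.1) →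
        ∑ x ∈ Ω, (insert x.1 (L.ΩI x.1)).card ≤
          ∑ j ∈ Ω.image Prod.fst, (insert j (L.ΩI j)).card * r j +
            ∑ i ∈ Ω.image Prod.snd, s i := by
  choose m hm using L.dvd_Me hMs hNs
  choose n hn using L.dvd_Ne hMs hNs
  rcases Nat.eq_zero_or_pos δ with rfl | hδ
  -- For `δ = 0` the counting condition is vacuous and all block sizes are harmless, so `s` is
  -- simply taken large enough.
  · refine ⟨0, fun _ => ∑ x : Fin K × Fin K, (insert x.1 (L.ΩI x.1)).card, fun j => ?_,
      fun i => ?_, fun Ω _ => ?_⟩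
    · simp [hm]
    · simp [hn]
    · rcases Ω.eq_empty_or_nonempty with rfl | ⟨x, hx⟩
      · simp
      · refine le_add_left (le_trans (Finset.sum_le_sum_of_subset (Finset.subset_univ Ω)) ?_)
        exact Finset.single_le_sum (f := fun _ : Fin K =>
          ∑ x : Fin K × Fin K, (insert x.1 (L.ΩI x.1)).card) (fun _ _ => Nat.zero_le _)
          (Finset.mem_image_of_mem Prod.snd hx)
  · have hδ' : (0 : ℤ) < δ := by exact_mod_cast hδ
    have hr : ∀ j, ∃ r : ℕ, m j = (insert j (L.ΩI j)).card + r := by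
      intro j
      have h := h2 j
      rw [hm, dZero_const] at h
      push_cast at h
      have h' : ((insert j (L.ΩI j)).card : ℤ) ≤ m j := by nlinarith
      exact ⟨(m j - (insert j (L.ΩI j)).card).toNat, by omega⟩
    have hs : ∀ i, ∃ s : ℕ, n i = 1 + s := by
      intro i
      have h := h1 i
      rw [hn] at h
      have h' : 1 ≤ n i := by nlinarith
      exact ⟨(n i - 1).toNat, by omega⟩
    choose r hr using hr
    choose s hs using hs
    refine ⟨r, s, fun j => ?_, fun i => ?_, fun Ω hΩ => ?_⟩
    · rw [hm, hr]
      push_cast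
      ring
    · rw [hn, hs]
      push_cast
      ring
    · have h := h3 Ω hΩ
      have hC : ∀ x : Fin K × Fin K, L.Ccon (fun _ => δ) x.1 x.2 =
          (δ * δ : ℤ) * ((insert x.1 (L.ΩI x.1)).card : ℤ) := fun x => by
        rw [Ccon, dZero_const]
        push_cast
        ring
      have hU : ∀ j, L.Uvar (fun _ => δ) j =
          (δ * δ : ℤ) * ((insert j (L.ΩI j)).card * r j : ℕ) := fun j => by
        rw [Uvar, dZero_const, hm, hr]
        push_cast
        ring
      have hV : ∀ i, L.Vvar (fun _ => δ) i = (δ * δ : ℤ) * s i := fun i => by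
        rw [Vvar, hn, hs]
        ring
      simp only [hC, hU, hV, ← Finset.mul_sum] at h
      rw [← mul_add] at h
      have h := le_of_mul_le_mul_left h (mul_pos hδ' hδ')
      exact_mod_cast h

end FeedbackProfile

end InterferenceAlignment

end

theorem corollary1 {K : ℕ} {M N : Fin K → ℕ}
    (L : InterferenceAlignment.FeedbackProfile M N) (d : Fin K → ℕ) (δ : ℕ)
    (hd : ∀ i, d i = δ) (hMs : ∀ i, δ ∣ L.Ms i) (hNs : ∀ i, δ ∣ L.Ns i)
    (h1 : ∀ i, (d i : ℤ) ≤ L.Ne i)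
    (h2 : ∀ j, (L.dZero d j : ℤ) ≤ L.Me j)
    (h3 : ∀ Ωsub : Finset (Fin K × Fin K), (∀ x ∈ Ωsub, x.2 ∈ L.ΩIV x.1) →
      ∑ x ∈ Ωsub, L.Ccon d x.1 x.2 ≤
        ∑ j ∈ Ωsub.image Prod.fst, L.Uvar d j + ∑ i ∈ Ωsub.image Prod.snd, L.Vvar d i) :
    L.AlmostSurelyFeasible d := by
  obtain rfl : d = fun _ => δ := funext hd
  obtain ⟨r, s, hr, hs, hcount⟩ := L.exists_block_sizes hMs hNs h1 h2 h3
  have hMe : ∀ j, L.Me j = Fintype.card ((L.layout r s δ).RowT j) := fun j => by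
    rw [hr, Fintype.card_sum, Fintype.card_prod, Fintype.card_prod, Fintype.card_coe,
      Fintype.card_fin, Fintype.card_fin]
  have hNe : ∀ i, L.Ne i = Fintype.card ((L.layout r s δ).ColT i) := fun i => by
    rw [hs, Fintype.card_sum, Fintype.card_prod, Fintype.card_fin, Fintype.card_fin]
  refine L.almostSurelyFeasible_of_blocks r s δ
    (fun j => Fintype.equivFinOfCardEq (L.card_Row hMe hNe j))
    (fun i => Fintype.equivFinOfCardEq (L.card_Col hMe hNe i)) hMe hNe fun Ω hΩ => ?_
  simp only [Fintype.card_coe]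
  exact hcount Ω fun x hx => (Finset.mem_filter.1 (hΩ hx)).2
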